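/- Let $\mathcal D$ be a nonempty finite domain and let $\Gamma_1,\dots,\Gamma_d$ be fixed finite constraint languages over $\mathcal D$ (each relation carrying its arity), each of which contains the full binary relation $\mathcal D^2$ and is closed under partial assignments: if a constraint has its relation in $\Gamma_i$ and some of its variables are instantiated, then the relation of the reduced constraint is in $\Gamma_i$. Let $\rho$ be the maximum arity of a relation in $\Gamma_1\cup\dots\cup\Gamma_d$. A CSP instance $\mathbf I$ is a finite set of constraints over $\mathcal D$ (each with an explicitly listed relation), and $\mathrm{var}(\mathbf I)$ is the set of its variables. $\mathrm{CSP}(\Gamma_1)\uplus\dots\uplus\mathrm{CSP}(\Gamma_d)$ is the class of all CSP instances that can be partitioned into pairwise variable-disjoint (possibly empty) sub-instances $\mathbf I_1,\dots,\mathbf I_d$ such that all relations of $\mathbf I_i$ are in $\Gamma_i$. A set $B\subseteq\mathrm{var}(\mathbf I)$ is a strong backdoor of $\mathbf I$ if for every assignment $\alpha:B\to\mathcal D$ the reduced instance $\mathbf I|_\alpha$ is in this class. An instance of Extended SBD Compression is a tuple $(\mathbf I,k,S,W)$, where $\mathbf I$ is a CSP instance, $k\ge 0$ is an integer, and $S,W$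 are disjoint sets of variables such that $W\cup S$ is a strong backdoor of $\mathbf I$ of size at most $k+\rho$. A solution is a strong backdoor $Z$ of $\mathbf I$ with $|Z|\le k$, $S\subseteq Z$ and $Z\cap W=\emptyset$. The instance is called non-separating if it has a solution $Z$ such that $W$ is contained in a single connected component of the graph obtained from the incidence graph of $\mathbf I$ (vertices: the variables and the constraints of $\mathbf I$; a variable is adjacent to the constraints whose scope contains it) by deleting the variables in $Z$ (this condition is considered to hold if $W=\emptyset$). Then there is an algorithm that, given any non-separating instance $(\mathbf I,k,S,W)$ of Extended SBD Compression, finds a solution of it in time $2^{\mathcal O(k^2)}\,|\mathbf I|^{\mathcal O(1)}$. Here $|\mathbf I|$ is the encoding length of $\mathbf I$, and the algorithm and the constants hidden in the $\mathcal O$-notation depend only on $\mathcal D$ and $\Gamma_1,\dots,\Gamma_d$. -/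

import Mathlib

namespace SBD

/-! ### Constraint satisfaction over the finite domain `Fin q`, with variables in `ℕ` -/

/-- A relation over `Fin q`, together with its arity: a finite set of tuples of that length. -/
@[ext]
structure Relation (q : ℕ) where
  arity : ℕ
  tuples : Finset (List (Fin q))
  length_eq : ∀ t ∈ tuples, t.length = arity
deriving DecidableEq

/-- The full relation `D ^ n` over the domain `D = Fin q`. -/
def Relation.full (q n : ℕ) : Relation q where
  arity := n
  tuples := Finset.univ.image fun f : Fin n → Fin q => List.ofFn f
  length_eq := by
    intro t ht
    obtain ⟨f, -, rfl⟩ := Finset.mem_image.1 ht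
    simp

/-- A constraint: a sequence of variables (repetitions are allowed) and a relation of the
matching arity, given by its set of tuples. -/
@[ext]
structure Constraint (q : ℕ) where
  scope : List ℕ
  tuples : Finset (List (Fin q))
  length_eq : ∀ t ∈ tuples, t.length = scope.length
deriving DecidableEq

/-- The relation of a constraint. -/
def Constraint.rel {q : ℕ} (C : Constraint q) : Relation q where
  arity := C.scope.length
  tuples := C.tuples
  length_eq := C.length_eq

/-- The set of variables that occur in the scope of a constraint. -/
def Constraint.vars {q : ℕ} (C : Constraint q) : Finset ℕ := C.scope.toFinset

/-- Deleting from a tuple `t` all coordinates that belong to variables in `X`. -/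
def dropCoords {q : ℕ} (X : Finset ℕ) (scope : List ℕ) (t : List (Fin q)) : List (Fin q) :=
  ((scope.zip t).filter fun p => p.1 ∉ X).map Prod.snd

theorem length_dropCoords {q : ℕ} (X : Finset ℕ) (scope : List ℕ) (t : List (Fin q))
    (h : t.length = scope.length) :
    (dropCoords X scope t).length = (scope.filter fun x => x ∉ X).length := by
  induction scope generalizing t with
  | nil => simp [dropCoords]
  | cons x s ih =>
    cases t with
    | nil => simp at h
    | cons a t =>
      have := ih t (by simpa using h)
      by_cases hx : x ∈ X <;> simp_all [dropCoords]

/-- The constraint `C|_α` for the assignment `α` with domain `X`: tuples that contradict `α` on `X`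
are deleted, and then the variables in `X` and their coordinates are removed. (The values of `α`
outside `X` are ignored; as the domain is nonempty, every assignment `X → Fin q` arises.) -/
def Constraint.restrict {q : ℕ} (C : Constraint q) (X : Finset ℕ) (α : ℕ → Fin q) :
    Constraint q where
  scope := C.scope.filter fun x => x ∉ X
  tuples := (C.tuples.filter fun t => ∀ p ∈ C.scope.zip t, p.1 ∈ X → α p.1 = p.2).image
    (dropCoords X C.scope)
  length_eq := by
    intro t ht
    obtain ⟨u, hu, rfl⟩ := Finset.mem_image.1 ht
    exact length_dropCoords X C.scope u (C.length_eq u (Finset.mem_filter.1 hu).1)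

/-- A CSP instance: a finite set of constraints. -/
abbrev Instance (q : ℕ) := Finset (Constraint q)

/-- The variables of an instance. -/
def Instance.vars {q : ℕ} (I : Instance q) : Finset ℕ := I.biUnion Constraint.vars

/-- The instance `I|_α` for the assignment `α` with domain `X`. -/
def Instance.restrict {q : ℕ} (I : Instance q) (X : Finset ℕ) (α : ℕ → Fin q) : Instance q :=
  I.image fun C => C.restrict X α

/-- The class `CSP(Γ)` of all instances whose relations belong to the finite language `Γ`. -/
def CSP {q : ℕ} (Γ : Finset (Relation q)) : Set (Instance q) :=
  {I | ∀ C ∈ I, C.rel ∈ Γ}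

/-- A language is closed under (partial) assignments. -/
def ClosedUnderAssignments {q : ℕ} (Γ : Finset (Relation q)) : Prop :=
  ∀ (C : Constraint q) (X : Finset ℕ) (α : ℕ → Fin q), C.rel ∈ Γ → (C.restrict X α).rel ∈ Γ

/-- The scattered class `H 0 ⊎ ⋯ ⊎ H (d - 1)`: all instances that can be partitioned into pairwise
variable disjoint (possibly empty) sub-instances `P i ∈ H i`. -/
def scattered {q d : ℕ} (H : Fin d → Set (Instance q)) : Set (Instance q) :=
  {I | ∃ P : Fin d → Instance q,
    (∀ C, C ∈ I ↔ ∃ i, C ∈ P i) ∧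
    (∀ i j, i ≠ j → Disjoint (P i) (P j)) ∧
    (∀ i j, i ≠ j → Disjoint (P i).vars (P j).vars) ∧
    ∀ i, P i ∈ H i}

/-- `B` is a strong backdoor of `I` into the class `H`. -/
def IsStrongBackdoor {q : ℕ} (H : Set (Instance q)) (I : Instance q) (B : Finset ℕ) : Prop :=
  B ⊆ I.vars ∧ ∀ α : ℕ → Fin q, I.restrict B α ∈ H

/-- The incidence graph of `I` after deletion of the variables in `Z`. Its vertices are the
variables of `I` outside `Z` and the constraints of `I`; all other elements of the ambient vertex
type are isolated. -/
def incidenceGraph {q : ℕ} (I : Instance q) (Z : Finset ℕ) :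
    SimpleGraph (ℕ ⊕ Constraint q) where
  Adj u v := ∃ x, ∃ C ∈ I, x ∈ C.vars ∧ x ∉ Z ∧
    ((u = Sum.inl x ∧ v = Sum.inr C) ∨ (u = Sum.inr C ∧ v = Sum.inl x))
  symm := ⟨by
    rintro u v ⟨x, C, hC, hx, hZ, h⟩
    exact ⟨x, C, hC, hx, hZ, h.symm.imp And.symm And.symm⟩⟩
  loopless := ⟨by
    rintro u ⟨x, C, -, -, -, ⟨h, h'⟩ | ⟨h, h'⟩⟩ <;> simp [h] at h'⟩

/-! ### Extended SBD Compression -/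

/-- The scattered class `CSP(Γ 0) ⊎ ⋯ ⊎ CSP(Γ (d - 1))`. -/
def scatteredCSP {q d : ℕ} (Γ : Fin d → Finset (Relation q)) : Set (Instance q) :=
  scattered fun i => CSP (Γ i)

/-- The maximum arity of a relation in one of the languages. -/
def maxArity {q d : ℕ} (Γ : Fin d → Finset (Relation q)) : ℕ :=
  Finset.univ.sup fun i => (Γ i).sup Relation.arity

/-- `(I, k, S, W)` is an instance of Extended SBD Compression. -/
def IsExtInstance {q d : ℕ} (Γ : Fin d → Finset (Relation q)) (I : Instance q) (k : ℕ)
    (S W : Finset ℕ) : Prop :=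
  Disjoint S W ∧ IsStrongBackdoor (scatteredCSP Γ) I (W ∪ S) ∧ (W ∪ S).card ≤ k + maxArity Γ

/-- `Z` is a solution of the instance `(I, k, S, W)`. -/
def IsSolution {q d : ℕ} (Γ : Fin d → Finset (Relation q)) (I : Instance q) (k : ℕ)
    (S W Z : Finset ℕ) : Prop :=
  IsStrongBackdoor (scatteredCSP Γ) I Z ∧ Z.card ≤ k ∧ S ⊆ Z ∧ Disjoint Z W

/-- `(I, k, S, W)` is a non-separating instance: an instance with a solution `Z` such that `W` lies
in one connected component of the incidence graph after deletion of `Z`. -/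
def IsNonSeparatingInstance {q d : ℕ} (Γ : Fin d → Finset (Relation q)) (I : Instance q) (k : ℕ)
    (S W : Finset ℕ) : Prop :=
  IsExtInstance Γ I k S W ∧
    ∃ Z, IsSolution Γ I k S W Z ∧
      ∀ v ∈ W, ∀ w ∈ W, (incidenceGraph I Z).Reachable (Sum.inl v) (Sum.inl w)

/-! ### Model of computation

Programs work on binary trees, built from a leaf and pairs; they can form and take apart pairs,
test for the leaf, compose, and loop. There are no primitives on numbers and no comparison of trees.
Every elementary operation is charged the number of nodes of the trees that it handles, so no value
that arises is larger than the input or the time spent so far, and the model and multi-tape Turing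
machines simulate each other with polynomial overhead. -/

/-- Binary trees. -/
inductive Data : Type
  | nil : Data
  | pair : Data → Data → Data

namespace Data

/-- The number of nodes of a tree. -/
def size : Data → ℕ
  | nil => 1
  | pair a b => a.size + b.size + 1

/-- The left subtree. -/
def left : Data → Data
  | nil => nil
  | pair a _ => a

/-- The right subtree. -/
def right : Data → Data
  | nil => nil
  | pair _ b => b

/-- A list of trees as a tree. -/
def ofList : List Data → Data
  | [] => nil
  | a :: l => pair a (ofList l)

/-- A natural number in binary, least significant bit first. -/
def ofNat (n : ℕ) : Data :=
  ofList (n.bits.map fun b => if b then pair nil nil else nil)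

/-- A natural number in unary. -/
def unary (n : ℕ) : Data :=
  ofList (List.replicate n nil)

end Data

/-- Programs. -/
inductive Program : Type
  | id : Program
  | nil : Program
  | left : Program
  | right : Program
  | pair : Program → Program → Program
  | comp : Program → Program → Program
  | ite : Program → Program → Program → Program
  | loop : Program → Program

/-- `Eval p x y t`: on input `x` the program `p` halts with output `y` in time `t`.
`comp f g` runs `g` and then `f`. `ite c f g` runs `f` if the output of `c` is a pair and `g` if it
is the leaf. `loop f` runs `f`; if the left part of the output is a pair, it repeats with the right
part as the new input, and otherwise it halts with the right part as output. -/
inductive Eval : Program → Data → Data → ℕ → Prop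
  | id (x : Data) : Eval .id x x x.size
  | nil (x : Data) : Eval .nil x .nil 1
  | left (x : Data) : Eval .left x x.left x.size
  | right (x : Data) : Eval .right x x.right x.size
  | pair {f g : Program} {x a b : Data} {s t : ℕ} :
      Eval f x a s → Eval g x b t → Eval (.pair f g) x (.pair a b) (s + t + (Data.pair a b).size)
  | comp {f g : Program} {x y z : Data} {s t : ℕ} :
      Eval g x y s → Eval f y z t → Eval (.comp f g) x z (s + t + 1)
  | ite_pair {c f g : Program} {x a b y : Data} {s t : ℕ} :
      Eval c x (.pair a b) s → Eval f x y t → Eval (.ite c f g) x y (s + t + 1)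
  | ite_nil {c f g : Program} {x y : Data} {s t : ℕ} :
      Eval c x .nil s → Eval g x y t → Eval (.ite c f g) x y (s + t + 1)
  | loop_stop {f : Program} {x y : Data} {s : ℕ} :
      Eval f x y s → y.left = .nil → Eval (.loop f) x y.right (s + 1)
  | loop_step {f : Program} {x y z : Data} {s t : ℕ} :
      Eval f x y s → y.left ≠ .nil → Eval (.loop f) y.right z t → Eval (.loop f) x z (s + t + 1)

/-- Programs are deterministic: output and running time are determined by the input. -/
theorem Eval.unique {p : Program} {x y y' : Data} {t t' : ℕ} (h : Eval p x y t)
    (h' : Eval p x y' t') : y = y' ∧ t = t' := by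
  induction h generalizing y' t' with
  | id x => cases h'; exact ⟨rfl, rfl⟩
  | nil x => cases h'; exact ⟨rfl, rfl⟩
  | left x => cases h'; exact ⟨rfl, rfl⟩
  | right x => cases h'; exact ⟨rfl, rfl⟩
  | pair _ _ ih₁ ih₂ =>
    cases h' with
    | pair h₁ h₂ =>
      obtain ⟨rfl, rfl⟩ := ih₁ h₁
      obtain ⟨rfl, rfl⟩ := ih₂ h₂
      exact ⟨rfl, rfl⟩
  | comp _ _ ih₁ ih₂ =>
    cases h' with
    | comp h₁ h₂ =>
      obtain ⟨rfl, rfl⟩ := ih₁ h₁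
      obtain ⟨rfl, rfl⟩ := ih₂ h₂
      exact ⟨rfl, rfl⟩
  | ite_pair _ _ ih₁ ih₂ =>
    cases h' with
    | ite_pair h₁ h₂ =>
      obtain ⟨-, rfl⟩ := ih₁ h₁
      obtain ⟨rfl, rfl⟩ := ih₂ h₂
      exact ⟨rfl, rfl⟩
    | ite_nil h₁ h₂ => exact absurd (ih₁ h₁).1 (by simp)
  | ite_nil _ _ ih₁ ih₂ =>
    cases h' with
    | ite_pair h₁ h₂ => exact absurd (ih₁ h₁).1 (by simp)
    | ite_nil h₁ h₂ =>
      obtain ⟨-, rfl⟩ := ih₁ h₁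
      obtain ⟨rfl, rfl⟩ := ih₂ h₂
      exact ⟨rfl, rfl⟩
  | loop_stop _ hy ih =>
    cases h' with
    | loop_stop h₁ _ =>
      obtain ⟨rfl, rfl⟩ := ih h₁
      exact ⟨rfl, rfl⟩
    | loop_step h₁ hn _ =>
      obtain ⟨rfl, -⟩ := ih h₁
      exact absurd hy hn
  | loop_step _ hn _ ih₁ ih₂ =>
    cases h' with
    | loop_stop h₁ hy =>
      obtain ⟨rfl, -⟩ := ih₁ h₁
      exact absurd hy hn
    | loop_step h₁ _ h₂ =>
      obtain ⟨rfl, rfl⟩ := ih₁ h₁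
      obtain ⟨rfl, rfl⟩ := ih₂ h₂
      exact ⟨rfl, rfl⟩

/-! ### Encodings -/

/-- `x` encodes the finite set `s`: it lists the elements of `s` in some order, without repetition,
each of them by one of its encodings with respect to `e`. -/
def EncodesFinset {α : Type} (e : α → Data → Prop) (s : Finset α) (x : Data) : Prop :=
  ∃ (l : List α) (xs : List Data),
    (l : Multiset α) = s.val ∧ List.Forall₂ e l xs ∧ x = Data.ofList xs

/-- `x` encodes the finite set `S` of variables, as a list of binary numbers. -/
def EncodesVars (S : Finset ℕ) (x : Data) : Prop :=
  EncodesFinset (fun v y => y = Data.ofNat v) S x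

/-- `x` encodes the constraint `C`, as the list of its scope paired with a list of its tuples. -/
def EncodesConstraint {q : ℕ} (C : Constraint q) (x : Data) : Prop :=
  ∃ r, EncodesFinset (fun (t : List (Fin q)) y =>
      y = Data.ofList (t.map fun a => Data.ofNat (a : ℕ))) C.tuples r ∧
    x = .pair (Data.ofList (C.scope.map Data.ofNat)) r

/-- `x` encodes the CSP instance `I`, as a list of its constraints. -/
def EncodesInstance {q : ℕ} (I : Instance q) (x : Data) : Prop :=
  EncodesFinset EncodesConstraint I x

end SBD

/-!
Call a constraint linked to `W` if it can be reached from a constraint with a variable in `W`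
through common variables outside `Z`, and call `Z` good if, for every assignment of `Z`, the reducts
of all constraints linked to `W` have their relations in one of the languages. A solution `Z` that
leaves `W` in one connected component is good (`IsStrongBackdoor.isGood`). Conversely, a good set
that contains `S` is a strong backdoor, as the constraints that are not linked to `W` are dealt with
by the given backdoor `W ∪ S` (`IsGood.isStrongBackdoor`). So it suffices to extend `S` to a good
set of at most `k` variables that is disjoint from `W`.

If `S` is not good, then some assignment of `S` comes with a violating linked constraint for each
language. If `Z` is a good set that contains `S`, then for an extension of this assignment to `Z`
the reducts of all linked constraints belong to one of the languages. The violating constraint for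
this language either contains one of the at most `ρ` variables that can be added to `S`, or is cut
off from `W` by `Z`. In the latter case a set `A` of constraints is to be separated from `W`. The
number of boundary variables of a set of constraints is submodular, so the largest set `R` with the
fewest boundary variables among those that contain `A` and avoid `W` may be assumed to be cut off as
a whole (`IsGood.exists_separating`). Let `v` be a boundary variable of `R`. Either `v` is in the
backdoor, or all constraints that contain `v` are cut off as well, and then more variables are
needed to separate the enlarged set, because `R` was the largest minimum. The backdoor grows at most
`k` times, and between two such events the cut grows at most `k` times. Hence a solution is reached
after at most `k * (k + 2)` choices among a bounded number of options
(`IsPromising.exists_accepts`), and the algorithm tries all sequences of choices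
(`findBackdoor_spec`).

Minimum cuts are found by reversing paths: if a path from `A` to `T` is reversed, then every set
between `A` and `T` loses exactly one leaving arc (`exists_cut_residual`), and once there is no such
path, the nodes from which `T` cannot be reached form the largest minimum cut (`sinkSide_spec`).

For the running time, `PolyTime` is closed under composition, the usual operations on lists, and
folds whose intermediate results are polynomially bounded (`PolyTime.foldl`); `fun_prop` derives
that the search with given lists of assignments and of sequences of choices is polynomial. These
lists are the only exponential part; they have size `2 ^ O(k ^ 2)` (`exists_program_words`).
-/

namespace SBD

/-! ### Polynomial-time computable functions -/

theorem Data.size_pos (x : Data) : 0 < x.size := by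
  cases x <;> simp [Data.size]

theorem Eval.size_le {p : Program} {x y : Data} {t : ℕ} (h : Eval p x y t) : y.size ≤ t := by
  induction h with
  | id x => exact le_rfl
  | nil x => simp [Data.size]
  | left x => cases x <;> simp [Data.size, Data.left]; omega
  | right x => cases x <;> simp [Data.size, Data.right]; omega
  | pair _ _ ih₁ ih₂ => simp only [Data.size]; omega
  | comp _ _ ih₁ ih₂ => omega
  | ite_pair _ _ ih₁ ih₂ => omega
  | ite_nil _ _ ih₁ ih₂ => omega
  | loop_stop _ _ ih =>
    rename_i y _ _ _
    have : y.right.size ≤ y.size := by cases y <;> simp [Data.size, Data.right]; omega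
    omega
  | loop_step _ _ _ ih₁ ih₂ => omega

/-- Types whose elements are represented by trees. -/
class Coded (α : Type) where
  /-- The tree that represents an element. -/
  code : α → Data

open Coded (code)

instance : Coded Data := ⟨fun x => x⟩
instance : Coded Unit := ⟨fun _ => .nil⟩
instance : Coded Bool := ⟨fun b => if b then .pair .nil .nil else .nil⟩
instance : Coded ℕ := ⟨Data.ofNat⟩
instance {q : ℕ} : Coded (Fin q) := ⟨fun a => Data.ofNat a⟩

section Coded

variable {α β γ ε σ : Type} [Coded α] [Coded β] [Coded γ] [Coded ε] [Coded σ]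

instance : Coded (List α) := ⟨fun l => Data.ofList (l.map code)⟩
instance : Coded (α × β) := ⟨fun a => .pair (code a.1) (code a.2)⟩

/-- The size of the tree that represents an element. -/
def csize (a : α) : ℕ := (code a).size

theorem csize_pos (a : α) : 0 < csize a := Data.size_pos _

@[simp] theorem csize_nil : csize ([] : List α) = 1 := rfl
@[simp] theorem csize_cons (a : α) (l : List α) : csize (a :: l) = csize a + csize l + 1 := rfl
@[simp] theorem csize_pair (a : α) (b : β) : csize (a, b) = csize a + csize b + 1 := rfl

theorem csize_append (l m : List α) : csize (l ++ m) + 1 = csize l + csize m := by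
  induction l with
  | nil => simp; omega
  | cons a l ih => simp; omega

theorem length_lt_csize (l : List α) : l.length < csize l := by
  induction l with
  | nil => simp
  | cons a l ih => simp; omega

theorem csize_le_of_mem {a : α} {l : List α} (h : a ∈ l) : csize a ≤ csize l := by
  induction l with
  | nil => simp at h
  | cons b l ih =>
    rcases List.mem_cons.1 h with rfl | h
    · simp; omega
    · have := ih h; simp; omega

theorem csize_le_of_sublist {l m : List α} (h : l.Sublist m) : csize l ≤ csize m := by
  induction h with
  | slnil => rfl
  | cons a _ ih => simp; omega
  | cons_cons a _ ih => simp; omega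

theorem csize_reverse (l : List α) : csize l.reverse = csize l := by
  induction l with
  | nil => rfl
  | cons a l ih => have := csize_append l.reverse [a]; simp at this ⊢; omega

theorem csize_le_of_forall {l : List α} {M : ℕ} (h : ∀ a ∈ l, csize a ≤ M) :
    csize l ≤ l.length * (M + 1) + 1 := by
  induction l with
  | nil => simp
  | cons b l ih =>
    have h₁ := h b (by simp)
    have h₂ := ih fun a ha => h a (by simp [ha])
    simp [add_mul]; omega

/-- The function `g` is bounded by a polynomial in the size of its argument. -/
def PolyBounded (g : α → ℕ) : Prop := ∃ c, ∀ a, g a ≤ c * csize a ^ c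

theorem PolyBounded.of_le {g g' : α → ℕ} (h : PolyBounded g') (hg : ∀ a, g a ≤ g' a) :
    PolyBounded g :=
  let ⟨c, hc⟩ := h
  ⟨c, fun a => (hg a).trans (hc a)⟩

theorem PolyBounded.const (n : ℕ) : PolyBounded fun _ : α => n :=
  ⟨n, fun a => Nat.le_mul_of_pos_right _ (Nat.pow_pos (csize_pos a))⟩

theorem PolyBounded.csize : PolyBounded fun a : α => csize a := ⟨1, fun a => by simp⟩

theorem PolyBounded.add {g g' : α → ℕ} (h : PolyBounded g) (h' : PolyBounded g') :
    PolyBounded fun a => g a + g' a := by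
  obtain ⟨c, hc⟩ := h
  obtain ⟨c', hc'⟩ := h'
  refine ⟨c + c', fun a => (Nat.add_le_add (hc a) (hc' a)).trans ?_⟩
  rw [add_mul]
  exact Nat.add_le_add (Nat.mul_le_mul le_rfl (Nat.pow_le_pow_right (csize_pos a) (by omega)))
    (Nat.mul_le_mul le_rfl (Nat.pow_le_pow_right (csize_pos a) (by omega)))

theorem PolyBounded.mul {g g' : α → ℕ} (h : PolyBounded g) (h' : PolyBounded g') :
    PolyBounded fun a => g a * g' a := by
  obtain ⟨c, hc⟩ := h
  obtain ⟨c', hc'⟩ := h'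
  refine ⟨c * c' + (c + c'), fun a => (Nat.mul_le_mul (hc a) (hc' a)).trans ?_⟩
  calc c * SBD.csize a ^ c * (c' * SBD.csize a ^ c') = c * c' * SBD.csize a ^ (c + c') := by ring
    _ ≤ _ := Nat.mul_le_mul (by omega) (Nat.pow_le_pow_right (csize_pos a) (by omega))

theorem PolyBounded.pow {g : α → ℕ} (h : PolyBounded g) (n : ℕ) :
    PolyBounded fun a => g a ^ n := by
  induction n with
  | zero => simpa using PolyBounded.const 1
  | succ n ih => simpa [pow_succ] using ih.mul h

theorem PolyBounded.comp {g : β → ℕ} (hg : PolyBounded g) {f : α → β}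
    (hf : PolyBounded fun a => SBD.csize (f a)) : PolyBounded fun a => g (f a) := by
  obtain ⟨c, hc⟩ := hg
  exact ((PolyBounded.const c).mul (hf.pow c)).of_le fun a => hc (f a)

/-- A function is polynomial-time computable if some program maps the representation of each
argument to that of the value, in time polynomial in the size of the argument. -/
@[fun_prop]
def PolyTime (f : α → β) : Prop :=
  ∃ (p : Program) (T : α → ℕ), PolyBounded T ∧ ∀ a, ∃ t ≤ T a, Eval p (code a) (code (f a)) t

namespace PolyTime

theorem polyBounded_csize {f : α → β} (h : PolyTime f) : PolyBounded fun a => csize (f a) := by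
  obtain ⟨p, T, hT, h⟩ := h
  refine hT.of_le fun a => ?_
  obtain ⟨t, ht, he⟩ := h a
  exact he.size_le.trans ht

/-- A function that does not change the representation is computed by the identity program. -/
theorem of_code_eq {f : α → β} (h : ∀ a, code (f a) = code a) : PolyTime f :=
  ⟨.id, fun a => csize a, .csize, fun a => ⟨_, le_rfl, by rw [h]; exact .id _⟩⟩

/-- Polynomial-time computability depends on the represented values only. -/
theorem congr_code {f : α → β} {g : α → γ} (hg : PolyTime g) (h : ∀ a, code (f a) = code (g a)) :
    PolyTime f := by
  obtain ⟨p, T, hT, hp⟩ := hg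
  exact ⟨p, T, hT, fun a => by rw [h]; exact hp a⟩

@[fun_prop]
protected theorem id : PolyTime fun a : α => a := of_code_eq fun _ => rfl

@[fun_prop]
protected theorem comp {g : β → γ} {f : α → β} (hg : PolyTime g) (hf : PolyTime f) :
    PolyTime fun a => g (f a) := by
  have hb := hf.polyBounded_csize
  obtain ⟨p, T, hT, hp⟩ := hf
  obtain ⟨p', T', hT', hp'⟩ := hg
  refine ⟨.comp p' p, _, (hT.add (hT'.comp hb)).add (.const 1), fun a => ?_⟩
  obtain ⟨t, ht, he⟩ := hp a
  obtain ⟨t', ht', he'⟩ := hp' (f a)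
  exact ⟨_, by omega, .comp he he'⟩

@[fun_prop]
theorem prodMk {f : α → β} {g : α → γ} (hf : PolyTime f) (hg : PolyTime g) :
    PolyTime fun a => (f a, g a) := by
  obtain ⟨p, T, hT, hp⟩ := hf
  obtain ⟨p', T', hT', hp'⟩ := hg
  refine ⟨.pair p p', _, ((hT.add hT').mul (.const 2)).add (.const 1), fun a => ?_⟩
  obtain ⟨t, ht, he⟩ := hp a
  obtain ⟨t', ht', he'⟩ := hp' a
  refine ⟨_, ?_, .pair he he'⟩
  have := he.size_le
  have := he'.size_le
  simp only [Data.size]; omega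

@[fun_prop]
theorem fst {f : α → β × γ} (hf : PolyTime f) : PolyTime fun a => (f a).1 :=
  PolyTime.comp (g := Prod.fst)
    ⟨.left, fun a => csize a, .csize, fun a => ⟨_, le_rfl, .left (code a)⟩⟩ hf

@[fun_prop]
theorem snd {f : α → β × γ} (hf : PolyTime f) : PolyTime fun a => (f a).2 :=
  PolyTime.comp (g := Prod.snd)
    ⟨.right, fun a => csize a, .csize, fun a => ⟨_, le_rfl, .right (code a)⟩⟩ hf

@[fun_prop]
protected theorem const (b : β) : PolyTime fun _ : α => b := by
  suffices h : ∀ x : Data, PolyTime fun _ : α => x from (h (code b)).congr_code fun _ => rfl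
  intro x
  induction x with
  | nil => exact ⟨.nil, fun _ => 1, .const 1, fun a => ⟨_, le_rfl, .nil _⟩⟩
  | pair x y hx hy => exact (hx.prodMk hy).congr_code fun _ => rfl

/-- Case distinction on whether a tree is a pair. The result `r` is described by two implications,
so that it may be given by any kind of case distinction. -/
theorem dite_nil {c : α → Data} {f g r : α → β} (hc : PolyTime c) (hf : PolyTime f)
    (hg : PolyTime g) (h₁ : ∀ a, c a = .nil → r a = g a) (h₂ : ∀ a, c a ≠ .nil → r a = f a) :
    PolyTime r := by
  obtain ⟨p, T, hT, hp⟩ := hf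
  obtain ⟨p', T', hT', hp'⟩ := hg
  obtain ⟨p'', T'', hT'', hp''⟩ := hc
  refine ⟨.ite p'' p p', _, ((hT.add hT').add hT'').add (.const 1), fun a => ?_⟩
  obtain ⟨t, ht, he⟩ := hp a
  obtain ⟨t', ht', he'⟩ := hp' a
  obtain ⟨t'', ht'', he''⟩ := hp'' a
  change Eval p'' (code a) (c a) t'' at he''
  cases h : c a with
  | nil =>
    rw [h₁ a h]
    rw [h] at he''
    exact ⟨_, by omega, .ite_nil he'' he'⟩
  | pair x y =>
    rw [h₂ a (by simp [h])]
    rw [h] at he''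
    exact ⟨_, by omega, .ite_pair he'' he⟩

@[fun_prop]
protected theorem cond {c : α → Bool} {f g : α → β} (hc : PolyTime c) (hf : PolyTime f)
    (hg : PolyTime g) : PolyTime fun a => bif c a then f a else g a := by
  refine dite_nil (c := fun a => code (c a)) (hc.congr_code fun _ => rfl) hf hg ?_ ?_ <;>
  · intro a h
    cases hca : c a <;> simp_all [code]

@[fun_prop]
theorem not {c : α → Bool} (hc : PolyTime c) : PolyTime fun a => !(c a) := by
  have := hc.cond (.const false) (.const true)
  refine this.congr_code fun a => ?_
  cases c a <;> rfl

@[fun_prop]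
theorem and {c d : α → Bool} (hc : PolyTime c) (hd : PolyTime d) :
    PolyTime fun a => (c a && d a) := by
  have := hc.cond hd (.const false)
  refine this.congr_code fun a => ?_
  cases c a <;> rfl

@[fun_prop]
theorem or {c d : α → Bool} (hc : PolyTime c) (hd : PolyTime d) :
    PolyTime fun a => (c a || d a) := by
  have := hc.cond (.const true) hd
  refine this.congr_code fun a => ?_
  cases c a <;> rfl

@[fun_prop]
theorem cons {f : α → β} {g : α → List β} (hf : PolyTime f) (hg : PolyTime g) :
    PolyTime fun a => f a :: g a := (hf.prodMk hg).congr_code fun _ => rfl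

@[fun_prop]
theorem isEmpty {f : α → List β} (hf : PolyTime f) : PolyTime fun a => (f a).isEmpty := by
  refine dite_nil (c := fun a => code (f a)) (hf.congr_code fun _ => rfl) (.const false)
    (.const true) ?_ ?_ <;>
  · intro a h
    cases hca : f a <;> simp_all [code, Data.ofList]

@[fun_prop]
theorem tail {f : α → List β} (hf : PolyTime f) : PolyTime fun a => (f a).tail :=
  PolyTime.comp (g := List.tail)
    ⟨.right, fun a => csize a, .csize, fun a => ⟨_, le_rfl, by
      have := Eval.right (code a)
      cases a <;> exact this⟩⟩ hf

@[fun_prop]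
theorem headD {f : α → List β} (hf : PolyTime f) {g : α → β} (hg : PolyTime g) :
    PolyTime fun a => (f a).headD (g a) := by
  have h : PolyTime fun a => (code (f a)).left := PolyTime.comp
    (g := fun l : List β => (code l).left)
    ⟨.left, fun a => csize a, .csize, fun a => ⟨_, le_rfl, .left (code a)⟩⟩ hf
  have := dite_nil (c := fun a => code (f a)) (r := fun a => code ((f a).headD (g a)))
    (hf.congr_code fun _ => rfl) h (hg.congr_code (g := g) (f := fun a => code (g a)) fun _ => rfl)
    (fun a h => by cases hca : f a <;> simp_all [code, Data.ofList])
    (fun a h => by cases hca : f a <;> simp_all [code, Data.ofList, Data.left])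
  exact this.congr_code fun _ => rfl

end PolyTime
end Coded

/-! ### Loops over lists -/

section Loops

variable {α β γ ε σ : Type} [Coded α] [Coded β] [Coded γ] [Coded ε] [Coded σ]

/-- A fold over a list is computed in time polynomial in any bound `M` on the sizes of the input and
of all intermediate results. -/
theorem PolyTime.exists_program_foldl {h : ε → σ → α → σ}
    (hh : PolyTime fun y : ε × σ × α => h y.1 y.2.1 y.2.2) :
    ∃ (p : Program) (c : ℕ), ∀ (e : ε) (l : List α) (s : σ) (M : ℕ), csize e ≤ M → csize l ≤ M →
      (∀ l', l' <+: l → csize (l'.foldl (h e) s) ≤ M) →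
      ∃ t ≤ c * M ^ c, Eval p (code (e, l, s)) (code (l.foldl (h e) s)) t := by
  -- One pass of the loop, on the state `(e, l, s)`.
  have hbody : PolyTime fun y : ε × List α × σ => match y.2.1 with
      | [] => Data.pair .nil (code y.2.2)
      | a :: l => Data.pair (.pair .nil .nil) (code (y.1, l, h y.1 y.2.2 a)) := by
    have h0 : PolyTime fun y : ε × List α × σ => Data.pair .nil (code y.2.2) :=
      PolyTime.congr_code (g := fun y : ε × List α × σ => (Data.nil, y.2.2)) (by fun_prop)
        fun _ => rfl
    rcases isEmpty_or_nonempty α with hα | ⟨⟨a₀⟩⟩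
    · refine h0.congr_code ?_
      rintro ⟨e, l, s⟩
      cases l with
      | nil => rfl
      | cons a l => exact (hα.false a).elim
    · have h1 : PolyTime fun y : ε × List α × σ =>
          (Data.pair .nil .nil, y.1, y.2.1.tail, h y.1 y.2.2 (y.2.1.headD a₀)) := by
        have := hh.comp (f := fun y : ε × List α × σ => (y.1, y.2.2, y.2.1.headD a₀))
          (.prodMk (by fun_prop) (.prodMk (by fun_prop) (.headD (by fun_prop) (by fun_prop))))
        exact .prodMk (by fun_prop) (.prodMk (by fun_prop) (.prodMk (by fun_prop) this))
      refine PolyTime.dite_nil (c := fun y : ε × List α × σ => code y.2.1)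
        (PolyTime.congr_code (g := fun y : ε × List α × σ => y.2.1) (by fun_prop) fun _ => rfl)
        (h1.congr_code (f := fun y : ε × List α × σ => Data.pair (.pair .nil .nil)
          (code (y.1, y.2.1.tail, h y.1 y.2.2 (y.2.1.headD a₀)))) fun _ => rfl) h0 ?_ ?_
      · rintro ⟨e, l, s⟩ hl
        cases l with
        | nil => rfl
        | cons a l => cases hl
      · rintro ⟨e, l, s⟩ hl
        cases l with
        | nil => exact (hl rfl).elim
        | cons a l => rfl
  obtain ⟨p, T, ⟨c, hc⟩, hp⟩ := hbody
  have key : ∀ (e : ε) (M : ℕ) (l : List α) (s : σ), csize e ≤ M → csize l ≤ M →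
      (∀ l', l' <+: l → csize (l'.foldl (h e) s) ≤ M) →
      ∃ t ≤ csize l * (c * (3 * M + 2) ^ c + 1),
        Eval (.loop p) (code (e, l, s)) (code (l.foldl (h e) s)) t := by
    intro e M l
    induction l with
    | nil =>
      intro s he hl hs
      obtain ⟨t, ht, hE⟩ := hp (e, [], s)
      refine ⟨t + 1, ?_, Eval.loop_stop hE rfl⟩
      have h₁ : csize s ≤ M := hs [] (List.nil_prefix)
      have h₂ : csize (e, ([] : List α), s) ≤ 3 * M + 2 := by simp at hl ⊢; omega
      have h₃ := ht.trans ((hc _).trans (Nat.mul_le_mul le_rfl (Nat.pow_le_pow_left h₂ c)))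
      simp; omega
    | cons a l ih =>
      intro s he hl hs
      obtain ⟨t, ht, hE⟩ := hp (e, a :: l, s)
      have h₁ : csize s ≤ M := hs [] (List.nil_prefix)
      have h₂ : csize (e, a :: l, s) ≤ 3 * M + 2 := by simp at hl ⊢; omega
      have h₃ := ht.trans ((hc _).trans (Nat.mul_le_mul le_rfl (Nat.pow_le_pow_left h₂ c)))
      obtain ⟨t', ht', hE'⟩ := ih (h e s a) he (by simp at hl; omega) (by
        intro l' hl'
        exact hs (a :: l') (List.prefix_cons_inj a |>.2 hl'))
      refine ⟨t + t' + 1, ?_, .loop_step hE (by simp [code, Data.left]) hE'⟩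
      rw [csize_cons, add_mul, add_mul]
      omega
  refine ⟨.loop p, c * 5 ^ c + 1 + (c + 1), fun e l s M he hl hs => ?_⟩
  obtain ⟨t, ht, hE⟩ := key e M l s he hl hs
  refine ⟨t, ht.trans ?_, hE⟩
  have hM : 0 < M := (csize_pos e).trans_le he
  calc csize l * (c * (3 * M + 2) ^ c + 1)
      ≤ M * (c * (5 * M) ^ c + 1 * M ^ c) := by
        refine Nat.mul_le_mul hl (Nat.add_le_add (Nat.mul_le_mul le_rfl
          (Nat.pow_le_pow_left (by omega) c)) ?_)
        have := Nat.pow_pos (n := c) hM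
        omega
    _ = (c * 5 ^ c + 1) * M ^ (c + 1) := by rw [mul_pow]; ring
    _ ≤ _ := Nat.mul_le_mul (by omega) (Nat.pow_le_pow_right hM (by omega))

namespace PolyTime

/-- A fold whose intermediate results are polynomially bounded is computable in polynomial time. -/
protected theorem foldl {l : ε → List α} {s : ε → σ} {h : ε → σ → α → σ} (hl : PolyTime l)
    (hs : PolyTime s) (hh : PolyTime fun y : ε × σ × α => h y.1 y.2.1 y.2.2) {b : ε → ℕ}
    (hb : PolyBounded b) (hle : ∀ e l', l' <+: l e → csize (l'.foldl (h e) (s e)) ≤ b e) :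
    PolyTime fun e => (l e).foldl (h e) (s e) := by
  obtain ⟨p, c, hp⟩ := exists_program_foldl hh
  have hin : PolyTime fun e => (e, l e, s e) := by fun_prop
  have hb' := hl.polyBounded_csize
  obtain ⟨p₀, T₀, hT₀, hp₀⟩ := hin
  refine ⟨.comp p p₀, _, (hT₀.add ((PolyBounded.const c).mul
    (((PolyBounded.csize.add hb').add hb).pow c))).add (.const 1), fun e => ?_⟩
  obtain ⟨t₀, ht₀, hE₀⟩ := hp₀ e
  obtain ⟨t, ht, hE⟩ := hp e (l e) (s e) (csize e + csize (l e) + b e) (by omega) (by omega)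
    fun l' hl' => (hle e l' hl').trans (by omega)
  exact ⟨_, by omega, .comp hE₀ hE⟩

@[fun_prop]
theorem reverse {l : ε → List α} (hl : PolyTime l) : PolyTime fun e => (l e).reverse := by
  have := PolyTime.foldl (h := fun _ s a => a :: s) hl (.const []) (by fun_prop)
    hl.polyBounded_csize (by
      intro e l' hl'
      rw [List.foldl_flip_cons_eq_append', List.append_nil, csize_reverse]
      exact csize_le_of_sublist hl'.sublist)
  exact this.congr_code fun e => by rw [List.foldl_flip_cons_eq_append', List.append_nil]

@[fun_prop]
theorem append {l m : ε → List α} (hl : PolyTime l) (hm : PolyTime m) :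
    PolyTime fun e => l e ++ m e := by
  have := PolyTime.foldl (h := fun _ s a => a :: s) hl.reverse hm (by fun_prop)
    (hl.reverse.polyBounded_csize.add hm.polyBounded_csize) (by
      intro e l' hl'
      rw [List.foldl_flip_cons_eq_append']
      have h₁ := csize_append l'.reverse (m e)
      have h₂ := csize_le_of_sublist hl'.sublist
      rw [csize_reverse] at h₁
      omega)
  exact this.congr_code fun e => by rw [List.foldl_flip_cons_eq_append', List.reverse_reverse]

@[fun_prop]
theorem flatMap {l : ε → List α} {f : ε → α → List β} (hl : PolyTime l)
    (hf : PolyTime fun y : ε × α => f y.1 y.2) : PolyTime fun e => (l e).flatMap (f e) := by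
  obtain ⟨c, hc⟩ := hf.polyBounded_csize
  have hM : PolyBounded fun e => c * (csize e + csize (l e) + 1) ^ c :=
    (PolyBounded.const c).mul (((PolyBounded.csize.add hl.polyBounded_csize).add (.const 1)).pow c)
  have hfold : ∀ (e : ε) (m : List α) (s : List β),
      m.foldl (fun s a => s ++ f e a) s = s ++ m.flatMap (f e) := by
    intro e m
    induction m with
    | nil => intro s; simp
    | cons a m ih => intro s; simp [ih]
  have := PolyTime.foldl (h := fun e s a => s ++ f e a) hl (.const []) (by
      have := hf.comp (f := fun y : ε × List β × α => (y.1, y.2.2)) (by fun_prop)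
      fun_prop) ((hl.polyBounded_csize.mul hM).add (.const 1)) (by
    intro e l' hl'
    rw [hfold]
    have key : ∀ m : List α, (∀ a ∈ m, a ∈ l e) →
        csize (m.flatMap (f e)) ≤ m.length * (c * (csize e + csize (l e) + 1) ^ c) + 1 := by
      intro m
      induction m with
      | nil => simp
      | cons a m ih =>
        intro hm
        have h₁ := ih fun b hb => hm b (by simp [hb])
        have h₂ := csize_append (f e a) (m.flatMap (f e))
        have h₃ : csize (f e a) ≤ c * (csize e + csize (l e) + 1) ^ c := by
          refine (hc (e, a)).trans (Nat.mul_le_mul le_rfl (Nat.pow_le_pow_left ?_ c))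
          have := csize_le_of_mem (hm a (by simp))
          simp; omega
        rw [List.flatMap_cons, List.length_cons, add_mul]
        omega
    refine (key l' fun a ha => hl'.subset ha).trans
      (Nat.add_le_add_right (Nat.mul_le_mul ?_ le_rfl) 1)
    exact hl'.length_le.trans (length_lt_csize _).le)
  refine this.congr_code fun e => ?_
  simp [hfold]

@[fun_prop]
theorem map {l : ε → List α} {f : ε → α → β} (hl : PolyTime l)
    (hf : PolyTime fun y : ε × α => f y.1 y.2) : PolyTime fun e => (l e).map (f e) := by
  have := hl.flatMap (f := fun e a => [f e a]) (by fun_prop)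
  refine this.congr_code fun e => ?_
  simp [List.map_eq_flatMap]

@[fun_prop]
theorem filter {l : ε → List α} {f : ε → α → Bool} (hl : PolyTime l)
    (hf : PolyTime fun y : ε × α => f y.1 y.2) : PolyTime fun e => (l e).filter (f e) := by
  have := hl.flatMap (f := fun e a => bif f e a then [a] else []) (by fun_prop)
  refine this.congr_code fun e => ?_
  congr 1
  induction l e with
  | nil => rfl
  | cons a m ih => cases h : f e a <;> simp [ih, h]

@[fun_prop]
theorem any {l : ε → List α} {f : ε → α → Bool} (hl : PolyTime l)
    (hf : PolyTime fun y : ε × α => f y.1 y.2) : PolyTime fun e => (l e).any (f e) := by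
  have : PolyTime fun e => !((l e).filter (f e)).isEmpty := by fun_prop
  refine this.congr_code fun e => ?_
  congr 1
  induction l e with
  | nil => rfl
  | cons a m ih => cases h : f e a <;> simp [ih, h]

@[fun_prop]
theorem all {l : ε → List α} {f : ε → α → Bool} (hl : PolyTime l)
    (hf : PolyTime fun y : ε × α => f y.1 y.2) : PolyTime fun e => (l e).all (f e) := by
  have : PolyTime fun e => !((l e).any fun a => !(f e a)) := by fun_prop
  refine this.congr_code fun e => ?_
  simp [List.all_eq_not_any_not]

@[fun_prop]
theorem takeOne {l : ε → List α} (hl : PolyTime l) : PolyTime fun e => (l e).take 1 := by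
  rcases isEmpty_or_nonempty α with hα | ⟨⟨a₀⟩⟩
  · refine (PolyTime.const ([] : List α)).congr_code fun e => ?_
    cases l e with
    | nil => rfl
    | cons a l => exact (hα.false a).elim
  · have h := hl.headD (.const a₀)
    have : PolyTime fun e => bif (l e).isEmpty then [] else [(l e).headD a₀] := by fun_prop
    refine this.congr_code fun e => ?_
    cases l e <;> rfl

@[fun_prop]
theorem drop {l : ε → List α} {n : ε → List β} (hl : PolyTime l) (hn : PolyTime n) :
    PolyTime fun e => (l e).drop (n e).length := by
  have hfold : ∀ (m : List β) (s : List α), m.foldl (fun s _ => s.tail) s = s.drop m.length := by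
    intro m
    induction m with
    | nil => simp
    | cons b m ih => intro s; simp [ih, List.drop_tail]
  have := PolyTime.foldl (h := fun _ s _ => s.tail) hn hl (by fun_prop) hl.polyBounded_csize (by
    intro e l' _
    rw [hfold]
    exact csize_le_of_sublist (List.drop_sublist _ _))
  exact this.congr_code fun e => by rw [hfold]

@[fun_prop]
theorem zip {l : ε → List α} {m : ε → List β} (hl : PolyTime l) (hm : PolyTime m) :
    PolyTime fun e => (l e).zip (m e) := by
  -- The state holds the reversed result and the rest of the second list.
  let step : List (α × β) × List β → α → List (α × β) × List β := fun s a =>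
    ((s.2.take 1).map (fun b => (a, b)) ++ s.1, s.2.tail)
  have hfold : ∀ (n : List α) (s : List (α × β) × List β),
      n.foldl step s = ((n.zip s.2).reverse ++ s.1, s.2.drop n.length) := by
    intro n
    induction n with
    | nil => simp
    | cons a n ih =>
      rintro ⟨s₁, s₂⟩
      rw [List.foldl_cons, ih]
      cases s₂ <;> simp [step]
  have hsz : ∀ (n : List α) (k : List β), csize (n.zip k) ≤ csize n + csize k := by
    intro n
    induction n with
    | nil => simp
    | cons a n ih =>
      intro k
      cases k with
      | nil => simp
      | cons b k => have := ih k; simp; omega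
  have := PolyTime.foldl (h := fun _ s a => step s a) hl ((PolyTime.const []).prodMk hm)
    (by simp only [step]; fun_prop)
    (((hl.polyBounded_csize.add hm.polyBounded_csize).add hm.polyBounded_csize).add (.const 1)) (by
      intro e l' hl'
      rw [hfold]
      have h₁ := hsz l' (m e)
      have h₂ := csize_le_of_sublist hl'.sublist
      have h₃ := csize_le_of_sublist (List.drop_sublist l'.length (m e))
      simp [csize_reverse]; omega)
  refine this.fst.reverse.congr_code fun e => ?_
  rw [hfold]
  simp

end PolyTime

/-- Types with an equality test that is computable in polynomial time. -/
class PolyTimeEq (α : Type) [Coded α] [DecidableEq α] : Prop where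
  polyTime : PolyTime fun y : α × α => decide (y.1 = y.2)

@[fun_prop]
theorem PolyTime.decide_eq [DecidableEq α] [PolyTimeEq α] {f g : ε → α} (hf : PolyTime f)
    (hg : PolyTime g) : PolyTime fun e => decide (f e = g e) :=
  PolyTime.comp (g := fun y : α × α => decide (y.1 = y.2)) PolyTimeEq.polyTime (hf.prodMk hg)

/-- An equality test may be carried out on injective images. -/
theorem PolyTimeEq.of_injective [DecidableEq α] [DecidableEq β] [PolyTimeEq β] {f : α → β}
    (hf : PolyTime f) (hinj : Function.Injective f) : PolyTimeEq α :=
  ⟨by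
    have : PolyTime fun y : α × α => decide (f y.1 = f y.2) := by fun_prop
    exact this.congr_code fun y => by simp [hinj.eq_iff]⟩

instance : PolyTimeEq Unit := ⟨(PolyTime.const true).congr_code fun _ => rfl⟩

instance : PolyTimeEq Bool := ⟨by
  have : PolyTime fun y : Bool × Bool => bif y.1 then y.2 else !y.2 := by fun_prop
  refine this.congr_code ?_
  rintro ⟨_ | _, _ | _⟩ <;> rfl⟩

instance [DecidableEq α] [PolyTimeEq α] [DecidableEq β] [PolyTimeEq β] : PolyTimeEq (α × β) := ⟨by
  have : PolyTime fun y : (α × β) × (α × β) =>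
    decide (y.1.1 = y.2.1) && decide (y.1.2 = y.2.2) := by fun_prop
  exact this.congr_code fun y => by simp [Prod.ext_iff]⟩

instance [DecidableEq α] [PolyTimeEq α] : PolyTimeEq (List α) := ⟨by
  have : PolyTime fun y : List α × List α =>
      (((y.1.zip y.2).all fun z => decide (z.1 = z.2)) && (y.1.drop y.2.length).isEmpty) &&
        (y.2.drop y.1.length).isEmpty := by fun_prop
  refine this.congr_code fun y => ?_
  congr 1
  obtain ⟨l, m⟩ := y
  simp only
  induction l generalizing m with
  | nil => cases m <;> simp
  | cons a l ih =>
    cases m with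
    | nil => simp
    | cons b m =>
      have := ih m
      simp only [List.cons.injEq, Bool.decide_and, this, List.zip_cons_cons, List.all_cons,
        List.length_cons, List.drop_succ_cons, Bool.and_assoc]⟩

instance : PolyTimeEq ℕ :=
  .of_injective (f := fun n : ℕ => n.bits)
    (PolyTime.of_code_eq fun n => by simp [code, Data.ofNat]) fun m n h => by
      have : Nat.digits 2 m = Nat.digits 2 n := by
        rw [Nat.digits_two_eq_bits, Nat.digits_two_eq_bits]
        exact congrArg _ h
      exact Nat.digits_inj_iff.1 this

instance {q : ℕ} : PolyTimeEq (Fin q) :=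
  .of_injective (f := fun a : Fin q => (a : ℕ)) (PolyTime.of_code_eq fun _ => rfl)
    Fin.val_injective

@[fun_prop]
theorem PolyTime.mem [DecidableEq α] [PolyTimeEq α] [BEq α] [LawfulBEq α] {f : ε → α}
    {l : ε → List α} (hf : PolyTime f) (hl : PolyTime l) :
    PolyTime fun e => decide (f e ∈ l e) := by
  have : PolyTime fun e => (l e).any fun a => decide (f e = a) := by fun_prop
  refine this.congr_code fun e => ?_
  rw [show (l e).any (fun a => decide (f e = a)) = decide (f e ∈ l e) by
    rw [Bool.eq_iff_iff]; simp]

@[fun_prop]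
theorem PolyTime.erase [DecidableEq α] [PolyTimeEq α] [BEq α] [LawfulBEq α] {f : ε → α}
    {l : ε → List α} (hf : PolyTime f) (hl : PolyTime l) : PolyTime fun e => (l e).erase (f e) := by
  -- The flag records whether an occurrence of the element has been removed already.
  let step : α → List α × Bool → α → List α × Bool := fun b s a =>
    bif decide (b = a) && !s.2 then (s.1, true) else (a :: s.1, s.2)
  have hfold : ∀ (b : α) (l : List α) (s : List α × Bool), l.foldl (step b) s =
      ((bif s.2 then l else l.erase b).reverse ++ s.1, s.2 || decide (b ∈ l)) := by
    intro b l
    induction l with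
    | nil => simp
    | cons a l ih =>
      rintro ⟨s, _ | _⟩
      · by_cases hba : b = a
        · rw [List.foldl_cons, ih]
          simp [step, hba]
        · rw [List.foldl_cons, ih]
          simp [step, hba, List.erase_cons_tail, Ne.symm hba]
      · rw [List.foldl_cons, ih]
        simp [step]
  have := PolyTime.foldl (s := fun _ => (([] : List α), false)) (h := fun e s a => step (f e) s a)
    hl (by fun_prop) (by
      have : PolyTime fun y : ε × (List α × Bool) × α => f y.1 := by fun_prop
      simp only [step]; fun_prop) (hl.polyBounded_csize.add (.const 10)) (by
      intro e l' hl'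
      rw [hfold]
      have h₂ := csize_le_of_sublist hl'.sublist
      have h₃ := csize_le_of_sublist (List.erase_sublist (a := f e) (l := l'))
      have h₄ : csize (false || decide (f e ∈ l')) ≤ 3 := by
        cases (false || decide (f e ∈ l')) <;> decide
      simp [csize_reverse] at h₄ ⊢; omega)
  refine this.fst.reverse.congr_code fun e => ?_
  rw [hfold]
  simp

end Loops

/-! ### Minimum cuts in directed multigraphs -/

section Cuts

variable {V : Type} [DecidableEq V]

/-- The number of arcs, with multiplicity, that leave the node set `Q`. -/
def cut (E : List (V × V)) (Q : V → Bool) : ℕ := E.countP fun a => Q a.1 && !Q a.2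

/-- The nodes reached by a search with the state `F`, which lists the nodes reached together with
further data. -/
def nodes (F : List (V × List (V × V))) : List V := F.map Prod.fst

/-- One step of a backward search: if the head of the arc `a` has been reached and its tail has not,
then the tail is reached. Each node is stored with the list of arcs in which a path from that node
to the targets of the search has been reversed. -/
def relax (F : List (V × List (V × V))) (a : V × V) : List (V × List (V × V)) :=
  bif decide (a.1 ∈ nodes F) then F else
    ((F.filter fun b => decide (b.1 = a.2) && decide (a ∈ b.2)).take 1).map
      (fun b => (a.1, (a.2, a.1) :: b.2.erase a)) ++ F

/-- Backward search from the nodes in `T`: as many passes over all arcs as there are arcs. -/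
def search (E : List (V × V)) (T : List V) : List (V × List (V × V)) :=
  (E.flatMap fun _ => E).foldl relax (T.map fun v => (v, E))

/-- Reverses a path from `A` to `T`, if there is one. -/
def augment (A T : List V) (E : List (V × V)) : List (V × V) :=
  (((search E T).filter fun b => decide (b.1 ∈ A)).map Prod.snd).headD E

/-- Reverses paths from `A` to `T` one after the other, as many as the length of `n`. -/
def residual (E : List (V × V)) (A T : List V) (n : List Unit) : List (V × V) :=
  n.foldl (fun E _ => augment A T E) E

theorem relax_eq (F : List (V × List (V × V))) (a : V × V) :
    relax F a = F ∨ a.1 ∉ nodes F ∧ ∃ b ∈ F, b.1 = a.2 ∧ a ∈ b.2 ∧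
      relax F a = (a.1, (a.2, a.1) :: b.2.erase a) :: F := by
  by_cases h : a.1 ∈ nodes F
  · simp [relax, h]
  · cases hF : F.filter fun b => decide (b.1 = a.2) && decide (a ∈ b.2) with
    | nil => simp [relax, h, hF]
    | cons b l =>
      have hb : b ∈ F.filter fun b => decide (b.1 = a.2) && decide (a ∈ b.2) := by simp [hF]
      simp only [List.mem_filter, Bool.and_eq_true, decide_eq_true_eq] at hb
      exact .inr ⟨h, b, hb.1, hb.2.1, hb.2.2, by simp [relax, h, hF]⟩

theorem nodes_subset_relax (F : List (V × List (V × V))) (a : V × V) :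
    nodes F ⊆ nodes (relax F a) := by
  obtain h | ⟨-, b, -, -, -, h⟩ := relax_eq F a <;> simp [h, nodes]

theorem nodes_subset_foldl (l : List (V × V)) (F : List (V × List (V × V))) :
    nodes F ⊆ nodes (l.foldl relax F) := by
  induction l generalizing F with
  | nil => simp
  | cons a l ih => exact List.Subset.trans (nodes_subset_relax F a) (ih _)

/-- Reversing a path from `v` to `T` decreases by one the number of arcs that leave a set `Q`
disjoint from `T` if `v` lies in `Q`, and preserves it otherwise. -/
def PathsReversed (E : List (V × V)) (T : List V) (F : List (V × List (V × V))) : Prop :=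
  ∀ b ∈ F, ∀ Q : V → Bool, (∀ v ∈ T, Q v = false) → cut b.2 Q + (Q b.1).toNat = cut E Q

theorem PathsReversed.relax {E : List (V × V)} {T : List V} {F : List (V × List (V × V))}
    (h : PathsReversed E T F) (a : V × V) : PathsReversed E T (relax F a) := by
  obtain h' | ⟨-, b, hb, hba, hab, h'⟩ := relax_eq F a
  · rwa [h']
  · rw [h']
    intro c hc Q hQ
    rcases List.mem_cons.1 hc with rfl | hc
    · rw [← h b hb Q hQ, hba]
      have := (List.perm_cons_erase hab).countP_eq (fun a => Q a.1 && !Q a.2)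
      simp only [cut]
      rw [this]
      cases h₁ : Q a.1 <;> cases h₂ : Q a.2 <;> simp [h₁, h₂]
    · exact h c hc Q hQ

theorem PathsReversed.foldl {E : List (V × V)} {T : List V} {F : List (V × List (V × V))}
    (h : PathsReversed E T F) (l : List (V × V)) : PathsReversed E T (l.foldl SBD.relax F) := by
  induction l generalizing F with
  | nil => exact h
  | cons a l ih => exact ih (h.relax a)

theorem pathsReversed_search (E : List (V × V)) (T : List V) : PathsReversed E T (search E T) := by
  refine PathsReversed.foldl ?_ _
  intro b hb Q hQ
  obtain ⟨v, hv, rfl⟩ := List.mem_map.1 hb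
  simp [hQ v hv]

/-- The reversed paths use only arcs whose tails have been reached. So an arc whose tail is new can
be put in front of any of the paths found so far. -/
def KeepsNewArcs (E : List (V × V)) (F : List (V × List (V × V))) : Prop :=
  ∀ b ∈ F, ∀ a ∈ E, a.1 ∉ nodes F → a ∈ b.2

theorem KeepsNewArcs.relax {E : List (V × V)} {F : List (V × List (V × V))}
    (h : KeepsNewArcs E F) (a : V × V) : KeepsNewArcs E (relax F a) := by
  obtain h' | ⟨-, b, hb, hba, hab, h'⟩ := relax_eq F a
  · rwa [h']
  · rw [h']
    intro c hc a' ha' hn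
    simp only [nodes, List.map_cons, List.mem_cons, not_or] at hn
    rcases List.mem_cons.1 hc with rfl | hc
    · refine List.mem_cons_of_mem _ ((List.mem_erase_of_ne ?_).2 (h b hb a' ha' hn.2))
      rintro rfl
      exact hn.1 rfl
    · exact h c hc a' ha' hn.2

theorem KeepsNewArcs.foldl {E : List (V × V)} {F : List (V × List (V × V))}
    (h : KeepsNewArcs E F) (l : List (V × V)) : KeepsNewArcs E (l.foldl SBD.relax F) := by
  induction l generalizing F with
  | nil => exact h
  | cons a l ih => exact ih (h.relax a)

theorem KeepsNewArcs.fst_mem_relax {E : List (V × V)} {F : List (V × List (V × V))}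
    (h : KeepsNewArcs E F) {a : V × V} (ha : a ∈ E) (ha' : a.2 ∈ nodes F) :
    a.1 ∈ nodes (SBD.relax F a) := by
  by_contra hn
  have hn' : a.1 ∉ nodes F := fun h' => hn (nodes_subset_relax F a h')
  obtain ⟨b, hb, hba⟩ := List.mem_map.1 ha'
  have hmem : b ∈ F.filter fun b => decide (b.1 = a.2) && decide (a ∈ b.2) := by
    simp [hb, hba, h b hb a ha hn']
  cases hF : F.filter fun b => decide (b.1 = a.2) && decide (a ∈ b.2) with
  | nil => simp [hF] at hmem
  | cons c l =>
    simp only [SBD.relax, hF, decide_eq_false hn', cond_false] at hn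
    simp [nodes] at hn

/-- The nodes reached are closed under predecessors. -/
theorem mem_nodes_search {E : List (V × V)} {T : List V} {a : V × V} (ha : a ∈ E)
    (h : a.2 ∈ nodes (search E T)) : a.1 ∈ nodes (search E T) := by
  -- Each pass over all arcs reaches a new tail of an arc, unless the set is closed already.
  let closed : List (V × List (V × V)) → Prop := fun F =>
    ∀ a ∈ E, a.2 ∈ nodes F → a.1 ∈ nodes F
  let φ : List (V × List (V × V)) → ℕ := fun F => E.countP fun a => a.1 ∉ nodes F
  have hclosed : ∀ F, closed F → ∀ l, l ⊆ E → l.foldl relax F = F := by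
    intro F hF l
    induction l with
    | nil => simp
    | cons a l ih =>
      intro hl
      have : relax F a = F := by
        obtain h' | ⟨hn, b, hb, hba, -⟩ := relax_eq F a
        · exact h'
        · refine absurd (hF a (hl (by simp)) ?_) hn
          exact List.mem_map.2 ⟨b, hb, hba⟩
      rw [List.foldl_cons, this]
      exact ih fun x hx => hl (by simp [hx])
  have hpass : ∀ F, KeepsNewArcs E F → ¬ closed F → φ (E.foldl relax F) < φ F := by
    intro F hF hc
    simp only [closed, not_forall] at hc
    obtain ⟨a, haE, ha, hn⟩ := hc
    have hsub := nodes_subset_foldl E F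
    have hmem : a.1 ∈ nodes (E.foldl relax F) := by
      obtain ⟨l₁, l₂, hE⟩ := List.append_of_mem haE
      have h₁ := (hF.foldl l₁).fst_mem_relax haE (nodes_subset_foldl l₁ F ha)
      have h₂ := nodes_subset_foldl l₂ _ h₁
      have h₃ : E.foldl relax F = l₂.foldl relax (relax (l₁.foldl relax F) a) := by
        conv_lhs => rw [hE]
        rw [List.foldl_append, List.foldl_cons]
      rwa [h₃]
    obtain ⟨l₁, l₂, hE⟩ := List.append_of_mem haE
    have hle : ∀ l : List (V × V), l.countP (fun a => a.1 ∉ nodes (E.foldl relax F)) ≤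
        l.countP (fun a => a.1 ∉ nodes F) := by
      intro l
      refine List.countP_mono_left fun x _ hx => ?_
      simp only [decide_eq_true_eq] at hx ⊢
      exact fun h => hx (hsub h)
    have h₁ := hle l₁
    have h₂ := hle l₂
    have h₃ : ∀ G, φ G = l₁.countP (fun a => a.1 ∉ nodes G) +
        ((l₂.countP fun a => a.1 ∉ nodes G) + if a.1 ∉ nodes G then 1 else 0) := by
      intro G
      simp only [φ]
      conv_lhs => rw [hE]
      rw [List.countP_append, List.countP_cons]
      simp
    rw [h₃, h₃ F, if_pos hn, if_neg (not_not.2 hmem)]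
    omega
  have hiter : ∀ (l : List (V × V)) (F), KeepsNewArcs E F →
      closed (l.foldl (fun F _ => E.foldl relax F) F) ∨
        φ (l.foldl (fun F _ => E.foldl relax F) F) + l.length ≤ φ F := by
    intro l
    induction l with
    | nil => intro F _; right; simp
    | cons x l ih =>
      intro F hF
      by_cases hc : closed F
      · have : ∀ m : List (V × V), m.foldl (fun F _ => E.foldl relax F) F = F := by
          intro m
          induction m with
          | nil => rfl
          | cons y m ihm => rw [List.foldl_cons, hclosed F hc E (by simp), ihm]
        left
        rwa [this]
      · have := hpass F hF hc
        rcases ih (E.foldl relax F) (hF.foldl E) with h | h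
        · exact .inl h
        · right
          simp only [List.foldl_cons, List.length_cons]
          omega
  have hsearch : search E T =
      E.foldl (fun F _ => E.foldl relax F) (T.map fun v => (v, E)) := by
    simp [search, List.foldl_flatMap]
  have h0 : KeepsNewArcs E (T.map fun v => (v, E)) := by
    intro b hb a ha _
    obtain ⟨v, -, rfl⟩ := List.mem_map.1 hb
    exact ha
  rw [hsearch] at h ⊢
  rcases hiter E _ h0 with hc | hc
  · exact hc a ha h
  · by_contra hn
    have h₁ : 0 < φ (E.foldl (fun F _ => E.foldl relax F) (T.map fun v => (v, E))) :=
      List.countP_pos_iff.2 ⟨a, ha, by simpa using hn⟩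
    have h₂ : φ (T.map fun v => (v, E)) ≤ E.length := List.countP_le_length
    omega

theorem subset_nodes_search (E : List (V × V)) (T : List V) : T ⊆ nodes (search E T) := by
  refine fun v hv => nodes_subset_foldl _ _ ?_
  simp [nodes, hv]

/-- A property that holds on `T` and is inherited by predecessors holds for all nodes reached: no
arc leaves the set of nodes without the property, while reversing a path from one of them would
remove a leaving arc. -/
theorem forall_mem_nodes_search {E : List (V × V)} {T : List V} {P : V → Prop}
    (hT : ∀ v ∈ T, P v) (hE : ∀ a ∈ E, P a.2 → P a.1) : ∀ v ∈ nodes (search E T), P v := by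
  classical
  intro v hv
  obtain ⟨b, hb, rfl⟩ := List.mem_map.1 hv
  have h := pathsReversed_search E T b hb (fun v => !decide (P v)) fun v hv => by simp [hT v hv]
  have h0 : cut E (fun v => !decide (P v)) = 0 :=
    List.countP_eq_zero.2 fun a ha => by
      have := hE a ha
      simp only [Bool.not_not, Bool.and_eq_true, Bool.not_eq_true', decide_eq_false_iff_not,
        decide_eq_true_eq]
      tauto
  by_contra hP
  simp [h0, hP] at h

theorem augment_eq (A T : List V) (E : List (V × V)) :
    (augment A T E = E ∧ ∀ v ∈ A, v ∉ nodes (search E T)) ∨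
      ∃ b ∈ search E T, b.1 ∈ A ∧ augment A T E = b.2 := by
  cases hF : (search E T).filter fun b => decide (b.1 ∈ A) with
  | nil =>
    refine .inl ⟨by simp [augment, hF], fun v hv hn => ?_⟩
    obtain ⟨b, hb, rfl⟩ := List.mem_map.1 hn
    have : b ∈ (search E T).filter fun b => decide (b.1 ∈ A) := by simp [hb, hv]
    simp [hF] at this
  | cons b l =>
    have : b ∈ (search E T).filter fun b => decide (b.1 ∈ A) := by simp [hF]
    simp only [List.mem_filter, decide_eq_true_eq] at this
    exact .inr ⟨b, this.1, this.2, by simp [augment, hF]⟩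

/-- The number of arcs that leave a set between `A` and `T` drops by the number of reversed
paths. -/
theorem exists_cut_residual (A T : List V) (n : List Unit) (E : List (V × V)) :
    ∃ m, (∀ Q : V → Bool, (∀ v ∈ A, Q v = true) → (∀ v ∈ T, Q v = false) →
        cut E Q = cut (residual E A T n) Q + m) ∧
      (m = n.length ∨ ∀ v ∈ A, v ∉ nodes (search (residual E A T n) T)) := by
  induction n generalizing E with
  | nil => exact ⟨0, fun _ _ _ => rfl, .inl rfl⟩
  | cons x n ih =>
    rcases augment_eq A T E with ⟨h, hA⟩ | ⟨b, hb, hbA, h⟩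
    · have : ∀ n, residual E A T n = E := by
        intro n
        induction n with
        | nil => rfl
        | cons x n ihn => exact (congrArg (fun E => residual E A T n) h).trans ihn
      rw [this]
      exact ⟨0, fun _ _ _ => rfl, .inr hA⟩
    · obtain ⟨m, hm, hm'⟩ := ih (augment A T E)
      refine ⟨m + 1, fun Q hQA hQT => ?_, hm'.imp (by simp) id⟩
      have h₁ := pathsReversed_search E T b hb Q hQT
      have h₂ := hm Q hQA hQT
      rw [hQA _ hbA, ← h, h₂] at h₁
      rw [← h₁, Bool.toNat_true, add_assoc]
      rfl

/-- The nodes that reach `T` after reversing `n` paths from `A` to `T`. -/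
def sinkSide (E : List (V × V)) (A T : List V) (n : List Unit) : List V :=
  nodes (search (residual E A T n) T)

/-- If fewer arcs than the length of `n` suffice to separate `A` from `T`, then the complement of
`sinkSide E A T n` is the largest set with the least number of leaving arcs. -/
theorem sinkSide_spec {E : List (V × V)} {A T : List V} {n : List Unit} {Q₀ : V → Bool}
    (hA₀ : ∀ v ∈ A, Q₀ v = true) (hT₀ : ∀ v ∈ T, Q₀ v = false) (hQ₀ : cut E Q₀ < n.length) :
    (∀ v ∈ A, v ∉ sinkSide E A T n) ∧ (∀ v ∈ T, v ∈ sinkSide E A T n) ∧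
    ∀ Q : V → Bool, (∀ v ∈ A, Q v = true) → (∀ v ∈ T, Q v = false) →
      cut E (fun v => decide (v ∉ sinkSide E A T n)) ≤ cut E Q ∧
      (cut E Q ≤ cut E (fun v => decide (v ∉ sinkSide E A T n)) →
        ∀ v, Q v = true → v ∉ sinkSide E A T n) := by
  obtain ⟨m, hm, hm'⟩ := exists_cut_residual A T n E
  have hA : ∀ v ∈ A, v ∉ sinkSide E A T n := by
    refine hm'.resolve_left ?_
    have := hm Q₀ hA₀ hT₀
    omega
  have hT : ∀ v ∈ T, v ∈ sinkSide E A T n := subset_nodes_search _ _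
  refine ⟨hA, hT, fun Q hQA hQT => ?_⟩
  have h₁ := hm (fun v => decide (v ∉ sinkSide E A T n)) (by simpa using hA) (by simpa using hT)
  have h₂ := hm Q hQA hQT
  have h₃ : cut (residual E A T n) (fun v => decide (v ∉ sinkSide E A T n)) = 0 := by
    refine List.countP_eq_zero.2 fun a ha h => ?_
    simp only [Bool.and_eq_true, decide_eq_true_eq, Bool.not_eq_true', decide_eq_false_iff_not,
      not_not] at h
    exact h.1 (mem_nodes_search ha h.2)
  refine ⟨by omega, fun hle v hv hv' => ?_⟩
  have h₄ : cut (residual E A T n) Q = 0 := by omega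
  obtain ⟨b, hb, rfl⟩ := List.mem_map.1 hv'
  have := pathsReversed_search _ _ b hb Q hQT
  rw [hv, h₄, Bool.toNat_true] at this
  omega

variable [Coded V]

theorem csize_eq_of_perm {α : Type} [Coded α] {l m : List α} (h : l.Perm m) :
    csize l = csize m := by
  induction h with
  | nil => rfl
  | cons a _ ih => simp [ih]
  | swap a b l => simp; omega
  | trans _ _ ih₁ ih₂ => exact ih₁.trans ih₂

/-- Reversing paths does not change the size of the list of arcs. -/
theorem csize_foldl_relax {E : List (V × V)} {l : List (V × V)} (F : List (V × List (V × V)))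
    (hF : ∀ b ∈ F, csize b.2 = csize E) : ∀ b ∈ l.foldl relax F, csize b.2 = csize E := by
  induction l generalizing F with
  | nil => exact hF
  | cons a l ih =>
    refine ih _ ?_
    obtain h' | ⟨-, b, hb, hba, hab, h'⟩ := relax_eq F a
    · rwa [h']
    · rw [h']
      intro c hc
      rcases List.mem_cons.1 hc with rfl | hc
      · have : csize a = csize a.1 + csize a.2 + 1 := rfl
        rw [← hF b hb, csize_eq_of_perm (List.perm_cons_erase hab)]
        simp; omega
      · exact hF c hc

theorem csize_of_mem_search {E : List (V × V)} {T : List V} :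
    ∀ b ∈ search E T, csize b.2 = csize E :=
  csize_foldl_relax _ fun b hb => by
    obtain ⟨v, -, rfl⟩ := List.mem_map.1 hb
    rfl

theorem csize_augment (A T : List V) (E : List (V × V)) : csize (augment A T E) = csize E := by
  rcases augment_eq A T E with ⟨h, -⟩ | ⟨b, hb, -, h⟩
  · rw [h]
  · rw [h, csize_of_mem_search b hb]

theorem csize_residual (E : List (V × V)) (A T : List V) (n : List Unit) :
    csize (residual E A T n) = csize E := by
  induction n generalizing E with
  | nil => rfl
  | cons x n ih => exact (ih (augment A T E)).trans (csize_augment A T E)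

theorem csize_foldl_relax_le (E : List (V × V)) (T : List V) (l : List (V × V))
    (hl : l <+: E.flatMap fun _ => E) :
    csize (l.foldl relax (T.map fun v => (v, E))) ≤
      (csize T + csize E * csize E) * (csize T + 2 * csize E + 2) + 1 := by
  have hlen : ∀ (l : List (V × V)) (F : List (V × List (V × V))),
      (l.foldl relax F).length ≤ F.length + l.length := by
    intro l
    induction l with
    | nil => simp
    | cons a l ih =>
      intro F
      have h₁ := ih (relax F a)
      have h₂ : (relax F a).length ≤ F.length + 1 := by
        obtain h' | ⟨-, b, -, -, -, h'⟩ := relax_eq F a <;> simp [h']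
      simp only [List.foldl_cons, List.length_cons]
      omega
  have hnodes : ∀ (l : List (V × V)) (F : List (V × List (V × V))), l ⊆ E.flatMap (fun _ => E) →
      (∀ b ∈ F, csize b.1 ≤ csize T + csize E) →
      ∀ b ∈ l.foldl relax F, csize b.1 ≤ csize T + csize E := by
    intro l
    induction l with
    | nil => intro F _ h; exact h
    | cons a l ih =>
      intro F hl hF
      refine ih _ (fun x hx => hl (by simp [hx])) ?_
      obtain h' | ⟨-, b, hb, hba, hab, h'⟩ := relax_eq F a
      · rwa [h']
      · rw [h']
        intro c hc
        rcases List.mem_cons.1 hc with rfl | hc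
        · obtain ⟨_, -, haE⟩ := List.mem_flatMap.1 (hl (by simp : a ∈ a :: l))
          have h₁ := csize_le_of_mem haE
          have h₂ : csize a = csize a.1 + csize a.2 + 1 := rfl
          simp only
          omega
        · exact hF c hc
  have h₁ := hnodes l (T.map fun v => (v, E)) hl.subset (by
    intro b hb
    obtain ⟨v, hv, rfl⟩ := List.mem_map.1 hb
    exact (csize_le_of_mem hv).trans (by omega))
  have h₂ := csize_foldl_relax (l := l) (E := E) (T.map fun v => (v, E)) (by
    intro b hb
    obtain ⟨v, -, rfl⟩ := List.mem_map.1 hb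
    rfl)
  refine (csize_le_of_forall (M := csize T + 2 * csize E + 1) fun b hb => ?_).trans
    (Nat.add_le_add_right (Nat.mul_le_mul ?_ le_rfl) 1)
  · have h₃ : csize b = csize b.1 + csize b.2 + 1 := rfl
    have := h₁ b hb
    have := h₂ b hb
    omega
  · refine (hlen l _).trans ?_
    rw [List.length_map]
    have h₃ := hl.length_le
    simp only [List.length_flatMap, List.map_const', List.sum_replicate, smul_eq_mul] at h₃
    have h₄ := length_lt_csize T
    have h₅ := Nat.mul_le_mul (length_lt_csize E).le (length_lt_csize E).le
    omega

variable [PolyTimeEq V] {ε : Type} [Coded ε]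

@[fun_prop]
theorem PolyTime.search {E : ε → List (V × V)} {T : ε → List V} (hE : PolyTime E)
    (hT : PolyTime T) : PolyTime fun e => search (E e) (T e) := by
  have hE' := hE.polyBounded_csize
  have hT' := hT.polyBounded_csize
  refine PolyTime.foldl (h := fun _ => relax) (by fun_prop) (by fun_prop) (by
    unfold relax nodes
    fun_prop) (((hT'.add (hE'.mul hE')).mul ((hT'.add ((PolyBounded.const 2).mul hE')).add
      (.const 2))).add (.const 1)) fun e l hl => csize_foldl_relax_le _ _ _ hl

@[fun_prop]
theorem PolyTime.sinkSide {E : ε → List (V × V)} {A T : ε → List V} {n : ε → List Unit}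
    (hE : PolyTime E) (hA : PolyTime A) (hT : PolyTime T) (hn : PolyTime n) :
    PolyTime fun e => sinkSide (E e) (A e) (T e) (n e) := by
  have hr : PolyTime fun e => residual (E e) (A e) (T e) (n e) := by
    refine PolyTime.foldl (h := fun e E _ => augment (A e) (T e) E) hn hE (by
      unfold augment
      have : PolyTime fun y : ε × List (V × V) × Unit => A y.1 := by fun_prop
      have : PolyTime fun y : ε × List (V × V) × Unit => T y.1 := by fun_prop
      fun_prop) hE.polyBounded_csize fun e l _ => (csize_residual _ _ _ l).le
  unfold SBD.sinkSide nodes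
  fun_prop

end Cuts

/-! ### Restrictions of constraints -/

section Restrict

variable {q : ℕ}

theorem zip_filter_dropCoords (X : Finset ℕ) {scope : List ℕ} {t : List (Fin q)}
    (h : t.length = scope.length) :
    (scope.filter fun x => x ∉ X).zip (dropCoords X scope t) =
      (scope.zip t).filter fun p => p.1 ∉ X := by
  induction scope generalizing t with
  | nil => simp
  | cons x s ih =>
    cases t with
    | nil => simp at h
    | cons a t =>
      have := ih (t := t) (by simpa using h)
      by_cases hx : x ∈ X <;> simp_all [dropCoords]

theorem Constraint.mem_tuples_restrict {C : Constraint q} {X : Finset ℕ} {α : ℕ → Fin q}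
    {u : List (Fin q)} : u ∈ (C.restrict X α).tuples ↔ ∃ t ∈ C.tuples,
      (∀ p ∈ C.scope.zip t, p.1 ∈ X → α p.1 = p.2) ∧ dropCoords X C.scope t = u := by
  simp [restrict, and_assoc]

/-- A reduct depends only on the instantiated variables that occur in the constraint. -/
theorem Constraint.restrict_congr {C : Constraint q} {X Y : Finset ℕ} {α β : ℕ → Fin q}
    (h : ∀ x ∈ C.scope, x ∈ X ↔ x ∈ Y) (hαβ : ∀ x ∈ C.scope, x ∈ X → α x = β x) :
    C.restrict X α = C.restrict Y β := by
  have hfst : ∀ t : List (Fin q), ∀ p ∈ C.scope.zip t, p.1 ∈ C.scope :=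
    fun t p hp => (List.of_mem_zip hp).1
  ext1
  · refine List.filter_congr fun x hx => ?_
    simp [h x hx]
  · have h₁ : ∀ t : List (Fin q), dropCoords X C.scope t = dropCoords Y C.scope t := by
      intro t
      unfold dropCoords
      congr 1
      refine List.filter_congr fun p hp => ?_
      simp [h p.1 (hfst t p hp)]
    have h₂ : ∀ t : List (Fin q), (∀ p ∈ C.scope.zip t, p.1 ∈ X → α p.1 = p.2) ↔
        ∀ p ∈ C.scope.zip t, p.1 ∈ Y → β p.1 = p.2 := by
      intro t
      refine forall₂_congr fun p hp => ?_
      rw [← h p.1 (hfst t p hp)]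
      refine forall_congr' fun hX => ?_
      rw [hαβ p.1 (hfst t p hp) hX]
    simp only [restrict, h₂]
    exact Finset.image_congr fun t _ => h₁ t

theorem Constraint.restrict_restrict {C : Constraint q} {X Y : Finset ℕ} {α : ℕ → Fin q}
    (h : ∀ x ∈ C.scope, x ∈ X → x ∈ Y) :
    (C.restrict X α).restrict Y α = C.restrict Y α := by
  have hfst : ∀ t : List (Fin q), ∀ p ∈ C.scope.zip t, p.1 ∈ C.scope :=
    fun t p hp => (List.of_mem_zip hp).1
  have hlen : ∀ t ∈ C.tuples, (C.restrict X α).scope.zip (dropCoords X C.scope t) =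
      (C.scope.zip t).filter fun p => p.1 ∉ X := fun t ht =>
    zip_filter_dropCoords X (C.length_eq t ht)
  have hdrop : ∀ t ∈ C.tuples,
      dropCoords Y (C.restrict X α).scope (dropCoords X C.scope t) =
        dropCoords Y C.scope t := by
    intro t ht
    unfold dropCoords
    have := hlen t ht
    unfold dropCoords at this
    rw [this, List.filter_filter]
    congr 1
    refine List.filter_congr fun p hp => ?_
    have := h p.1 (hfst t p hp)
    by_cases hX : p.1 ∈ X <;> simp [hX, this]
  ext1
  · simp only [restrict]
    rw [List.filter_filter]
    refine List.filter_congr fun x hx => ?_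
    have := h x hx
    by_cases hX : x ∈ X <;> simp [hX, this]
  · ext u
    simp only [mem_tuples_restrict]
    constructor
    · rintro ⟨_, ⟨t, ht, ht₁, rfl⟩, ht₂, rfl⟩
      refine ⟨t, ht, fun p hp hY => ?_, (hdrop t ht).symm⟩
      by_cases hX : p.1 ∈ X
      · exact ht₁ p hp hX
      · refine ht₂ p ?_ hY
        rw [hlen t ht]
        simp [hp, hX]
    · rintro ⟨t, ht, ht₁, rfl⟩
      refine ⟨dropCoords X C.scope t, ⟨t, ht, fun p hp hX => ?_, rfl⟩, ?_, hdrop t ht⟩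
      · exact ht₁ p hp (h p.1 (hfst t p hp) hX)
      · rw [hlen t ht]
        intro p hp hY
        exact ht₁ p (List.mem_filter.1 hp).1 hY

/-- Instantiating more variables of a constraint does not leave a language that is closed under
assignments. -/
theorem ClosedUnderAssignments.restrict_mem {Γ : Finset (Relation q)}
    (hΓ : ClosedUnderAssignments Γ) {C : Constraint q} {X Y : Finset ℕ} {α : ℕ → Fin q}
    (h : ∀ x ∈ C.scope, x ∈ X → x ∈ Y) (hC : (C.restrict X α).rel ∈ Γ) :
    (C.restrict Y α).rel ∈ Γ := by
  rw [← C.restrict_restrict h]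
  exact hΓ _ _ _ hC

end Restrict

/-! ### Constraints linked to a set of variables, and separators -/

section Linked

variable {q d : ℕ} {K : Type} (con : K → Constraint q) (I : List K) (W : Finset ℕ)

/-- The instance that consists of the constraints presented by the elements of `I`. Different
presentations may stand for the same constraint. -/
def instanceOf : Instance q := (I.map con).toFinset

/-- The constraints that contain variables of `W` or can be reached from such constraints through
common variables outside `Z`. -/
inductive Linked (Z : Finset ℕ) : K → Prop
  | base {C : K} {x : ℕ} : C ∈ I → x ∈ (con C).scope → x ∈ W → Linked Z C
  | step {C C' : K} {x : ℕ} : Linked Z C → C' ∈ I → x ∈ (con C).scope → x ∈ (con C').scope →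
      x ∉ Z → Linked Z C'

/-- For each assignment of `Z`, the constraints linked to `W` reduce to constraints over one common
language. Nothing is required of the other constraints. -/
def IsGood (Γ : Fin d → Finset (Relation q)) (Z : Finset ℕ) : Prop :=
  ∀ α : ℕ → Fin q, ∃ i, ∀ C, Linked con I W Z C → ((con C).restrict Z α).rel ∈ Γ i

/-- A set of constraints none of which contains a variable of `W`. -/
def Avoids (R : K → Prop) : Prop := ∀ C ∈ I, R C → ∀ x ∈ (con C).scope, x ∉ W

open Classical in
/-- The variables outside `S` that occur both in constraints in `R` and in constraints not
in `R`. -/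
noncomputable def boundary (S : Finset ℕ) (R : K → Prop) : Finset ℕ :=
  (instanceOf con I).vars.filter fun x => x ∉ S ∧ (∃ C ∈ I, R C ∧ x ∈ (con C).scope) ∧
    ∃ C ∈ I, ¬ R C ∧ x ∈ (con C).scope

variable {con I W}

theorem mem_vars_instanceOf {x : ℕ} :
    x ∈ (instanceOf con I).vars ↔ ∃ C ∈ I, x ∈ (con C).scope := by
  simp [instanceOf, Instance.vars, Constraint.vars]

theorem mem_boundary {S : Finset ℕ} {R : K → Prop} {x : ℕ} :
    x ∈ boundary con I S R ↔ x ∉ S ∧ (∃ C ∈ I, R C ∧ x ∈ (con C).scope) ∧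
      ∃ C ∈ I, ¬ R C ∧ x ∈ (con C).scope := by
  classical
  rw [boundary, Finset.mem_filter, mem_vars_instanceOf, and_iff_right_iff_imp]
  rintro ⟨-, ⟨C, hC, -, hx⟩, -⟩
  exact ⟨C, hC, hx⟩

theorem Linked.mem {Z : Finset ℕ} {C : K} (h : Linked con I W Z C) : C ∈ I := by
  cases h <;> assumption

/-- The number of boundary variables is submodular. -/
theorem card_boundary_or_add_card_boundary_and_le (S : Finset ℕ) (R R' : K → Prop) :
    (boundary con I S fun C => R C ∨ R' C).card + (boundary con I S fun C => R C ∧ R' C).card ≤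
      (boundary con I S R).card + (boundary con I S R').card := by
  rw [← Finset.card_union_add_card_inter, ← Finset.card_union_add_card_inter (boundary con I S R)]
  refine Nat.add_le_add (Finset.card_le_card fun x => ?_) (Finset.card_le_card fun x => ?_)
  · simp only [Finset.mem_union, mem_boundary]
    rintro (⟨hS, ⟨C, hC, hR, hx⟩, C', hC', hR', hx'⟩ | ⟨hS, ⟨C, hC, hR, hx⟩, C', hC', hR', hx'⟩)
    · rw [not_or] at hR'
      exact hR.imp (fun h => ⟨hS, ⟨C, hC, h, hx⟩, C', hC', hR'.1, hx'⟩)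
        fun h => ⟨hS, ⟨C, hC, h, hx⟩, C', hC', hR'.2, hx'⟩
    · rw [not_and_or] at hR'
      exact hR'.imp (fun h => ⟨hS, ⟨C, hC, hR.1, hx⟩, C', hC', h, hx'⟩)
        fun h => ⟨hS, ⟨C, hC, hR.2, hx⟩, C', hC', h, hx'⟩
  · simp only [Finset.mem_inter, mem_boundary]
    rintro ⟨⟨hS, -, C', hC', hR', hx'⟩, -, ⟨C, hC, hR, hx⟩, -⟩
    rw [not_or] at hR'
    exact ⟨⟨hS, ⟨C, hC, hR.1, hx⟩, C', hC', hR'.1, hx'⟩, hS, ⟨C, hC, hR.2, hx⟩, C', hC', hR'.2, hx'⟩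

/-- A set that avoids `W` but contains a constraint linked to `W` has a boundary variable. -/
theorem Linked.not_or_boundary_nonempty {S : Finset ℕ} {R : K → Prop} (hR : Avoids con I W R)
    {C : K} (h : Linked con I W S C) : ¬ R C ∨ (boundary con I S R).Nonempty := by
  induction h with
  | base hC hx hW => exact .inl fun h => hR _ hC h _ hx hW
  | @step C C' x hC hC' hx hx' hS ih =>
    rcases ih with ih | ih
    · by_cases hRC : R C'
      · exact .inr ⟨x, mem_boundary.2 ⟨hS, ⟨C', hC', hRC, hx'⟩, C, hC.mem, ih, hx⟩⟩
      · exact .inl hRC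
    · exact .inr ih

theorem avoids_not_linked {Z : Finset ℕ} : Avoids con I W fun C => ¬ Linked con I W Z C :=
  fun _ hC hL _ hx hW => hL (.base hC hx hW)

theorem boundary_not_linked_subset {S Z : Finset ℕ} :
    boundary con I S (fun C => ¬ Linked con I W Z C) ⊆ Z \ S := by
  intro x hx
  obtain ⟨hS, ⟨C, hC, hCL, hxC⟩, C', hC', hCL', hxC'⟩ := mem_boundary.1 hx
  refine Finset.mem_sdiff.2 ⟨?_, hS⟩
  by_contra hZ
  exact hCL (.step (not_not.1 hCL') hC hxC' hxC hZ)

/-- Let the set of constraints `R` have at most as many boundary variables as its part that is not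
linked to `W`. Then `Z` can be changed, without increasing its size, so that all of `R` is cut off
from `W`: the variables of `Z` in the enlarged set of unlinked constraints are replaced by its
boundary, which is no larger by submodularity. The constraints cut off in addition do not matter,
and what remains linked to `W` was linked to `W` before. -/
theorem IsGood.exists_separating {Γ : Fin d → Finset (Relation q)}
    (hΓ : ∀ i, ClosedUnderAssignments (Γ i)) {S Z : Finset ℕ} (hZ : IsGood con I W Γ Z)
    (hSZ : S ⊆ Z) (hZI : Z ⊆ (instanceOf con I).vars) (hZW : Disjoint Z W) {R : K → Prop}
    (hR : Avoids con I W R)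
    (hmin : (boundary con I S R).card ≤
      (boundary con I S fun C => ¬ Linked con I W Z C ∧ R C).card) :
    ∃ Z', IsGood con I W Γ Z' ∧ S ⊆ Z' ∧ Z' ⊆ (instanceOf con I).vars ∧ Disjoint Z' W ∧
      Z'.card ≤ Z.card ∧ ∀ C, R C → ¬ Linked con I W Z' C := by
  classical
  let R' : K → Prop := fun C => ¬ Linked con I W Z C ∨ R C
  let F : Finset ℕ := Z.filter fun x => ¬ ∃ C ∈ I, R' C ∧ x ∈ (con C).scope
  let Z' := (S ∪ F) ∪ boundary con I S R'
  have hR' : Avoids con I W R' := fun C hC h => h.elim (avoids_not_linked C hC) (hR C hC)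
  have hlink : ∀ C, Linked con I W Z' C → ¬ R' C ∧ Linked con I W Z C := by
    intro C h
    induction h with
    | base hC hx hW => exact ⟨fun h => hR' _ hC h _ hx hW, .base hC hx hW⟩
    | @step C C' x hC hC' hx hx' hZ' ih =>
      have : ¬ R' C' := by
        intro h
        refine hZ' ?_
        by_cases hS : x ∈ S
        · exact Finset.mem_union_left _ (Finset.mem_union_left _ hS)
        · exact Finset.mem_union_right _
            (mem_boundary.2 ⟨hS, ⟨C', hC', h, hx'⟩, C, hC.mem, ih.1, hx⟩)
      refine ⟨this, ?_⟩
      simp only [R', not_or, not_not] at this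
      exact this.1
  refine ⟨Z', ?_, ?_, ?_, ?_, ?_, fun C hC h => (hlink C h).1 (.inr hC)⟩
  · intro α
    obtain ⟨i, hi⟩ := hZ α
    refine ⟨i, fun C hC => (hΓ i).restrict_mem ?_ (hi C (hlink C hC).2)⟩
    intro x hx hxZ
    by_cases hxR : ∃ C ∈ I, R' C ∧ x ∈ (con C).scope
    · by_cases hS : x ∈ S
      · exact Finset.mem_union_left _ (Finset.mem_union_left _ hS)
      · exact Finset.mem_union_right _
          (mem_boundary.2 ⟨hS, hxR, C, hC.mem, (hlink C hC).1, hx⟩)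
    · exact Finset.mem_union_left _ (Finset.mem_union_right _ (Finset.mem_filter.2 ⟨hxZ, hxR⟩))
  · exact Finset.subset_union_left.trans Finset.subset_union_left
  · refine Finset.union_subset (Finset.union_subset (hSZ.trans hZI)
      ((Finset.filter_subset _ _).trans hZI)) fun x hx => ?_
    obtain ⟨-, ⟨C, hC, -, hxC⟩, -⟩ := mem_boundary.1 hx
    exact mem_vars_instanceOf.2 ⟨C, hC, hxC⟩
  · rw [Finset.disjoint_left] at hZW ⊢
    intro x hx
    rcases Finset.mem_union.1 hx with hx | hx
    · rcases Finset.mem_union.1 hx with hx | hx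
      · exact hZW (hSZ hx)
      · exact hZW (Finset.mem_filter.1 hx).1
    · obtain ⟨-, ⟨C, hC, hCR, hxC⟩, -⟩ := mem_boundary.1 hx
      exact hR' C hC hCR x hxC
  · have h₁ := card_boundary_or_add_card_boundary_and_le (con := con) (I := I) S
      (fun C => ¬ Linked con I W Z C) R
    have h₂ : (boundary con I S fun C => ¬ Linked con I W Z C).card + (S ∪ F).card ≤ Z.card := by
      rw [← Finset.card_union_of_disjoint]
      · exact Finset.card_le_card (Finset.union_subset
          (boundary_not_linked_subset.trans Finset.sdiff_subset)
          (Finset.union_subset hSZ (Finset.filter_subset _ _)))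
      · rw [Finset.disjoint_left]
        intro x hx hx'
        obtain ⟨hS, ⟨C, hC, hCL, hxC⟩, -⟩ := mem_boundary.1 hx
        rcases Finset.mem_union.1 hx' with hx' | hx'
        · exact hS hx'
        · exact (Finset.mem_filter.1 hx').2 ⟨C, hC, .inl hCL, hxC⟩
    have h₃ : Z'.card ≤ (S ∪ F).card + (boundary con I S R').card := Finset.card_union_le _ _
    have h₄ : (boundary con I S R').card =
      (boundary con I S fun C => ¬ Linked con I W Z C ∨ R C).card := rfl
    omega

/-- A good set that contains `S` is a strong backdoor: constraints not linked to `W` contain no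
variable of `W`, so they are dealt with by the strong backdoor `W ∪ S`. -/
theorem IsGood.isStrongBackdoor {Γ : Fin d → Finset (Relation q)}
    (hΓ : ∀ i, ClosedUnderAssignments (Γ i)) {S Z : Finset ℕ}
    (hWS : IsStrongBackdoor (scatteredCSP Γ) (instanceOf con I) (W ∪ S))
    (hZ : IsGood con I W Γ Z) (hSZ : S ⊆ Z) (hZI : Z ⊆ (instanceOf con I).vars) :
    IsStrongBackdoor (scatteredCSP Γ) (instanceOf con I) Z := by
  classical
  refine ⟨hZI, fun α => ?_⟩
  obtain ⟨i₀, hi₀⟩ := hZ α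
  obtain ⟨P, hP, hPd, hPv, hPΓ⟩ := hWS.2 α
  have hidx : ∀ C ∈ I, ∃ i, (con C).restrict (W ∪ S) α ∈ P i := fun C hC =>
    (hP _).1 (Finset.mem_image_of_mem _ (List.mem_toFinset.2 (List.mem_map_of_mem hC)))
  -- The index of the part into which the reduct of a constraint is put.
  let idx : K → Fin d := fun C =>
    if h : C ∈ I ∧ ¬ Linked con I W Z C then (hidx C h.1).choose else i₀
  have hmem : ∀ C ∈ I, ((con C).restrict Z α).rel ∈ Γ (idx C) := by
    intro C hC
    by_cases hL : Linked con I W Z C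
    · simpa [idx, hL] using hi₀ C hL
    · have h : C ∈ I ∧ ¬ Linked con I W Z C := ⟨hC, hL⟩
      simp only [idx, dif_pos h]
      refine (hΓ _).restrict_mem ?_ (hPΓ _ _ (hidx C hC).choose_spec)
      intro x hx hxWS
      exact (Finset.mem_union.1 hxWS).elim (fun hW => absurd (.base hC hx hW) hL) (fun h => hSZ h)
  have hshare : ∀ C ∈ I, ∀ C' ∈ I, ∀ x, x ∈ (con C).scope → x ∈ (con C').scope → x ∉ Z →
      idx C = idx C' := by
    intro C hC C' hC' x hx hx' hxZ
    by_cases hL : Linked con I W Z C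
    · have hL' : Linked con I W Z C' := .step hL hC' hx hx' hxZ
      simp [idx, hL, hL']
    · have hL' : ¬ Linked con I W Z C' := fun hL' => hL (.step hL' hC hx' hx hxZ)
      have h : C ∈ I ∧ ¬ Linked con I W Z C := ⟨hC, hL⟩
      have h' : C' ∈ I ∧ ¬ Linked con I W Z C' := ⟨hC', hL'⟩
      simp only [idx, dif_pos h, dif_pos h']
      by_contra hne
      have hxWS : x ∉ W ∪ S := fun hxWS => (Finset.mem_union.1 hxWS).elim
        (fun hW => hL (.base hC hx hW)) (fun h => hxZ (hSZ h))
      refine Finset.disjoint_left.1 (hPv _ _ hne) (?_ : x ∈ _) ?_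
      · exact Finset.mem_biUnion.2 ⟨_, (hidx C hC).choose_spec, by
          simpa [Constraint.vars, Constraint.restrict, hx] using hxWS⟩
      · exact Finset.mem_biUnion.2 ⟨_, (hidx C' hC').choose_spec, by
          simpa [Constraint.vars, Constraint.restrict, hx'] using hxWS⟩
  have hrep : ∀ D : Constraint q, ∃ i, D ∈ (instanceOf con I).restrict Z α →
      ∃ C ∈ I, (con C).restrict Z α = D ∧ idx C = i := by
    intro D
    by_cases hD : D ∈ (instanceOf con I).restrict Z α
    · obtain ⟨E, hE, rfl⟩ := Finset.mem_image.1 hD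
      obtain ⟨C, hC, rfl⟩ : ∃ C ∈ I, con C = E := by simpa [instanceOf] using hE
      exact ⟨idx C, fun _ => ⟨C, hC, rfl, rfl⟩⟩
    · exact ⟨i₀, fun h => absurd h hD⟩
  -- Several constraints may have the same reduct, which is put into the part of one of them.
  choose ind hind using hrep
  refine ⟨fun i => ((instanceOf con I).restrict Z α).filter fun D => ind D = i, ?_, ?_, ?_, ?_⟩
  · intro D
    simp
  · intro i j hij
    rw [Finset.disjoint_left]
    intro D hD hD'
    exact hij ((Finset.mem_filter.1 hD).2.symm.trans (Finset.mem_filter.1 hD').2)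
  · intro i j hij
    rw [Finset.disjoint_left]
    intro x hx hx'
    obtain ⟨D, hD, hxD⟩ := Finset.mem_biUnion.1 hx
    obtain ⟨D', hD', hxD'⟩ := Finset.mem_biUnion.1 hx'
    obtain ⟨hD₁, rfl⟩ := Finset.mem_filter.1 hD
    obtain ⟨hD₁', rfl⟩ := Finset.mem_filter.1 hD'
    obtain ⟨C, hC, rfl, hCi⟩ := hind D hD₁
    obtain ⟨C', hC', rfl, hCi'⟩ := hind D' hD₁'
    simp only [Constraint.vars, Constraint.restrict, List.mem_toFinset, List.mem_filter,
      decide_eq_true_eq] at hxD hxD'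
    exact hij (hCi.symm.trans ((hshare C hC C' hC' x hxD.1 hxD'.1 hxD.2).trans hCi'))
  · intro i D hD
    obtain ⟨hD₁, rfl⟩ := Finset.mem_filter.1 hD
    obtain ⟨C, hC, rfl, hCi⟩ := hind D hD₁
    rw [← hCi]
    exact hmem C hC

/-- If `W` is contained in one connected component after deletion of a strong backdoor `Z`, then all
constraints linked to `W` belong to that component. -/
theorem IsStrongBackdoor.isGood [NeZero d] {Γ : Fin d → Finset (Relation q)} {Z : Finset ℕ}
    (hZ : IsStrongBackdoor (scatteredCSP Γ) (instanceOf con I) Z) (hZW : Disjoint Z W)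
    (hW : ∀ v ∈ W, ∀ w ∈ W,
      (incidenceGraph (instanceOf con I) Z).Reachable (Sum.inl v) (Sum.inl w)) :
    IsGood con I W Γ Z := by
  intro α
  obtain ⟨P, hP, hPd, hPv, hPΓ⟩ := hZ.2 α
  by_cases hL : ∃ C x, C ∈ I ∧ x ∈ (con C).scope ∧ x ∈ W
  · obtain ⟨C₀, x₀, hC₀, hx₀, hxW₀⟩ := hL
    have hmemI : ∀ C ∈ I, con C ∈ instanceOf con I := fun C hC =>
      List.mem_toFinset.2 (List.mem_map_of_mem hC)
    have hidx : ∀ C ∈ instanceOf con I, ∃ i, C.restrict Z α ∈ P i := fun C hC =>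
      (hP _).1 (Finset.mem_image_of_mem _ hC)
    have hshare : ∀ C ∈ instanceOf con I, ∀ C' ∈ instanceOf con I, ∀ x, x ∈ C.scope →
        x ∈ C'.scope → x ∉ Z → ∀ i, C.restrict Z α ∈ P i → C'.restrict Z α ∈ P i := by
      intro C hC C' hC' x hx hx' hxZ i hi
      obtain ⟨j, hj⟩ := hidx C' hC'
      by_cases hij : i = j
      · rwa [hij]
      · refine (Finset.disjoint_left.1 (hPv i j hij) (?_ : x ∈ _) ?_).elim
        · exact Finset.mem_biUnion.2
            ⟨_, hi, by simp [Constraint.vars, Constraint.restrict, hx, hxZ]⟩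
        · exact Finset.mem_biUnion.2
            ⟨_, hj, by simp [Constraint.vars, Constraint.restrict, hx', hxZ]⟩
    obtain ⟨i, hi⟩ := hidx _ (hmemI C₀ hC₀)
    refine ⟨i, fun C hC => hPΓ i _ ?_⟩
    -- The property of vertices that is transported along paths.
    let Q : ℕ ⊕ Constraint q → Prop := Sum.elim
      (fun x => ∀ C ∈ instanceOf con I, x ∈ C.scope → C.restrict Z α ∈ P i)
      (fun C => C.restrict Z α ∈ P i)
    have hQ : ∀ u v, (incidenceGraph (instanceOf con I) Z).Reachable u v → Q u → Q v := by
      rintro u v ⟨p⟩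
      induction p with
      | nil => exact _root_.id
      | cons h _ ih =>
        intro hu
        refine ih ?_
        obtain ⟨x, C, hC, hx, hxZ, ⟨rfl, rfl⟩ | ⟨rfl, rfl⟩⟩ := h
        · exact hu C hC (by simpa [Constraint.vars] using hx)
        · exact fun C' hC' hx' => hshare C hC C' hC' x (by simpa [Constraint.vars] using hx) hx' hxZ
            i hu
    have hxZ : ∀ x ∈ W, x ∉ Z := fun x hxW hxZ => Finset.disjoint_left.1 hZW hxZ hxW
    have hQW : ∀ x ∈ W, Q (Sum.inl x) := fun x hxW => hQ _ _ (hW x₀ hxW₀ x hxW) fun C' hC' hx' =>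
      hshare _ (hmemI C₀ hC₀) C' hC' x₀ hx₀ hx' (hxZ x₀ hxW₀) i hi
    induction hC with
    | base hC hx hxW => exact hQW _ hxW _ (hmemI _ hC) hx
    | step hC hC' hx hx' hZ ih =>
      exact hshare _ (hmemI _ hC.mem) _ (hmemI _ hC') _ hx hx' hZ i ih
  · refine ⟨0, fun C hC => (hL ?_).elim⟩
    induction hC with
    | base hC hx hxW => exact ⟨_, _, hC, hx, hxW⟩
    | step _ _ _ _ _ ih => exact ih

end Linked

/-! ### The algorithm -/

section Algorithm

variable {q : ℕ}

/-- A constraint as it is presented to the algorithm: its scope and a list of its tuples. -/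
abbrev RawConstraint (q : ℕ) := List ℕ × List (List (Fin q))

/-- A relation as it is presented to the algorithm: its arity in unary and a list of its tuples. -/
abbrev RawRelation (q : ℕ) := List Unit × List (List (Fin q))

/-- A node of the directed graph in which separators are computed: a constraint, or one of the two
copies of a variable. The sum of these types is encoded by lists of length at most one. -/
abbrev Node (q : ℕ) := List (Bool × ℕ) × List (RawConstraint q)

/-- The constraint that is presented by its scope and a list of its tuples. Tuples of the wrong
length are ignored. -/
def toConstraint (C : RawConstraint q) : Constraint q where
  scope := C.1
  tuples := (C.2.filter fun t => decide (t.length = C.1.length)).toFinset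
  length_eq := by simp

/-- The node of a constraint. -/
def conNode (C : RawConstraint q) : Node q := ([], [C])

/-- The copy of a variable that is entered from constraints. -/
def inNode (q x : ℕ) : Node q := ([(false, x)], [])

/-- The copy of a variable that is left towards constraints. -/
def outNode (q x : ℕ) : Node q := ([(true, x)], [])

/-- Removal of repetitions from a list of variables. -/
def distinctVars (l : List ℕ) : List ℕ :=
  l.foldl (fun s x => bif decide (x ∈ s) then s else x :: s) []

/-- The constraints that contain a variable of `W`. -/
def touching (I : List (RawConstraint q)) (W : List ℕ) : List (RawConstraint q) :=
  I.filter fun C => C.1.any fun x => decide (x ∈ W)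

/-- The pairs of constraints with a common variable outside `S`. -/
def sharingPairs (I : List (RawConstraint q)) (S : List ℕ) :
    List (RawConstraint q × RawConstraint q) :=
  I.flatMap fun C => (I.filter fun C' => C.1.any fun x => decide (x ∈ C'.1) && !decide (x ∈ S)).map
    fun C' => (C, C')

/-- The constraints linked to `W` after deletion of `S`. -/
def linkedList (I : List (RawConstraint q)) (S W : List ℕ) : List (RawConstraint q) :=
  nodes (search (sharingPairs I S) (touching I W))

/-- The directed graph in which separators are computed. The arc between the two copies of a
variable is simple, and all other arcs are repeated as often as the length of `n`, so that a cut of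
fewer arcs consists of arcs of variables. -/
def flowArcs (I : List (RawConstraint q)) (S : List ℕ) (n : List Unit) : List (Node q × Node q) :=
  ((distinctVars (I.flatMap Prod.fst)).filter fun x => !decide (x ∈ S)).map
      (fun x => (inNode q x, outNode q x)) ++
    I.flatMap fun C => (C.1.filter fun x => !decide (x ∈ S)).flatMap fun x =>
      n.flatMap fun _ => [(conNode C, inNode q x), (outNode q x, conNode C)]

/-- The largest set of constraints that contains `A`, avoids `W` and has the least possible number
of boundary variables, provided that this number is less than the length of `n`. -/
def minCutSide (I : List (RawConstraint q)) (S W : List ℕ) (A : List (RawConstraint q))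
    (n : List Unit) : List (RawConstraint q) :=
  I.filter fun C => !decide (conNode C ∈
    sinkSide (flowArcs I S n) (A.map conNode) ((touching I W).map conNode) n)

/-- The variables outside `S` that occur both in constraints in `R` and in constraints not
in `R`. -/
def boundaryList (I : List (RawConstraint q)) (S : List ℕ) (R : List (RawConstraint q)) : List ℕ :=
  (I.flatMap Prod.fst).filter fun x => (!decide (x ∈ S) && R.any fun C => decide (x ∈ C.1)) &&
    I.any fun C => !decide (C ∈ R) && decide (x ∈ C.1)

/-- The relation of the constraint that results from `C` by assigning the values `w` to the
variables `S`. -/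
def reduct (S : List ℕ) (w : List (Fin q)) (C : RawConstraint q) : RawRelation q :=
  ((C.1.filter fun x => !decide (x ∈ S)).map fun _ => (),
    (C.2.filter fun t => (C.1.zip t).all fun p => (S.zip w).all fun b =>
      !decide (b.1 = p.1) || decide (b.2 = p.2)).map fun t =>
        ((C.1.zip t).filter fun p => !decide (p.1 ∈ S)).map Prod.snd)

/-- Whether a relation belongs to a language. -/
def inLanguage (G : List (RawRelation q)) (R : RawRelation q) : Bool :=
  G.any fun R' => (decide (R'.1 = R.1) && R'.2.all fun t => decide (t ∈ R.2)) &&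
    R.2.all fun t => decide (t ∈ R'.2)

/-- The constraints in `U` whose reducts do not belong to the language `G`. -/
def violators (S : List ℕ) (U : List (RawConstraint q)) (w : List (Fin q))
    (G : List (RawRelation q)) : List (RawConstraint q) :=
  U.filter fun C => !inLanguage G (reduct S w C)

/-- The first assignment of `S` in `ws` for which the reducts of `U` belong to none of the languages
`Γ`, as a list of length at most one. -/
def conflict (Γ : List (List (RawRelation q))) (ws : List (List (Fin q))) (S : List ℕ)
    (U : List (RawConstraint q)) : List (List (Fin q)) :=
  (ws.filter fun w => Γ.all fun G => !(violators S U w G).isEmpty).take 1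

/-- A state of the search: the variables that have been put into the backdoor, and a set of
constraints to be separated from `W`. -/
abbrev State (q : ℕ) := List ℕ × List (RawConstraint q)

/-- Ways to deal with a violation: for one constraint for each language, either separate it from
`W`, or put one of its variables into the backdoor. -/
def violationChildren (Γ : List (List (RawRelation q))) (I : List (RawConstraint q))
    (ws : List (List (Fin q))) (W S : List ℕ) : List (State q) :=
  (conflict Γ ws S (linkedList I S W)).flatMap fun w => Γ.flatMap fun G =>
    ((violators S (linkedList I S W) w G).take 1).flatMap fun C =>
      (S, [C]) :: (C.1.filter fun x => !decide (x ∈ S) && !decide (x ∈ W)).map fun x => (x :: S, [])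

/-- Ways to separate `A` from `W`: choose a boundary variable `v` of the largest minimum cut, and
either put `v` into the backdoor or add all constraints that contain it to the separated part. -/
def separationChildren (I : List (RawConstraint q)) (n : List Unit) (W S : List ℕ)
    (A : List (RawConstraint q)) : List (State q) :=
  ((boundaryList I S (minCutSide I S W A n)).take 1).flatMap fun v =>
    [(v :: S, []), (S, I.filter fun C => decide (C ∈ minCutSide I S W A n) || decide (v ∈ C.1))]

/-- The successors of a state. Minimum cuts are computed for as long as they have fewer variables
than the length of `n`. -/
def children (Γ : List (List (RawRelation q))) (I : List (RawConstraint q))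
    (ws : List (List (Fin q))) (n : List Unit) (W : List ℕ) (st : State q) : List (State q) :=
  bif st.2.isEmpty then violationChildren Γ I ws W st.1 else separationChildren I n W st.1 st.2

/-- The successor with number `c`, or the state itself if there is none. -/
def step (Γ : List (List (RawRelation q))) (I : List (RawConstraint q))
    (ws : List (List (Fin q))) (n : List Unit) (W : List ℕ) (st : State q) (c : List Unit) :
    State q :=
  ((children Γ I ws n W st).drop c.length).headD st

/-- The state that is reached from `st` by the choices in `cs`. -/
def run (Γ : List (List (RawRelation q))) (I : List (RawConstraint q))
    (ws : List (List (Fin q))) (n : List Unit) (W : List ℕ) (st : State q) (cs : List (List Unit)) :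
    State q :=
  cs.foldl (step Γ I ws n W) st

/-- Whether a state provides a solution: a set of size at most the length of `k` without
conflicts. -/
def accepts (Γ : List (List (RawRelation q))) (I : List (RawConstraint q))
    (ws : List (List (Fin q))) (k : List Unit) (W : List ℕ) (st : State q) : Bool :=
  (st.1.drop k.length).isEmpty && (conflict Γ ws st.1 (linkedList I st.1 W)).isEmpty

/-- Tries all sequences of choices in `css`, where `ws` lists the words of values that are assigned
to backdoors. The words have length `k`, and surplus values are ignored. Only separators of at most
`k` variables matter, hence the bound `() :: k` of length `k + 1` on minimum cuts. -/
def findBackdoor (Γ : List (List (RawRelation q))) (I : List (RawConstraint q))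
    (ws : List (List (Fin q))) (css : List (List (List Unit))) (k : List Unit) (S W : List ℕ) :
    List ℕ :=
  (((css.map fun cs => run Γ I ws (() :: k) W (S, []) cs).filter
    (accepts Γ I ws k W)).map Prod.fst).headD []

/-! ### The algorithm runs in polynomial time -/

theorem csize_foldl_distinct (l s : List ℕ) :
    csize (l.foldl (fun s x => bif decide (x ∈ s) then s else x :: s) s) ≤ csize l + csize s := by
  induction l generalizing s with
  | nil => simp
  | cons a l ih =>
    rw [List.foldl_cons]
    refine (ih _).trans ?_
    by_cases h : a ∈ s <;> simp [h] <;> omega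

theorem mem_touching {I : List (RawConstraint q)} {W : List ℕ} {C : RawConstraint q} :
    C ∈ touching I W ↔ C ∈ I ∧ ∃ x ∈ C.1, x ∈ W := by
  simp [touching]

theorem mem_linkedList {I : List (RawConstraint q)} {S W : List ℕ} {C : RawConstraint q} :
    C ∈ linkedList I S W ↔ Linked toConstraint I W.toFinset S.toFinset C := by
  have harc : ∀ C C' : RawConstraint q, (C, C') ∈ sharingPairs I S ↔
      C ∈ I ∧ C' ∈ I ∧ ∃ x ∈ C.1, x ∈ C'.1 ∧ x ∉ S := by
    simp [sharingPairs]
  constructor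
  · intro h
    refine forall_mem_nodes_search (P := Linked toConstraint I W.toFinset S.toFinset) ?_ ?_ C h
    · intro C hC
      obtain ⟨hC, x, hx, hW⟩ := mem_touching.1 hC
      exact .base hC hx (by simpa using hW)
    · rintro ⟨C, C'⟩ ha h
      obtain ⟨hC, -, x, hx, hx', hS⟩ := (harc C C').1 ha
      exact .step h hC hx' hx (by simpa using hS)
  · intro h
    induction h with
    | base hC hx hW =>
      exact subset_nodes_search _ _ (mem_touching.2 ⟨hC, _, hx, by simpa using hW⟩)
    | @step C C' x hC hC' hx hx' hS ih =>
      exact mem_nodes_search (a := (C', C))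
        ((harc C' C).2 ⟨hC', hC.mem, x, hx', hx, by simpa using hS⟩) ih

theorem mem_minCutSide {I : List (RawConstraint q)} {S W : List ℕ} {A : List (RawConstraint q)}
    {n : List Unit} {C : RawConstraint q} : C ∈ minCutSide I S W A n ↔ C ∈ I ∧ conNode C ∉
      sinkSide (flowArcs I S n) (A.map conNode) ((touching I W).map conNode) n := by
  simp [minCutSide]

theorem avoids_minCutSide (I : List (RawConstraint q)) (S W : List ℕ) (A : List (RawConstraint q))
    (n : List Unit) : Avoids toConstraint I W.toFinset fun C => C ∈ minCutSide I S W A n := by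
  intro C hC h x hx hW
  exact (mem_minCutSide.1 h).2 (subset_nodes_search _ _ (List.mem_map_of_mem
    (mem_touching.2 ⟨hC, x, hx, by simpa using hW⟩)))

theorem mem_boundaryList {I : List (RawConstraint q)} {S : List ℕ} {R : List (RawConstraint q)}
    (hR : R ⊆ I) {x : ℕ} :
    x ∈ boundaryList I S R ↔ x ∈ boundary toConstraint I S.toFinset fun C => C ∈ R := by
  have : (∃ C ∈ I, C ∈ R ∧ x ∈ C.1) ↔ ∃ C ∈ R, x ∈ C.1 :=
    ⟨fun ⟨C, _, h, hx⟩ => ⟨C, h, hx⟩, fun ⟨C, h, hx⟩ => ⟨C, hR h, h, hx⟩⟩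
  rw [mem_boundary]
  simp only [toConstraint, this, boundaryList]
  simp only [List.mem_filter, List.mem_flatMap, Bool.and_eq_true, Bool.not_eq_true',
    decide_eq_false_iff_not, List.any_eq_true, decide_eq_true_eq, List.mem_toFinset]
  constructor
  · rintro ⟨-, ⟨hS, h⟩, C, hC, hCR, hx⟩
    exact ⟨hS, h, C, hC, hCR, hx⟩
  · rintro ⟨hS, h, C, hC, hCR, hx⟩
    exact ⟨⟨C, hC, hx⟩, ⟨hS, h⟩, C, hC, hCR, hx⟩

theorem minCutSide_subset (I : List (RawConstraint q)) (S W : List ℕ)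
    (A : List (RawConstraint q)) (n : List Unit) : minCutSide I S W A n ⊆ I :=
  fun _ h => List.mem_of_mem_filter h

theorem mem_children {Γ : List (List (RawRelation q))} {I : List (RawConstraint q)}
    {ws : List (List (Fin q))} {n : List Unit} {W : List ℕ} {st st' : State q}
    (h : st' ∈ children Γ I ws n W st) :
    (st'.1 = st.1 ∨ ∃ C ∈ I, ∃ x ∈ C.1, x ∉ st.1 ∧ x ∉ W ∧ st'.1 = x :: st.1) ∧
      csize st'.2 ≤ csize I + 2 := by
  unfold children at h
  cases hA : st.2.isEmpty with
  | true =>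
    simp only [hA, cond_true, violationChildren, List.mem_flatMap] at h
    obtain ⟨w, -, G, -, C, hC, h⟩ := h
    have hCI : C ∈ I :=
      (mem_linkedList.1 (List.mem_filter.1 (List.mem_of_mem_take hC)).1).mem
    rcases List.mem_cons.1 h with rfl | h
    · have := csize_le_of_mem hCI
      exact ⟨.inl rfl, by simp only [csize_cons, csize_nil]; omega⟩
    · obtain ⟨x, hx, rfl⟩ := List.mem_map.1 h
      simp only [List.mem_filter, Bool.and_eq_true, Bool.not_eq_true',
        decide_eq_false_iff_not] at hx
      exact ⟨.inr ⟨C, hCI, x, hx.1, hx.2.1, hx.2.2, rfl⟩, by simp⟩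
  | false =>
    simp only [hA, cond_false, separationChildren, List.mem_flatMap] at h
    obtain ⟨v, hv, h⟩ := h
    have hv := (mem_boundaryList (minCutSide_subset I st.1 W st.2 n)).1 (List.mem_of_mem_take hv)
    obtain ⟨hS, ⟨C, hC, hCR, hx⟩, -⟩ := mem_boundary.1 hv
    have hW := avoids_minCutSide I st.1 W st.2 n C hC hCR v hx
    rcases List.mem_cons.1 h with rfl | h
    · exact ⟨.inr ⟨C, hC, v, hx, by simpa using hS, by simpa using hW, rfl⟩, by simp⟩
    · rw [List.mem_singleton] at h
      subst h
      exact ⟨.inl rfl, (csize_le_of_sublist List.filter_sublist).trans (by omega)⟩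

section PolyTime

variable {ε : Type} [Coded ε] {I R A : ε → List (RawConstraint q)} {S W l : ε → List ℕ}
  {n k : ε → List Unit} {Γ : ε → List (List (RawRelation q))} {G : ε → List (RawRelation q)}
  {ws : ε → List (List (Fin q))} {w : ε → List (Fin q)} {C : ε → RawConstraint q}
  {st : ε → State q}

@[fun_prop]
theorem PolyTime.distinctVars (hl : PolyTime l) : PolyTime fun e => distinctVars (l e) :=
  PolyTime.foldl (h := fun _ s x => bif decide (x ∈ s) then s else x :: s) hl (.const [])
    (by fun_prop) (hl.polyBounded_csize.add (.const 1)) fun e l' hl' =>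
    (csize_foldl_distinct l' []).trans (by
      have := csize_le_of_sublist hl'.sublist
      simp only [csize_nil]; omega)

@[fun_prop]
theorem PolyTime.touching (hI : PolyTime I) (hW : PolyTime W) :
    PolyTime fun e => touching (I e) (W e) := by
  unfold SBD.touching
  fun_prop

@[fun_prop]
theorem PolyTime.linkedList (hI : PolyTime I) (hS : PolyTime S) (hW : PolyTime W) :
    PolyTime fun e => linkedList (I e) (S e) (W e) := by
  unfold SBD.linkedList sharingPairs nodes
  fun_prop

@[fun_prop]
theorem PolyTime.flowArcs (hI : PolyTime I) (hS : PolyTime S) (hn : PolyTime n) :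
    PolyTime fun e => flowArcs (I e) (S e) (n e) := by
  unfold SBD.flowArcs conNode inNode outNode
  fun_prop

@[fun_prop]
theorem PolyTime.minCutSide (hI : PolyTime I) (hS : PolyTime S) (hW : PolyTime W)
    (hA : PolyTime A) (hn : PolyTime n) :
    PolyTime fun e => minCutSide (I e) (S e) (W e) (A e) (n e) := by
  unfold SBD.minCutSide conNode
  fun_prop

@[fun_prop]
theorem PolyTime.boundaryList (hI : PolyTime I) (hS : PolyTime S) (hR : PolyTime R) :
    PolyTime fun e => boundaryList (I e) (S e) (R e) := by
  unfold SBD.boundaryList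
  fun_prop

@[fun_prop]
theorem PolyTime.reduct (hS : PolyTime S) (hw : PolyTime w) (hC : PolyTime C) :
    PolyTime fun e => reduct (S e) (w e) (C e) := by
  unfold SBD.reduct
  fun_prop

@[fun_prop]
theorem PolyTime.inLanguage {R : ε → RawRelation q} (hG : PolyTime G) (hR : PolyTime R) :
    PolyTime fun e => inLanguage (G e) (R e) := by
  unfold SBD.inLanguage
  fun_prop

@[fun_prop]
theorem PolyTime.violators (hS : PolyTime S) (hR : PolyTime R) (hw : PolyTime w)
    (hG : PolyTime G) : PolyTime fun e => violators (S e) (R e) (w e) (G e) := by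
  unfold SBD.violators
  fun_prop

@[fun_prop]
theorem PolyTime.conflict (hΓ : PolyTime Γ) (hws : PolyTime ws) (hS : PolyTime S)
    (hR : PolyTime R) : PolyTime fun e => conflict (Γ e) (ws e) (S e) (R e) := by
  unfold SBD.conflict
  fun_prop

@[fun_prop]
theorem PolyTime.children (hΓ : PolyTime Γ) (hI : PolyTime I) (hws : PolyTime ws)
    (hn : PolyTime n) (hW : PolyTime W) (hst : PolyTime st) :
    PolyTime fun e => children (Γ e) (I e) (ws e) (n e) (W e) (st e) := by
  unfold SBD.children violationChildren separationChildren
  fun_prop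

@[fun_prop]
theorem PolyTime.step {c : ε → List Unit} (hΓ : PolyTime Γ) (hI : PolyTime I) (hws : PolyTime ws)
    (hn : PolyTime n) (hW : PolyTime W) (hst : PolyTime st) (hc : PolyTime c) :
    PolyTime fun e => step (Γ e) (I e) (ws e) (n e) (W e) (st e) (c e) := by
  unfold SBD.step
  fun_prop

theorem step_eq_or_mem_children (Γ : List (List (RawRelation q))) (I : List (RawConstraint q))
    (ws : List (List (Fin q))) (n : List Unit) (W : List ℕ) (st : State q) (c : List Unit) :
    step Γ I ws n W st c = st ∨ step Γ I ws n W st c ∈ children Γ I ws n W st := by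
  unfold step
  cases h : (children Γ I ws n W st).drop c.length with
  | nil => simp
  | cons a l =>
    right
    exact List.mem_of_mem_drop (by rw [h]; simp)

theorem csize_run_le (Γ : List (List (RawRelation q))) (I : List (RawConstraint q))
    (ws : List (List (Fin q))) (n : List Unit) (W : List ℕ) (cs : List (List Unit)) (st : State q)
    (h : csize st.2 ≤ csize I + 2) :
    csize (run Γ I ws n W st cs) ≤
      csize st.1 + csize I + 3 + csize cs * (csize I + 1) := by
  induction cs generalizing st with
  | nil =>
    have : csize st = csize st.1 + csize st.2 + 1 := rfl
    change csize st ≤ _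
    omega
  | cons c cs ih =>
    have h₁ : csize (step Γ I ws n W st c).1 ≤ csize st.1 + (csize I + 1) ∧
        csize (step Γ I ws n W st c).2 ≤ csize I + 2 := by
      rcases step_eq_or_mem_children Γ I ws n W st c with hst | hst
      · rw [hst]
        exact ⟨by omega, h⟩
      · obtain ⟨h₁ | ⟨C, hC, x, hx, -, -, h₁⟩, h₂⟩ := mem_children hst
        · rw [h₁]
          exact ⟨by omega, h₂⟩
        · have h₃ := csize_le_of_mem hC
          have h₄ := csize_le_of_mem hx
          have h₅ : csize C = csize C.1 + csize C.2 + 1 := rfl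
          rw [h₁]
          exact ⟨by simp only [csize_cons]; omega, h₂⟩
    have h₂ := ih _ h₁.2
    have h₃ : run Γ I ws n W st (c :: cs) = run Γ I ws n W (step Γ I ws n W st c) cs := rfl
    rw [h₃, csize_cons, add_mul, add_mul]
    omega

@[fun_prop]
theorem PolyTime.run {cs : ε → List (List Unit)} (hΓ : PolyTime Γ) (hI : PolyTime I)
    (hws : PolyTime ws) (hn : PolyTime n) (hW : PolyTime W) (hS : PolyTime S)
    (hcs : PolyTime cs) :
    PolyTime fun e => run (Γ e) (I e) (ws e) (n e) (W e) (S e, []) (cs e) := by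
  refine PolyTime.foldl (h := fun e => SBD.step (Γ e) (I e) (ws e) (n e) (W e)) hcs (by fun_prop)
    (by fun_prop) (((hS.polyBounded_csize.add hI.polyBounded_csize).add (.const 3)).add
      (hcs.polyBounded_csize.mul (hI.polyBounded_csize.add (.const 1)))) fun e l hl => ?_
  refine (csize_run_le _ _ _ _ _ _ _ ?_).trans ?_
  · simp
  · exact Nat.add_le_add_left (Nat.mul_le_mul (csize_le_of_sublist hl.sublist) le_rfl) _

@[fun_prop]
theorem PolyTime.accepts (hΓ : PolyTime Γ) (hI : PolyTime I) (hws : PolyTime ws)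
    (hk : PolyTime k) (hW : PolyTime W) (hst : PolyTime st) :
    PolyTime fun e => accepts (Γ e) (I e) (ws e) (k e) (W e) (st e) := by
  unfold SBD.accepts
  fun_prop

@[fun_prop]
theorem PolyTime.findBackdoor {css : ε → List (List (List Unit))} (hΓ : PolyTime Γ)
    (hI : PolyTime I) (hws : PolyTime ws) (hcss : PolyTime css) (hk : PolyTime k)
    (hS : PolyTime S) (hW : PolyTime W) :
    PolyTime fun e => findBackdoor (Γ e) (I e) (ws e) (css e) (k e) (S e) (W e) := by
  unfold SBD.findBackdoor
  fun_prop

end PolyTime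

end Algorithm

/-! ### Correctness of the computation of separators -/

section Separators

variable {q : ℕ} {I : List (RawConstraint q)} {S W : List ℕ} {n : List Unit}

theorem distinctVars_spec (l : List ℕ) :
    (distinctVars l).Nodup ∧ ∀ x, x ∈ distinctVars l ↔ x ∈ l := by
  have key : ∀ l s : List ℕ, s.Nodup →
      (l.foldl (fun s x => bif decide (x ∈ s) then s else x :: s) s).Nodup ∧
        ∀ x, x ∈ l.foldl (fun s x => bif decide (x ∈ s) then s else x :: s) s ↔ x ∈ l ∨ x ∈ s := by
    intro l
    induction l with
    | nil => intro s hs; simpa using hs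
    | cons a l ih =>
      intro s hs
      rw [List.foldl_cons]
      by_cases h : a ∈ s
      · simp only [h, decide_true, cond_true]
        refine ⟨(ih s hs).1, fun x => ?_⟩
        rw [(ih s hs).2, List.mem_cons]
        constructor
        · tauto
        · rintro ((rfl | h') | h') <;> tauto
      · simp only [h, decide_false, cond_false]
        have hs' : (a :: s).Nodup := List.nodup_cons.2 ⟨h, hs⟩
        refine ⟨(ih _ hs').1, fun x => ?_⟩
        rw [(ih _ hs').2, List.mem_cons, List.mem_cons]
        tauto
  simpa [distinctVars] using key l [] List.nodup_nil

open Classical in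
/-- The set of nodes on the side of a set `R` of constraints: it contains one copy of every variable
that occurs in `R`, and the other copy as well if the variable occurs only in `R`. -/
noncomputable def sideOf (I : List (RawConstraint q)) (R : RawConstraint q → Prop) :
    Node q → Bool
  | ([], [C]) => decide (R C)
  | ([(false, x)], []) => decide (∃ C ∈ I, R C ∧ x ∈ C.1)
  | ([(true, x)], []) => decide (∀ C ∈ I, x ∈ C.1 → R C)
  | _ => false

theorem sideOf_conNode {R : RawConstraint q → Prop} {C : RawConstraint q} :
    sideOf I R (conNode C) = true ↔ R C := by
  simp [sideOf, conNode]

theorem sideOf_inNode {R : RawConstraint q → Prop} {x : ℕ} :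
    sideOf I R (inNode q x) = true ↔ ∃ C ∈ I, R C ∧ x ∈ C.1 := by
  simp [sideOf, inNode]

theorem sideOf_outNode {R : RawConstraint q → Prop} {x : ℕ} :
    sideOf I R (outNode q x) = true ↔ ∀ C ∈ I, x ∈ C.1 → R C := by
  simp [sideOf, outNode]

/-- The arcs that leave the side of `R` are those of the boundary variables of `R`. -/
theorem cut_flowArcs_sideOf (R : RawConstraint q → Prop) :
    cut (flowArcs I S n) (sideOf I R) = (boundary toConstraint I S.toFinset R).card := by
  have h₁ : (I.flatMap fun C => (C.1.filter fun x => !decide (x ∈ S)).flatMap fun x =>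
      n.flatMap fun _ => [(conNode C, inNode q x), (outNode q x, conNode C)]).countP
        (fun a => sideOf I R a.1 && !sideOf I R a.2) = 0 := by
    refine List.countP_eq_zero.2 fun a ha => ?_
    simp only [List.mem_flatMap, List.mem_filter, List.mem_cons, List.not_mem_nil, or_false] at ha
    obtain ⟨C, hC, x, ⟨hx, -⟩, -, -, rfl | rfl⟩ := ha
    · simp only [Bool.and_eq_true, Bool.not_eq_true', Bool.eq_false_iff, ne_eq, sideOf_conNode,
        sideOf_inNode, not_and, not_not]
      exact fun hR => ⟨C, hC, hR, hx⟩
    · simp only [Bool.and_eq_true, Bool.not_eq_true', Bool.eq_false_iff, ne_eq, sideOf_conNode,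
        sideOf_outNode, not_and, not_not]
      exact fun hR => hR C hC hx
  rw [cut, flowArcs, List.countP_append, h₁, add_zero, List.countP_map,
    List.countP_eq_length_filter,
    ← List.toFinset_card_of_nodup (((distinctVars_spec _).1.filter _).filter _)]
  congr 1
  ext x
  simp only [List.mem_toFinset, List.mem_filter, Function.comp, (distinctVars_spec _).2,
    Bool.and_eq_true, Bool.not_eq_true', Bool.eq_false_iff, ne_eq, sideOf_inNode, sideOf_outNode,
    decide_eq_true_eq, mem_boundary, List.mem_flatMap, toConstraint]
  constructor
  · rintro ⟨⟨-, hS⟩, h, h'⟩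
    push Not at h'
    obtain ⟨C, hC, hx, hR⟩ := h'
    exact ⟨hS, h, C, hC, hR, hx⟩
  · rintro ⟨hS, ⟨C', hC', hR', hx'⟩, C, hC, hR, hx⟩
    exact ⟨⟨⟨C, hC, hx⟩, hS⟩, ⟨C', hC', hR', hx'⟩, fun h => hR (h C hC hx)⟩

theorem sublist_flatMap_of_mem {α β : Type} {l : List α} {f : α → List β} {a : α} (h : a ∈ l) :
    (f a).Sublist (l.flatMap f) := by
  obtain ⟨l₁, l₂, rfl⟩ := List.append_of_mem h
  simp

/-- A set that is left by few arcs is not left by any repeated arc. -/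
theorem le_of_cut_flowArcs_lt {Q : Node q → Bool} (h : cut (flowArcs I S n) Q < n.length)
    {C : RawConstraint q} (hC : C ∈ I) {x : ℕ} (hx : x ∈ C.1) (hS : x ∉ S) :
    (Q (conNode C) = true → Q (inNode q x) = true) ∧
      (Q (outNode q x) = true → Q (conNode C) = true) := by
  have hsub : (n.flatMap fun _ => [(conNode C, inNode q x), (outNode q x, conNode C)]).Sublist
      (flowArcs I S n) := by
    have h₁ := sublist_flatMap_of_mem (l := C.1.filter fun x => !decide (x ∈ S)) (a := x)
      (f := fun x => n.flatMap fun _ => [(conNode C, inNode q x), (outNode q x, conNode C)])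
      (by simp [hx, hS])
    have h₂ := sublist_flatMap_of_mem (a := C) (f := fun C => (C.1.filter fun x =>
      !decide (x ∈ S)).flatMap fun x => n.flatMap fun _ =>
        [(conNode C, inNode q x), (outNode q x, conNode C)]) hC
    exact (h₁.trans h₂).trans (List.sublist_append_right _ _)
  have hle := hsub.countP_le (p := fun a => Q a.1 && !Q a.2)
  have hcount : ∀ m : List Unit, (∃ a ∈ [(conNode C, inNode q x), (outNode q x, conNode C)],
      (Q a.1 && !Q a.2) = true) →
      m.length ≤ (m.flatMap fun _ => [(conNode C, inNode q x), (outNode q x, conNode C)]).countP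
        (fun a => Q a.1 && !Q a.2) := by
    intro m hm
    have h₁ := List.countP_pos_iff.2 hm
    induction m with
    | nil => simp
    | cons a m ih =>
      rw [List.flatMap_cons, List.countP_append, List.length_cons]
      omega
  have hno : ¬ ∃ a ∈ [(conNode C, inNode q x), (outNode q x, conNode C)],
      (Q a.1 && !Q a.2) = true := fun hm => by
    have := hcount n hm
    unfold cut at h
    omega
  constructor
  · intro h₁
    by_contra h₂
    exact hno ⟨(conNode C, inNode q x), by simp, by simp [h₁, h₂]⟩
  · intro h₁
    by_contra h₂
    exact hno ⟨(outNode q x, conNode C), by simp, by simp [h₁, h₂]⟩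

theorem card_boundary_le_cut_flowArcs {Q : Node q → Bool}
    (h : cut (flowArcs I S n) Q < n.length) :
    (boundary toConstraint I S.toFinset fun C => Q (conNode C) = true).card ≤
      cut (flowArcs I S n) Q := by
  have hle : (boundary toConstraint I S.toFinset fun C => Q (conNode C) = true) ⊆
      (((distinctVars (I.flatMap Prod.fst)).filter fun x => !decide (x ∈ S)).filter fun x =>
        Q (inNode q x) && !Q (outNode q x)).toFinset := by
    intro x hx
    obtain ⟨hS, ⟨C, hC, hCQ, hxC⟩, C', hC', hCQ', hxC'⟩ := mem_boundary.1 hx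
    have hS' : x ∉ S := by simpa using hS
    have h₁ := (le_of_cut_flowArcs_lt h hC hxC hS').1 hCQ
    have h₂ := mt (le_of_cut_flowArcs_lt h hC' hxC' hS').2 hCQ'
    simp only [List.mem_toFinset, List.mem_filter, (distinctVars_spec _).2]
    refine ⟨⟨List.mem_flatMap.2 ⟨C, hC, hxC⟩, by simpa using hS'⟩, by simp [h₁, h₂]⟩
  refine (Finset.card_le_card hle).trans ((List.toFinset_card_le _).trans ?_)
  rw [← List.countP_eq_length_filter, cut, flowArcs, List.countP_append, List.countP_map]
  exact Nat.le_add_right _ _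

/-- If fewer variables than the length of `n` suffice to separate `A` from `W`, then
`minCutSide I S W A n` is the largest set with the least number of boundary variables. -/
theorem minCutSide_spec {A : List (RawConstraint q)} (hA : A ⊆ I) {R₀ : RawConstraint q → Prop}
    (hA₀ : ∀ C ∈ A, R₀ C) (hW₀ : Avoids toConstraint I W.toFinset R₀)
    (hlt : (boundary toConstraint I S.toFinset R₀).card < n.length) :
    A ⊆ minCutSide I S W A n ∧
    ∀ R : RawConstraint q → Prop, (∀ C ∈ A, R C) → Avoids toConstraint I W.toFinset R →
      (boundary toConstraint I S.toFinset fun C => C ∈ minCutSide I S W A n).card ≤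
          (boundary toConstraint I S.toFinset R).card ∧
        ((boundary toConstraint I S.toFinset R).card ≤
          (boundary toConstraint I S.toFinset fun C => C ∈ minCutSide I S W A n).card →
          ∀ C ∈ I, R C → C ∈ minCutSide I S W A n) := by
  have hside : ∀ R : RawConstraint q → Prop, (∀ C ∈ A, R C) → Avoids toConstraint I W.toFinset R →
      (∀ v ∈ A.map conNode, sideOf I R v = true) ∧
      (∀ v ∈ (touching I W).map conNode, sideOf I R v = false) := by
    intro R hRA hRW
    constructor
    · intro v hv
      obtain ⟨C, hC, rfl⟩ := List.mem_map.1 hv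
      exact sideOf_conNode.2 (hRA C hC)
    · intro v hv
      obtain ⟨C, hC, rfl⟩ := List.mem_map.1 hv
      obtain ⟨hCI, x, hx, hxW⟩ := mem_touching.1 hC
      rw [Bool.eq_false_iff, ne_eq, sideOf_conNode]
      exact fun hR => hRW C hCI hR x hx (by simpa using hxW)
  obtain ⟨h₁, h₂⟩ := hside R₀ hA₀ hW₀
  rw [← cut_flowArcs_sideOf (n := n)] at hlt
  obtain ⟨hsA, -, hmin⟩ := sinkSide_spec h₁ h₂ hlt
  have hbd : (boundary toConstraint I S.toFinset fun C => C ∈ minCutSide I S W A n) =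
      boundary toConstraint I S.toFinset fun C => conNode C ∉
        sinkSide (flowArcs I S n) (A.map conNode) ((touching I W).map conNode) n := by
    ext x
    simp only [mem_boundary, mem_minCutSide]
    constructor
    · rintro ⟨hS, ⟨C, hC, hCR, hx⟩, C', hC', hCR', hx'⟩
      exact ⟨hS, ⟨C, hC, hCR.2, hx⟩, C', hC', fun h => hCR' ⟨hC', h⟩, hx'⟩
    · rintro ⟨hS, ⟨C, hC, hCR, hx⟩, C', hC', hCR', hx'⟩
      exact ⟨hS, ⟨C, hC, ⟨hC, hCR⟩, hx⟩, C', hC', fun h => hCR' h.2, hx'⟩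
  have hle := card_boundary_le_cut_flowArcs ((hmin _ h₁ h₂).1.trans_lt hlt)
  simp only [decide_eq_true_eq] at hle
  rw [← hbd] at hle
  refine ⟨fun C hC => mem_minCutSide.2 ⟨hA hC, hsA _ (List.mem_map_of_mem hC)⟩,
    fun R hRA hRW => ?_⟩
  obtain ⟨h₃, h₄⟩ := hmin _ (hside R hRA hRW).1 (hside R hRA hRW).2
  rw [cut_flowArcs_sideOf] at h₃ h₄
  exact ⟨hle.trans h₃, fun h C hC hR =>
    mem_minCutSide.2 ⟨hC, h₄ (h.trans hle) _ (sideOf_conNode.2 hR)⟩⟩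

end Separators

/-! ### Correctness of the search -/

section Search

variable {q d : ℕ}

/-- A language as it is presented to the algorithm. -/
noncomputable def rawLanguage (G : Finset (Relation q)) : List (RawRelation q) :=
  G.toList.map fun R => (List.replicate R.arity (), R.tuples.toList)

/-- All languages as they are presented to the algorithm. -/
noncomputable def rawLanguages (Γ : Fin d → Finset (Relation q)) : List (List (RawRelation q)) :=
  (List.finRange d).map fun i => rawLanguage (Γ i)

theorem exists_mem_zip_of_mem {α β : Type} {l : List α} {m : List β} (h : l.length ≤ m.length)
    {a : α} (ha : a ∈ l) : ∃ b, (a, b) ∈ l.zip m := by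
  have : a ∈ (l.zip m).map Prod.fst := by rwa [List.map_fst_zip h]
  obtain ⟨p, hp, rfl⟩ := List.mem_map.1 this
  exact ⟨p.2, hp⟩

theorem mem_reduct {S : List ℕ} {w : List (Fin q)} (hlen : S.length ≤ w.length) {α : ℕ → Fin q}
    (hα : ∀ b ∈ S.zip w, α b.1 = b.2) {C : RawConstraint q}
    (hC : ∀ t ∈ C.2, t.length = C.1.length) (u : List (Fin q)) :
    u ∈ (reduct S w C).2 ↔ u ∈ ((toConstraint C).restrict S.toFinset α).tuples := by
  have hcons : ∀ t : List (Fin q), ((C.1.zip t).all fun p => (S.zip w).all fun b =>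
      !decide (b.1 = p.1) || decide (b.2 = p.2)) = true ↔
        ∀ p ∈ C.1.zip t, p.1 ∈ S.toFinset → α p.1 = p.2 := by
    intro t
    simp only [List.all_eq_true, Bool.or_eq_true, Bool.not_eq_true', decide_eq_false_iff_not,
      decide_eq_true_eq, List.mem_toFinset]
    refine forall₂_congr fun p hp => ⟨fun h hS => ?_, fun h b hb => ?_⟩
    · obtain ⟨b, hb⟩ := exists_mem_zip_of_mem hlen hS
      have h₁ := (h _ hb).resolve_left (by simp)
      rw [← h₁]
      exact hα _ hb
    · by_cases hbp : b.1 = p.1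
      · right
        rw [← hα b hb, hbp]
        exact h (hbp ▸ (List.of_mem_zip hb).1)
      · exact .inl hbp
  rw [Constraint.mem_tuples_restrict]
  simp only [reduct, List.mem_map, List.mem_filter, hcons]
  constructor
  · rintro ⟨t, ⟨ht, h⟩, rfl⟩
    exact ⟨t, by simp [toConstraint, ht, hC t ht], h, by simp [dropCoords, toConstraint]⟩
  · rintro ⟨t, ht, h, rfl⟩
    simp only [toConstraint, List.mem_toFinset, List.mem_filter] at ht
    exact ⟨t, ⟨ht.1, h⟩, by simp [dropCoords, toConstraint]⟩

theorem inLanguage_reduct {S : List ℕ} {w : List (Fin q)} (hlen : S.length ≤ w.length)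
    {α : ℕ → Fin q} (hα : ∀ b ∈ S.zip w, α b.1 = b.2) {C : RawConstraint q}
    (hC : ∀ t ∈ C.2, t.length = C.1.length) (G : Finset (Relation q)) :
    inLanguage (rawLanguage G) (reduct S w C) = true ↔
      ((toConstraint C).restrict S.toFinset α).rel ∈ G := by
  have hmem := mem_reduct hlen hα hC
  have harity : ∀ n : ℕ, List.replicate n () = (reduct S w C).1 ↔
      n = ((toConstraint C).restrict S.toFinset α).rel.arity := by
    intro n
    have : (reduct S w C).1 =
        List.replicate ((toConstraint C).restrict S.toFinset α).rel.arity () := by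
      simp [reduct, Constraint.rel, Constraint.restrict, toConstraint]
    rw [this, List.replicate_inj]
    tauto
  simp only [inLanguage, rawLanguage, List.any_map, List.any_eq_true, Function.comp,
    Bool.and_eq_true, decide_eq_true_eq, List.all_eq_true, Finset.mem_toList, hmem, harity]
  constructor
  · rintro ⟨R, hR, ⟨h₁, h₂⟩, h₃⟩
    have : R = ((toConstraint C).restrict S.toFinset α).rel := by
      ext1
      · exact h₁
      · ext t
        exact ⟨fun h => h₂ t h, fun h => h₃ t h⟩
    rwa [← this]
  · intro h
    exact ⟨_, h, ⟨rfl, fun t ht => ht⟩, fun t ht => ht⟩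

/-- All words over the alphabet `A` whose length is that of `n`. -/
def words {α : Type} (A : List α) (n : List Unit) : List (List α) :=
  n.foldl (fun ws _ => A.flatMap fun a => ws.map fun w => a :: w) [[]]

theorem mem_words {α : Type} {A : List α} {n : List Unit} {w : List α} :
    w ∈ words A n ↔ w.length = n.length ∧ ∀ a ∈ w, a ∈ A := by
  have key : ∀ (n : List Unit) (ws : List (List α)) (w : List α),
      w ∈ n.foldl (fun ws _ => A.flatMap fun a => ws.map fun w => a :: w) ws ↔
        ∃ u v, v ∈ ws ∧ w = u ++ v ∧ u.length = n.length ∧ ∀ a ∈ u, a ∈ A := by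
    intro n
    induction n with
    | nil =>
      intro ws w
      constructor
      · intro h
        exact ⟨[], w, h, by simp⟩
      · rintro ⟨u, v, hv, rfl, hu, -⟩
        rw [List.length_nil, List.length_eq_zero_iff] at hu
        simpa [hu] using hv
    | cons x n ih =>
      intro ws w
      rw [List.foldl_cons, ih]
      constructor
      · rintro ⟨u, v, hv, rfl, hu, huA⟩
        simp only [List.mem_flatMap, List.mem_map] at hv
        obtain ⟨a, ha, v, hv, rfl⟩ := hv
        refine ⟨u ++ [a], v, hv, by simp, by simp [hu], fun b hb => ?_⟩
        rcases List.mem_append.1 hb with hb | hb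
        · exact huA b hb
        · rw [List.mem_singleton] at hb
          rwa [hb]
      · rintro ⟨u, v, hv, rfl, hu, huA⟩
        rcases List.eq_nil_or_concat u with rfl | ⟨u, a, rfl⟩
        · simp at hu
        · refine ⟨u, a :: v, ?_, by simp, by simpa using hu, fun b hb => huA b (by simp [hb])⟩
          exact List.mem_flatMap.2 ⟨a, huA a (by simp), List.mem_map.2 ⟨v, hv, rfl⟩⟩
  rw [words, key]
  constructor
  · rintro ⟨u, v, hv, rfl, hu, huA⟩
    rw [List.mem_singleton] at hv
    subst hv
    simpa using ⟨hu, huA⟩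
  · rintro ⟨h₁, h₂⟩
    exact ⟨w, [], by simp, by simp, h₁, h₂⟩

theorem exists_assignment [NeZero q] {S : List ℕ} (hS : S.Nodup) (w : List (Fin q)) :
    ∃ α : ℕ → Fin q, ∀ b ∈ S.zip w, α b.1 = b.2 := by
  induction S generalizing w with
  | nil => exact ⟨fun _ => 0, by simp⟩
  | cons x S ih =>
    cases w with
    | nil => exact ⟨fun _ => 0, by simp⟩
    | cons a w =>
      obtain ⟨α, hα⟩ := ih (List.nodup_cons.1 hS).2 w
      refine ⟨Function.update α x a, fun b hb => ?_⟩
      rw [List.zip_cons_cons, List.mem_cons] at hb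
      rcases hb with rfl | hb
      · simp
      · have : b.1 ≠ x := fun h => (List.nodup_cons.1 hS).1 (h ▸ (List.of_mem_zip hb).1)
        rw [Function.update_of_ne this]
        exact hα b hb

theorem eq_of_mem_zip_map (α : ℕ → Fin q) (S : List ℕ) (r : List (Fin q)) :
    ∀ b ∈ S.zip (S.map α ++ r), α b.1 = b.2 := by
  induction S with
  | nil => simp
  | cons x S ih =>
    intro b hb
    rw [List.map_cons, List.cons_append, List.zip_cons_cons, List.mem_cons] at hb
    rcases hb with rfl | hb
    · rfl
    · exact ih b hb

/-- The letters of which sequences of choices consist: the numbers less than `B` in unary. -/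
def letters (B : ℕ) : List (List Unit) := (List.range B).map fun j => List.replicate j ()

theorem exists_step_eq {Γ : List (List (RawRelation q))} {ws : List (List (Fin q))} {n : List Unit}
    {I : List (RawConstraint q)} {W : List ℕ}
    {st st' : State q} {B : ℕ} (hB : (children Γ I ws n W st).length ≤ B)
    (h : st' ∈ children Γ I ws n W st) : ∃ c ∈ letters B, step Γ I ws n W st c = st' := by
  obtain ⟨j, hj, rfl⟩ := List.getElem_of_mem h
  refine ⟨List.replicate j (), List.mem_map.2 ⟨j, by simp; omega, rfl⟩, ?_⟩
  simp [step, List.headD_eq_head?_getD, List.head?_drop, hj]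

variable {Γ : Fin d → Finset (Relation q)} {I : List (RawConstraint q)} {S W : List ℕ}
  {k : List Unit}

theorem conflict_eq_nil_iff [NeZero q] (hI : ∀ C ∈ I, ∀ t ∈ C.2, t.length = C.1.length)
    (hS : S.Nodup) (hk : S.length ≤ k.length) :
    conflict (rawLanguages Γ) (words (List.finRange q) k) S (linkedList I S W) = [] ↔
      IsGood toConstraint I W.toFinset Γ S.toFinset := by
  have hviol : ∀ (w : List (Fin q)) (α : ℕ → Fin q), S.length ≤ w.length →
      (∀ b ∈ S.zip w, α b.1 = b.2) → ∀ i,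
      (violators S (linkedList I S W) w (rawLanguage (Γ i)) = [] ↔
        ∀ C, Linked toConstraint I W.toFinset S.toFinset C →
          ((toConstraint C).restrict S.toFinset α).rel ∈ Γ i) := by
    intro w α hlen hα i
    simp only [violators, List.filter_eq_nil_iff, mem_linkedList, Bool.not_eq_true',
      Bool.not_eq_false]
    exact forall₂_congr fun C hC => inLanguage_reduct hlen hα (hI C hC.mem) (Γ i)
  have h0 : conflict (rawLanguages Γ) (words (List.finRange q) k) S (linkedList I S W) = [] ↔
      ∀ w ∈ words (List.finRange q) k, ∃ i,
        violators S (linkedList I S W) w (rawLanguage (Γ i)) = [] := by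
    simp [conflict, rawLanguages, List.filter_eq_nil_iff]
  rw [h0]
  constructor
  · intro h α
    obtain ⟨i, hi⟩ := h (S.map α ++ List.replicate (k.length - S.length) 0)
      (mem_words.2 ⟨by simp; omega, fun a _ => List.mem_finRange a⟩)
    exact ⟨i, (hviol _ α (by simp) (eq_of_mem_zip_map α S _) i).1 hi⟩
  · intro h w hw
    obtain ⟨α, hα⟩ := exists_assignment hS w
    obtain ⟨i, hi⟩ := h α
    exact ⟨i, (hviol w α (by rw [(mem_words.1 hw).1]; exact hk) hα i).2 hi⟩

theorem length_flatMap_le {α β : Type} {f : α → List β} {m : ℕ} (l : List α)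
    (h : ∀ a ∈ l, (f a).length ≤ m) : (l.flatMap f).length ≤ l.length * m := by
  induction l with
  | nil => simp
  | cons a l ih =>
    have h₁ := h a (by simp)
    have h₂ := ih fun b hb => h b (by simp [hb])
    rw [List.flatMap_cons, List.length_append, List.length_cons, add_mul]
    omega

theorem length_children_le {ws : List (List (Fin q))} {n : List Unit} {st : State q} {ρ : ℕ}
    (hρ : ∀ C ∈ I, (C.1.filter fun x => !decide (x ∈ st.1) && !decide (x ∈ W)).length ≤ ρ) :
    (children (rawLanguages Γ) I ws n W st).length ≤ d * (ρ + 1) + 2 := by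
  unfold children
  cases st.2.isEmpty with
  | true =>
    rw [cond_true]
    have h₁ := length_flatMap_le (m := d * (ρ + 1))
      (f := fun w => (rawLanguages Γ).flatMap fun G =>
        ((violators st.1 (linkedList I st.1 W) w G).take 1).flatMap fun C =>
          (st.1, [C]) :: (C.1.filter fun x => !decide (x ∈ st.1) && !decide (x ∈ W)).map
            fun x => (x :: st.1, []))
      (conflict (rawLanguages Γ) ws st.1 (linkedList I st.1 W)) (fun w _ => by
        refine (length_flatMap_le (m := ρ + 1) _ fun G _ => ?_).trans (by simp [rawLanguages])
        refine (length_flatMap_le (m := ρ + 1) _ fun C hC => ?_).trans ?_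
        · have hCI : C ∈ I :=
            (mem_linkedList.1 (List.mem_filter.1 (List.mem_of_mem_take hC)).1).mem
          simpa using hρ C hCI
        · have : ((violators st.1 (linkedList I st.1 W) w G).take 1).length ≤ 1 :=
            List.length_take_le _ _
          exact (Nat.mul_le_mul this le_rfl).trans (by omega))
    have h₂ : (conflict (rawLanguages Γ) ws st.1 (linkedList I st.1 W)).length ≤ 1 :=
      List.length_take_le _ _
    have h₃ := Nat.mul_le_mul h₂ (le_refl (d * (ρ + 1)))
    unfold violationChildren
    omega
  | false =>
    rw [cond_false]
    have h₁ : ((boundaryList I st.1 (minCutSide I st.1 W st.2 n)).take 1).length ≤ 1 :=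
      List.length_take_le _ _
    have h₂ := length_flatMap_le (m := 2) (f := fun v => [((v :: st.1, []) : State q),
      (st.1, I.filter fun C => decide (C ∈ minCutSide I st.1 W st.2 n) || decide (v ∈ C.1))])
      ((boundaryList I st.1 (minCutSide I st.1 W st.2 n)).take 1) (fun _ _ => by simp)
    unfold separationChildren
    omega

theorem accepts_of_conflict_eq_nil {ws : List (List (Fin q))} {A : List (RawConstraint q)}
    (hS : S.length ≤ k.length)
    (h : conflict (rawLanguages Γ) ws S (linkedList I S W) = []) :
    accepts (rawLanguages Γ) I ws k W (S, A) = true := by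
  simp [accepts, h, hS]

end Search

section Search

variable {q d : ℕ} {Γ : Fin d → Finset (Relation q)} {I : List (RawConstraint q)}
  {S W : List ℕ} {A : List (RawConstraint q)} {k : List Unit}

/-- The state `(S, A)` leads to a solution: `S` extends to a good set `Z` that separates `A` from
`W`, and at least `m` variables outside `S` are needed to separate `A` from `W`. The number `m` is
zero if there is nothing to be separated, and positive otherwise. -/
structure IsPromising (Γ : Fin d → Finset (Relation q)) (I : List (RawConstraint q)) (k : ℕ)
    (W S : List ℕ) (A : List (RawConstraint q)) (m : ℕ) : Prop where
  nodup : S.Nodup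
  subset : A ⊆ I
  exists_solution : ∃ Z, IsGood toConstraint I W.toFinset Γ Z ∧ S.toFinset ⊆ Z ∧
    Z ⊆ (instanceOf toConstraint I).vars ∧ Disjoint Z W.toFinset ∧ Z.card ≤ k ∧
    ∀ C ∈ A, ¬ Linked toConstraint I W.toFinset Z C
  eq_zero : A = [] → m = 0
  pos : A ≠ [] → 0 < m
  exists_linked : A ≠ [] → ∃ C ∈ A, Linked toConstraint I W.toFinset S.toFinset C
  le_card : A ≠ [] → ∀ R : RawConstraint q → Prop, (∀ C ∈ A, R C) →
    Avoids toConstraint I W.toFinset R → m ≤ (boundary toConstraint I S.toFinset R).card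

theorem IsPromising.length_le {m : ℕ} (h : IsPromising Γ I k.length W S A m) :
    S.length ≤ k.length := by
  obtain ⟨Z, -, hSZ, -, -, hZk, -⟩ := h.exists_solution
  rw [← List.toFinset_card_of_nodup h.nodup]
  exact (Finset.card_le_card hSZ).trans hZk

/-- A state without a set to be separated is promising if it is contained in a solution. -/
theorem isPromising_nil {Z : Finset ℕ} {k : ℕ} (hS : S.Nodup)
    (hZ : IsGood toConstraint I W.toFinset Γ Z)
    (hSZ : S.toFinset ⊆ Z) (hZI : Z ⊆ (instanceOf toConstraint I).vars)
    (hZW : Disjoint Z W.toFinset) (hZk : Z.card ≤ k) : IsPromising Γ I k W S [] 0 where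
  nodup := hS
  subset := by simp
  exists_solution := ⟨Z, hZ, hSZ, hZI, hZW, hZk, by simp⟩
  eq_zero _ := rfl
  pos h := (h rfl).elim
  exists_linked h := (h rfl).elim
  le_card h := (h rfl).elim

theorem isPromising_cons {Z : Finset ℕ} {k : ℕ} (hS : S.Nodup)
    (hZ : IsGood toConstraint I W.toFinset Γ Z)
    (hSZ : S.toFinset ⊆ Z) (hZI : Z ⊆ (instanceOf toConstraint I).vars)
    (hZW : Disjoint Z W.toFinset) (hZk : Z.card ≤ k) {x : ℕ} (hx : x ∈ Z) (hxS : x ∉ S) :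
    IsPromising Γ I k W (x :: S) [] 0 :=
  isPromising_nil (List.nodup_cons.2 ⟨hxS, hS⟩) hZ (by
    rw [List.toFinset_cons]
    exact Finset.insert_subset hx hSZ) hZI hZW hZk

/-- If `(S, [])` does not provide a solution, then one of its successors is promising, and the
measure `(k - |S|) * (k + 2) - m` decreases. A solution `Z` extends the conflicting assignment of
`S`, so some language `Γ i` contains all reducts with respect to `Z`; the constraint chosen for
`Γ i` violates it, so it is no longer linked to `W` or contains a variable in `Z` outside `S`. -/
theorem IsPromising.exists_mem_violationChildren [NeZero q]
    (hI : ∀ C ∈ I, ∀ t ∈ C.2, t.length = C.1.length) (h : IsPromising Γ I k.length W S [] 0)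
    (hconf : conflict (rawLanguages Γ) (words (List.finRange q) k) S (linkedList I S W) ≠ []) :
    ∃ S' A' m, (S', A') ∈ violationChildren (rawLanguages Γ) I (words (List.finRange q) k) W S ∧
      IsPromising Γ I k.length W S' A' m ∧
      (k.length - S'.length) * (k.length + 2) + 1 ≤
        (k.length - S.length) * (k.length + 2) + m := by
  have hlen := h.length_le
  obtain ⟨Z, hZ, hSZ, hZI, hZW, hZk, -⟩ := h.exists_solution
  have hlt : S.length < k.length := by
    refine lt_of_le_of_ne hlen fun heq => hconf ((conflict_eq_nil_iff hI h.nodup hlen).2 ?_)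
    have : S.toFinset = Z := Finset.eq_of_subset_of_card_le hSZ (by
      rw [List.toFinset_card_of_nodup h.nodup]; omega)
    rwa [this]
  obtain ⟨w, hw⟩ := List.exists_mem_of_ne_nil _ hconf
  have hw' := List.mem_filter.1 (List.mem_of_mem_take hw)
  obtain ⟨α, hα⟩ := exists_assignment h.nodup w
  obtain ⟨i, hi⟩ := hZ α
  have hG : rawLanguage (Γ i) ∈ rawLanguages Γ := List.mem_map_of_mem (List.mem_finRange i)
  have hviol : violators S (linkedList I S W) w (rawLanguage (Γ i)) ≠ [] := by
    have := List.all_eq_true.1 hw'.2 _ hG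
    simpa using this
  obtain ⟨C, l, hCl⟩ := List.exists_cons_of_ne_nil hviol
  have hC : C ∈ violators S (linkedList I S W) w (rawLanguage (Γ i)) := by simp [hCl]
  obtain ⟨hCL, hCv⟩ := List.mem_filter.1 hC
  rw [mem_linkedList] at hCL
  have hwlen : S.length ≤ w.length := by
    rw [(mem_words.1 hw'.1).1]
    exact hlen
  have hrel : ((toConstraint C).restrict S.toFinset α).rel ∉ Γ i := by
    rw [← inLanguage_reduct hwlen hα (hI C hCL.mem)]
    simpa using hCv
  have hmem : ∀ st : State q, st ∈ (S, [C]) ::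
      ((C.1.filter fun x => !decide (x ∈ S) && !decide (x ∈ W)).map fun x => (x :: S, [])) →
      st ∈ violationChildren (rawLanguages Γ) I (words (List.finRange q) k) W S := fun st hst =>
    List.mem_flatMap.2 ⟨w, hw,
      List.mem_flatMap.2 ⟨_, hG, List.mem_flatMap.2 ⟨C, by simp [hCl], hst⟩⟩⟩
  by_cases hCZ : Linked toConstraint I W.toFinset Z C
  · obtain ⟨x, hx, hxZ, hxS⟩ : ∃ x ∈ C.1, x ∈ Z ∧ x ∉ S := by
      by_contra hno
      push Not at hno
      refine hrel ?_
      rw [Constraint.restrict_congr (Y := Z) (β := α) (fun x hx => ?_) fun _ _ _ => rfl]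
      · exact hi C hCZ
      · exact ⟨fun hxS => hSZ hxS, fun hxZ => by simpa using hno x hx hxZ⟩
    have hxW : x ∉ W := fun hxW => Finset.disjoint_left.1 hZW hxZ (by simpa using hxW)
    refine ⟨x :: S, [], 0, hmem _ (List.mem_cons_of_mem _ (List.mem_map.2 ⟨x, ?_, rfl⟩)),
      isPromising_cons h.nodup hZ hSZ hZI hZW hZk hxZ hxS, ?_⟩
    · simp [hx, hxS, hxW]
    · rw [List.length_cons]
      obtain ⟨j, hj⟩ : ∃ j, k.length - S.length = j + 1 := ⟨k.length - S.length - 1, by omega⟩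
      rw [hj, show k.length - (S.length + 1) = j by omega, add_mul]
      omega
  · refine ⟨S, [C], 1, hmem _ (by simp), ?_, by omega⟩
    exact {
      nodup := h.nodup
      subset := by simpa using hCL.mem
      exists_solution := ⟨Z, hZ, hSZ, hZI, hZW, hZk, by simpa using hCZ⟩
      eq_zero := by simp
      pos := by simp
      exists_linked := fun _ => ⟨C, by simp, hCL⟩
      le_card := fun _ R hR hRW => Finset.card_pos.2
        ((hCL.not_or_boundary_nonempty hRW).resolve_left (not_not.2 (hR C (by simp)))) }

/-- If a set has to be separated from `W`, then one of the successors is promising: by minimality of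
the cut, the largest minimum cut may be assumed to be separated from `W` by the solution, and as
it is the largest one, adding further constraints to it requires more variables. -/
theorem IsPromising.exists_mem_separationChildren (hΓ : ∀ i, ClosedUnderAssignments (Γ i)) {m : ℕ}
    (h : IsPromising Γ I k.length W S A m) (hA : A ≠ []) :
    ∃ S' A' m', (S', A') ∈ separationChildren I (() :: k) W S A ∧
      IsPromising Γ I k.length W S' A' m' ∧
      (k.length - S'.length) * (k.length + 2) + m + 1 ≤
        (k.length - S.length) * (k.length + 2) + m' := by
  classical
  obtain ⟨Z, hZ, hSZ, hZI, hZW, hZk, hAZ⟩ := h.exists_solution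
  set R := minCutSide I S W A (() :: k) with hRdef
  have hle : (boundary toConstraint I S.toFinset fun C =>
      ¬ Linked toConstraint I W.toFinset Z C).card + S.length ≤ k.length := by
    have h₁ := Finset.card_le_card
      (boundary_not_linked_subset (con := toConstraint) (I := I) (W := W.toFinset)
        (S := S.toFinset) (Z := Z))
    have h₂ := Finset.card_sdiff_add_card_eq_card hSZ
    rw [List.toFinset_card_of_nodup h.nodup] at h₂
    omega
  obtain ⟨hAR, hmin⟩ := minCutSide_spec (n := () :: k) (S := S) h.subset hAZ avoids_not_linked
    (by rw [List.length_cons]; omega)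
  rw [← hRdef] at hAR hmin
  have hRW : Avoids toConstraint I W.toFinset fun C => C ∈ R := avoids_minCutSide I S W A _
  have hmR := h.le_card hA (fun C => C ∈ R) (fun C hC => hAR hC) hRW
  have hRk := (hmin _ hAZ avoids_not_linked).1
  have hm := h.pos hA
  obtain ⟨v, hv⟩ : ∃ v, v ∈ (boundaryList I S R).take 1 := by
    obtain ⟨x, hx⟩ := Finset.card_pos.1 (hm.trans_le hmR)
    cases hl : boundaryList I S R with
    | nil => exact absurd ((mem_boundaryList (minCutSide_subset I S W A _)).2 hx) (by
        rw [← hRdef, hl]; simp)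
    | cons v l => exact ⟨v, by simp⟩
  have hvb := (mem_boundaryList (minCutSide_subset I S W A _)).1 (List.mem_of_mem_take hv)
  rw [← hRdef] at hvb
  obtain ⟨hvS, ⟨C₁, hC₁, hC₁R, hvC₁⟩, C₂, hC₂, hC₂R, hvC₂⟩ := mem_boundary.1 hvb
  have hmem : ∀ st ∈ [((v :: S, []) : State q),
      (S, I.filter fun C => decide (C ∈ R) || decide (v ∈ C.1))],
      st ∈ separationChildren I (() :: k) W S A := fun st hst =>
    List.mem_flatMap.2 ⟨v, hv, hst⟩
  obtain ⟨Z', hZ', hSZ', hZI', hZW', hZk', hRZ'⟩ :=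
    hZ.exists_separating hΓ hSZ hZI hZW hRW
      (hmin (fun C => ¬ Linked toConstraint I W.toFinset Z C ∧ C ∈ R)
        (fun C hC => ⟨hAZ C hC, hAR hC⟩) fun C hC hCR => hRW C hC hCR.2).1
  by_cases hvZ : v ∈ Z'
  · refine ⟨v :: S, [], 0, hmem _ (by simp), isPromising_cons h.nodup hZ' hSZ' hZI' hZW'
      (hZk'.trans hZk) hvZ (by simpa using hvS), ?_⟩
    obtain ⟨j, hj⟩ : ∃ j, k.length - S.length = j + 1 := ⟨k.length - S.length - 1, by omega⟩
    rw [List.length_cons, hj, show k.length - (S.length + 1) = j by omega, add_mul]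
    omega
  · have hAA : ∀ C ∈ A, C ∈ I.filter fun C => decide (C ∈ R) || decide (v ∈ C.1) := fun C hC =>
      List.mem_filter.2 ⟨h.subset hC, by simp [hAR hC]⟩
    refine ⟨S, _, m + 1, hmem _ (List.mem_cons_of_mem _ (List.mem_singleton_self _)), ?_, by omega⟩
    exact {
      nodup := h.nodup
      subset := fun C hC => List.mem_of_mem_filter hC
      exists_solution := by
        refine ⟨Z', hZ', hSZ', hZI', hZW', hZk'.trans hZk, fun C hC hCL => ?_⟩
        obtain ⟨hCI, hC⟩ := List.mem_filter.1 hC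
        rw [Bool.or_eq_true, decide_eq_true_eq, decide_eq_true_eq] at hC
        rcases hC with hC | hC
        · exact hRZ' C hC hCL
        · exact hRZ' C₁ hC₁R (.step hCL hC₁ hC hvC₁ hvZ)
      eq_zero := fun h' => by
        obtain ⟨C, hC⟩ := List.exists_mem_of_ne_nil _ hA
        simpa [h'] using hAA C hC
      pos := fun _ => Nat.succ_pos m
      exists_linked := fun _ => by
        obtain ⟨C, hC, hCL⟩ := h.exists_linked hA
        exact ⟨C, hAA C hC, hCL⟩
      le_card := fun _ R' hR' hRW' => by
        obtain ⟨h₁, h₂⟩ := hmin R' (fun C hC => hR' C (hAA C hC)) hRW'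
        by_contra hcon
        have hC₂' : R' C₂ := hR' C₂ (List.mem_filter.2 ⟨hC₂, by
          have : v ∈ C₂.1 := hvC₂
          simp [this]⟩)
        exact hC₂R (h₂ (by omega) C₂ hC₂ hC₂') }

/-- Some sequence of choices leads from a promising state to a solution: as long as none is reached,
the right choice decreases the measure `(k - |S|) * (k + 2) - m`, because either `S` grows, while
`m` never exceeds `k - |S|`, or `S` stays the same and `m` grows. -/
theorem IsPromising.exists_accepts [NeZero q] (hΓ : ∀ i, ClosedUnderAssignments (Γ i))
    (hI : ∀ C ∈ I, ∀ t ∈ C.2, t.length = C.1.length) {S₀ : List ℕ} {ρ : ℕ}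
    (hρ : ∀ C ∈ I, (C.1.filter fun x => !decide (x ∈ S₀) && !decide (x ∈ W)).length ≤ ρ)
    (N : List Unit) {S : List ℕ} {A : List (RawConstraint q)} {m : ℕ}
    (h : IsPromising Γ I k.length W S A m) (hS₀ : S₀ ⊆ S)
    (hN : (k.length - S.length) * (k.length + 2) ≤ N.length + m) :
    ∃ cs ∈ words (letters (d * (ρ + 1) + 2)) N,
      accepts (rawLanguages Γ) I (words (List.finRange q) k) k W
        (run (rawLanguages Γ) I (words (List.finRange q) k) (() :: k) W (S, A) cs) = true := by
  by_cases hfin : A = [] ∧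
      conflict (rawLanguages Γ) (words (List.finRange q) k) S (linkedList I S W) = []
  · obtain ⟨rfl, hconf⟩ := hfin
    -- No choice changes the state.
    refine ⟨List.replicate N.length [], mem_words.2 ⟨by simp, fun a ha => ?_⟩, ?_⟩
    · exact List.mem_map.2 ⟨0, by simp, (List.eq_of_mem_replicate ha).symm⟩
    · have : ∀ cs, run (rawLanguages Γ) I (words (List.finRange q) k) (() :: k) W (S, []) cs =
          (S, []) := by
        intro cs
        induction cs with
        | nil => rfl
        | cons c cs ih =>
          have : step (rawLanguages Γ) I (words (List.finRange q) k) (() :: k) W (S, []) c =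
              (S, []) := by
            simp [step, children, violationChildren, hconf]
          unfold run at ih ⊢
          rw [List.foldl_cons, this, ih]
      rw [this]
      exact accepts_of_conflict_eq_nil h.length_le hconf
  · obtain ⟨S', A', m', hmem, h', hlt⟩ : ∃ S' A' m', (S', A') ∈
        children (rawLanguages Γ) I (words (List.finRange q) k) (() :: k) W (S, A) ∧
        IsPromising Γ I k.length W S' A' m' ∧
        (k.length - S'.length) * (k.length + 2) + m + 1 ≤
          (k.length - S.length) * (k.length + 2) + m' := by
      by_cases hA : A = []
      · subst hA
        obtain rfl := h.eq_zero rfl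
        simpa [children] using h.exists_mem_violationChildren hI fun hc => hfin ⟨rfl, hc⟩
      · have hA' : A.isEmpty = false := by simpa using hA
        simpa [children, hA'] using h.exists_mem_separationChildren hΓ hA
    -- The measure of the new state is smaller, and it is not negative.
    have hm' : m' ≤ (k.length - S'.length) * (k.length + 2) := by
      by_cases hA' : A' = []
      · rw [h'.eq_zero hA']
        exact Nat.zero_le _
      · obtain ⟨Z, -, hSZ, -, -, hZk, hAZ⟩ := h'.exists_solution
        have h₁ := h'.le_card hA' _ hAZ avoids_not_linked
        have h₂ := Finset.card_le_card
          (boundary_not_linked_subset (con := toConstraint) (I := I) (W := W.toFinset)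
            (S := S'.toFinset) (Z := Z))
        have h₃ := Finset.card_sdiff_add_card_eq_card hSZ
        rw [List.toFinset_card_of_nodup h'.nodup] at h₃
        exact (show m' ≤ k.length - S'.length by omega).trans
          (Nat.le_mul_of_pos_right _ (by omega))
    obtain ⟨x, N, rfl⟩ : ∃ x N', N = x :: N' := List.exists_cons_of_ne_nil fun hnil => by
      rw [hnil] at hN
      simp at hN
      omega
    have hS' : S ⊆ S' := by
      obtain ⟨h₁ | ⟨C, -, x, -, -, -, h₁⟩, -⟩ := mem_children hmem
      · exact fun y hy => by rw [show S' = S from h₁]; exact hy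
      · exact fun y hy => by rw [show S' = x :: S from h₁]; exact List.mem_cons_of_mem _ hy
    obtain ⟨c, hc, hstep⟩ := exists_step_eq (length_children_le (Γ := Γ) (ρ := ρ) fun C hC => by
      refine le_trans (List.Sublist.length_le ?_) (hρ C hC)
      refine List.monotone_filter_right _ fun x hx => ?_
      simp only [Bool.and_eq_true, Bool.not_eq_true', decide_eq_false_iff_not] at hx ⊢
      exact ⟨fun hx' => hx.1 (hS₀ hx'), hx.2⟩) hmem
    obtain ⟨cs, hcs, hacc⟩ := h'.exists_accepts hΓ hI hρ N (fun y hy => hS' (hS₀ hy)) (by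
      rw [List.length_cons] at hN
      omega)
    refine ⟨c :: cs, ?_, ?_⟩
    · rw [mem_words] at hcs ⊢
      refine ⟨by simp [hcs.1], fun a ha => ?_⟩
      rcases List.mem_cons.1 ha with rfl | ha
      · exact hc
      · exact hcs.2 a ha
    · unfold run at hacc ⊢
      rwa [List.foldl_cons, hstep]
termination_by N.length

theorem run_invariant {Γ : List (List (RawRelation q))} {ws : List (List (Fin q))} {n : List Unit}
    (cs : List (List Unit)) (st : State q) (hst : st.1.Nodup) (hW : ∀ x ∈ st.1, x ∉ W)
    (hI : ∀ x ∈ st.1, x ∈ (instanceOf toConstraint I).vars) :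
    (run Γ I ws n W st cs).1.Nodup ∧ st.1 ⊆ (run Γ I ws n W st cs).1 ∧
      (∀ x ∈ (run Γ I ws n W st cs).1, x ∉ W) ∧
      ∀ x ∈ (run Γ I ws n W st cs).1, x ∈ (instanceOf toConstraint I).vars := by
  induction cs generalizing st with
  | nil => exact ⟨hst, List.Subset.refl _, hW, hI⟩
  | cons c cs ih =>
    have hrun : run Γ I ws n W st (c :: cs) = run Γ I ws n W (step Γ I ws n W st c) cs := rfl
    rw [hrun]
    have key : (step Γ I ws n W st c).1 = st.1 ∨
        ∃ C ∈ I, ∃ x ∈ C.1, x ∉ st.1 ∧ x ∉ W ∧ (step Γ I ws n W st c).1 = x :: st.1 := by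
      rcases step_eq_or_mem_children Γ I ws n W st c with h | h
      · rw [h]
        exact .inl rfl
      · exact (mem_children h).1
    rcases key with h | ⟨C, hC, x, hx, hxS, hxW, h⟩
    · obtain ⟨h₁, h₂, h₃⟩ := ih (step Γ I ws n W st c) (by rwa [h]) (by rwa [h]) (by rwa [h])
      rw [h] at h₂
      exact ⟨h₁, h₂, h₃⟩
    · obtain ⟨h₁, h₂, h₃⟩ := ih (step Γ I ws n W st c)
        (by rw [h]; exact List.nodup_cons.2 ⟨hxS, hst⟩)
        (by
          rw [h]
          intro y hy
          rcases List.mem_cons.1 hy with rfl | hy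
          · exact hxW
          · exact hW y hy)
        (by
          rw [h]
          intro y hy
          rcases List.mem_cons.1 hy with rfl | hy
          · exact mem_vars_instanceOf.2 ⟨C, hC, hx⟩
          · exact hI y hy)
      rw [h] at h₂
      exact ⟨h₁, fun y hy => h₂ (List.mem_cons_of_mem _ hy), h₃⟩

/-- On non-separating instances the algorithm finds a solution. -/
theorem findBackdoor_spec [NeZero q] [NeZero d] (hΓ : ∀ i, ClosedUnderAssignments (Γ i))
    (hI : ∀ C ∈ I, ∀ t ∈ C.2, t.length = C.1.length) (hS : S.Nodup)
    (h : IsNonSeparatingInstance Γ (instanceOf toConstraint I) k.length S.toFinset W.toFinset)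
    {N : List Unit} (hN : k.length * (k.length + 2) ≤ N.length) :
    (findBackdoor (rawLanguages Γ) I (words (List.finRange q) k)
      (words (letters (d * (maxArity Γ + 1) + 2)) N) k S W).Nodup ∧
    IsSolution Γ (instanceOf toConstraint I) k.length S.toFinset W.toFinset
      (findBackdoor (rawLanguages Γ) I (words (List.finRange q) k)
        (words (letters (d * (maxArity Γ + 1) + 2)) N) k S W).toFinset := by
  obtain ⟨⟨hSW, hbd, -⟩, Z, ⟨hZ, hZk, hSZ, hZW⟩, hconn⟩ := h
  have hρ : ∀ C ∈ I, (C.1.filter fun x => !decide (x ∈ S) && !decide (x ∈ W)).length ≤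
      maxArity Γ := by
    intro C hC
    obtain ⟨P, hP, -, -, hPΓ⟩ := hbd.2 fun _ => 0
    obtain ⟨i, hi⟩ := (hP _).1 (Finset.mem_image_of_mem _
      (List.mem_toFinset.2 (List.mem_map_of_mem (f := toConstraint) hC)))
    have h₁ := hPΓ i _ hi
    have h₂ : _ ≤ (Γ i).sup Relation.arity := Finset.le_sup h₁
    have h₃ : (Γ i).sup Relation.arity ≤ maxArity Γ :=
      Finset.le_sup (f := fun i => (Γ i).sup Relation.arity) (Finset.mem_univ i)
    refine le_trans (le_of_eq ?_) (h₂.trans h₃)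
    simp only [Constraint.rel, Constraint.restrict, toConstraint]
    congr 1
    refine List.filter_congr fun x _ => ?_
    by_cases hxS : x ∈ S <;> by_cases hxW : x ∈ W <;> simp [hxS, hxW]
  have hprom := isPromising_nil (k := k.length) hS (hZ.isGood hZW hconn) hSZ hZ.1 hZW hZk
  obtain ⟨cs, hcs, hacc⟩ := hprom.exists_accepts hΓ hI hρ N (List.Subset.refl _)
    ((Nat.mul_le_mul (Nat.sub_le _ _) le_rfl).trans (by omega))
  -- The output is the first component of some accepted state.
  obtain ⟨st, hst, hout⟩ : ∃ st, st ∈ ((words (letters (d * (maxArity Γ + 1) + 2)) N).map fun cs =>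
      run (rawLanguages Γ) I (words (List.finRange q) k) (() :: k) W (S, []) cs).filter
        (accepts (rawLanguages Γ) I (words (List.finRange q) k) k W) ∧
      findBackdoor (rawLanguages Γ) I (words (List.finRange q) k)
        (words (letters (d * (maxArity Γ + 1) + 2)) N) k S W = st.1 := by
    have hmem := List.mem_filter.2 ⟨List.mem_map_of_mem (f := fun cs =>
      run (rawLanguages Γ) I (words (List.finRange q) k) (() :: k) W (S, []) cs) hcs, hacc⟩
    unfold findBackdoor
    cases hl : ((words (letters (d * (maxArity Γ + 1) + 2)) N).map fun cs =>
      run (rawLanguages Γ) I (words (List.finRange q) k) (() :: k) W (S, []) cs).filter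
        (accepts (rawLanguages Γ) I (words (List.finRange q) k) k W) with
    | nil => simp [hl] at hmem
    | cons st l => exact ⟨st, by simp, by simp⟩
  rw [hout]
  obtain ⟨hst, hacc⟩ := List.mem_filter.1 hst
  obtain ⟨cs, -, rfl⟩ := List.mem_map.1 hst
  have hSI : ∀ x ∈ S, x ∈ (instanceOf toConstraint I).vars := fun x hx =>
    hbd.1 (Finset.mem_union_right _ (List.mem_toFinset.2 hx))
  obtain ⟨h₁, h₂, h₃, h₄⟩ := run_invariant (Γ := rawLanguages Γ)
    (ws := words (List.finRange q) k) (n := () :: k) cs (S, []) hS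
    (fun x hx hxW => Finset.disjoint_left.1 hSW (List.mem_toFinset.2 hx) (List.mem_toFinset.2 hxW))
    hSI
  generalize run (rawLanguages Γ) I (words (List.finRange q) k) (() :: k) W (S, []) cs = st at *
  simp only [accepts, Bool.and_eq_true, List.isEmpty_iff, List.drop_eq_nil_iff] at hacc
  have hgood := (conflict_eq_nil_iff hI h₁ hacc.1).1 hacc.2
  have hSub : S.toFinset ⊆ st.1.toFinset := fun x hx =>
    List.mem_toFinset.2 (h₂ (List.mem_toFinset.1 hx))
  refine ⟨h₁, hgood.isStrongBackdoor hΓ hbd hSub fun x hx => h₄ x (List.mem_toFinset.1 hx), ?_,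
    hSub, ?_⟩
  · rw [List.toFinset_card_of_nodup h₁]
    exact hacc.1
  · rw [Finset.disjoint_left]
    exact fun x hx hxW => h₃ x (List.mem_toFinset.1 hx) (List.mem_toFinset.1 hxW)

end Search

/-! ### Running time -/

section Time

variable {ι : Type} {κ σ : ι → ℕ} {g g' : ι → ℕ}

/-- The function `g` is bounded by `2 ^ O(κ) * σ ^ O(1)`. -/
def FPTBounded (κ σ : ι → ℕ) (g : ι → ℕ) : Prop := ∃ c, ∀ i, g i ≤ 2 ^ (c * κ i) * σ i ^ c

theorem FPTBounded.of_le (h : FPTBounded κ σ g) (hle : ∀ i, g' i ≤ g i) : FPTBounded κ σ g' :=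
  let ⟨c, hc⟩ := h
  ⟨c, fun i => (hle i).trans (hc i)⟩

theorem FPTBounded.size : FPTBounded κ σ σ :=
  ⟨1, fun i => by simpa using Nat.le_mul_of_pos_left _ (Nat.two_pow_pos _)⟩

theorem FPTBounded.two_pow (c : ℕ) (hσ : ∀ i, 0 < σ i) : FPTBounded κ σ fun i => 2 ^ (c * κ i) :=
  ⟨c, fun i => Nat.le_mul_of_pos_right _ (Nat.pow_pos (hσ i))⟩

theorem FPTBounded.mul (h : FPTBounded κ σ g) (h' : FPTBounded κ σ g') :
    FPTBounded κ σ fun i => g i * g' i := by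
  obtain ⟨c, hc⟩ := h
  obtain ⟨c', hc'⟩ := h'
  refine ⟨c + c', fun i => (Nat.mul_le_mul (hc i) (hc' i)).trans (le_of_eq ?_)⟩
  rw [add_mul, pow_add, pow_add]
  ring

theorem FPTBounded.const (hκ : ∀ i, 0 < κ i) (hσ : ∀ i, 0 < σ i) (n : ℕ) :
    FPTBounded κ σ fun _ => n :=
  (FPTBounded.two_pow n hσ).of_le fun i => Nat.lt_two_pow_self.le.trans
    (Nat.pow_le_pow_right (by omega) (Nat.le_mul_of_pos_right _ (hκ i)))

theorem FPTBounded.pow (hκ : ∀ i, 0 < κ i) (hσ : ∀ i, 0 < σ i) (h : FPTBounded κ σ g) (n : ℕ) :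
    FPTBounded κ σ fun i => g i ^ n := by
  induction n with
  | zero => simpa using FPTBounded.const hκ hσ 1
  | succ n ih => simpa [pow_succ] using ih.mul h

theorem FPTBounded.add (hκ : ∀ i, 0 < κ i) (hσ : ∀ i, 0 < σ i) (h : FPTBounded κ σ g)
    (h' : FPTBounded κ σ g') : FPTBounded κ σ fun i => g i + g' i := by
  obtain ⟨c, hc⟩ := h
  obtain ⟨c', hc'⟩ := h'
  have hle : ∀ (a b : ℕ), a ≤ b → ∀ i, 2 ^ (a * κ i) * σ i ^ a ≤ 2 ^ (b * κ i) * σ i ^ b :=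
    fun a b hab i => Nat.mul_le_mul
      (Nat.pow_le_pow_right (by omega) (Nat.mul_le_mul hab le_rfl))
      (Nat.pow_le_pow_right (hσ i) hab)
  refine ((FPTBounded.const hκ hσ 2).mul ⟨c + c', fun i => le_rfl⟩).of_le fun i => ?_
  have h₁ := (hc i).trans (hle c (c + c') (by omega) i)
  have h₂ := (hc' i).trans (hle c' (c + c') (by omega) i)
  omega

theorem FPTBounded.comp {α : Type} [Coded α] (hκ : ∀ i, 0 < κ i) (hσ : ∀ i, 0 < σ i)
    {T : α → ℕ} (hT : PolyBounded T) {f : ι → α} (hf : FPTBounded κ σ fun i => csize (f i)) :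
    FPTBounded κ σ fun i => T (f i) := by
  obtain ⟨c, hc⟩ := hT
  exact ((FPTBounded.const hκ hσ c).mul (hf.pow hκ hσ c)).of_le fun i => hc (f i)

theorem csize_flatMap_cons_le {α : Type} [Coded α] (A : List α) (ws : List (List α)) :
    csize (A.flatMap fun a => ws.map fun w => a :: w) ≤ 2 * csize A * csize ws := by
  have hmap : ∀ (a : α) (ws : List (List α)),
      csize (ws.map fun w => a :: w) ≤ (csize a + 2) * csize ws := by
    intro a ws
    induction ws with
    | nil => simp
    | cons w ws ih =>
      simp only [List.map_cons, csize_cons, mul_add]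
      have := Nat.le_mul_of_pos_left (csize w) (show 0 < csize a + 2 by omega)
      omega
  induction A with
  | nil =>
    have := csize_pos ws
    simp; omega
  | cons a A ih =>
    have h₁ := hmap a ws
    have h₂ := csize_append (ws.map fun w => a :: w) (A.flatMap fun a => ws.map fun w => a :: w)
    have h₃ : 2 * csize (a :: A) * csize ws =
        (csize a + 2) * csize ws + csize a * csize ws + 2 * csize A * csize ws := by
      rw [csize_cons]; ring
    rw [List.flatMap_cons]
    omega

/-- The list of all words of length `n` is computed in time `2 ^ O(n)`. -/
theorem exists_program_words {α : Type} [Coded α] (A : List α) :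
    ∃ (p : Program) (c : ℕ), ∀ n : List Unit, ∃ t ≤ 2 ^ (c * (n.length + 1)),
      Eval p (code n) (code (words A n)) t := by
  obtain ⟨p, c, hp⟩ := PolyTime.exists_program_foldl
    (h := fun (_ : Unit) (ws : List (List α)) (_ : Unit) =>
      A.flatMap fun a => ws.map fun w => a :: w)
    (by fun_prop)
  have hin : PolyTime fun n : List Unit => ((), n, ([[]] : List (List α))) := by fun_prop
  obtain ⟨p₀, T₀, ⟨c₀, hT₀⟩, hp₀⟩ := hin
  set D := 2 * csize A with hD
  have hD2 : 2 ≤ D := by have := csize_pos A; omega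
  have hsize : ∀ n : List Unit, csize (words A n) ≤ 3 * D ^ n.length := by
    have key : ∀ (n : List Unit) (ws : List (List α)),
        csize (n.foldl (fun ws _ => A.flatMap fun a => ws.map fun w => a :: w) ws) ≤
          csize ws * D ^ n.length := by
      intro n
      induction n with
      | nil => simp
      | cons x n ih =>
        intro ws
        refine (ih _).trans
          ((Nat.mul_le_mul (csize_flatMap_cons_le A ws) le_rfl).trans (le_of_eq ?_))
        rw [List.length_cons, pow_succ]
        ring
    exact fun n => key n [[]]
  have hn : ∀ n : List Unit, csize n ≤ 3 * D ^ n.length := by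
    intro n
    have h₁ : csize n = 2 * n.length + 1 := by
      induction n with
      | nil => rfl
      | cons x n ih => rw [csize_cons, ih, List.length_cons]; simp [csize, code, Data.size]; omega
    have h₂ : n.length < D ^ n.length := Nat.lt_pow_self (by omega)
    omega
  have hM : ∀ n : List Unit, 3 * D ^ n.length ≤ 2 ^ ((D + 2) * (n.length + 1)) := by
    intro n
    calc 3 * D ^ n.length ≤ 2 ^ 2 * (2 ^ D) ^ n.length :=
          Nat.mul_le_mul (by norm_num) (Nat.pow_le_pow_left Nat.lt_two_pow_self.le _)
      _ = 2 ^ (2 + D * n.length) := by rw [← pow_mul, ← pow_add]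
      _ ≤ _ := Nat.pow_le_pow_right (by omega) (by nlinarith)
  -- The time is polynomial in `2 ^ ((D + 2) * (n + 1))`.
  refine ⟨.comp p p₀, (c₀ + (D + 2) * c₀) + (c + (D + 2) * c) + 2, fun n => ?_⟩
  obtain ⟨t₀, ht₀, hE₀⟩ := hp₀ n
  obtain ⟨t, ht, hE⟩ := hp () n [[]] (3 * D ^ n.length)
    (by
      have := Nat.pow_pos (n := n.length) (show 0 < D by omega)
      simp [csize, code, Data.size]
      omega)
    (hn n) (fun l' hl' => (hsize l').trans
      (Nat.mul_le_mul le_rfl (Nat.pow_le_pow_right (by omega) hl'.length_le)))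
  refine ⟨_, ?_, .comp hE₀ hE⟩
  have hbound : ∀ a s, s ≤ 3 * D ^ n.length →
      a * s ^ a ≤ 2 ^ ((a + (D + 2) * a) * (n.length + 1)) := by
    intro a s hs
    calc a * s ^ a ≤ 2 ^ a * (2 ^ ((D + 2) * (n.length + 1))) ^ a :=
          Nat.mul_le_mul Nat.lt_two_pow_self.le (Nat.pow_le_pow_left (hs.trans (hM n)) a)
      _ = 2 ^ (a + (D + 2) * (n.length + 1) * a) := by rw [← pow_mul, ← pow_add]
      _ ≤ _ := Nat.pow_le_pow_right (by omega) (by nlinarith)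
  have h₁ := (ht₀.trans (hT₀ n)).trans (hbound c₀ _ (hn n))
  have h₂ := ht.trans (hbound c _ le_rfl)
  have h₃ := hsize n
  rw [show (c₀ + (D + 2) * c₀ + (c + (D + 2) * c) + 2) * (n.length + 1) =
    (c₀ + (D + 2) * c₀) * (n.length + 1) + (c + (D + 2) * c) * (n.length + 1) +
      2 * (n.length + 1) by ring, pow_add, pow_add]
  generalize 2 ^ ((c₀ + (D + 2) * c₀) * (n.length + 1)) = x at *
  generalize 2 ^ ((c + (D + 2) * c) * (n.length + 1)) = y at *
  have hx : 0 < x := (hE₀.size_le.trans h₁).trans_lt' (Data.size_pos _)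
  have hy : 0 < y := (hE.size_le.trans h₂).trans_lt' (Data.size_pos _)
  have h₄ : 2 ^ 2 ≤ 2 ^ (2 * (n.length + 1)) := Nat.pow_le_pow_right (by omega) (by omega)
  have h₅ := Nat.mul_le_mul (le_refl (x * y)) h₄
  have h₆ := Nat.le_mul_of_pos_right x hy
  have h₇ := Nat.le_mul_of_pos_left y hx
  omega

end Time

section Main

variable {q d : ℕ}

theorem csize_replicate_unit (n : ℕ) : csize (List.replicate n ()) = 2 * n + 1 := by
  induction n with
  | zero => rfl
  | succ n ih => rw [List.replicate_succ, csize_cons, ih]; simp [csize, code, Data.size]; omega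

/-- A list of distinct variables of an instance is not much larger than the instance. -/
theorem csize_vars_le {I : List (RawConstraint q)} {S : List ℕ} (hS : S.Nodup)
    (hSI : ∀ x ∈ S, x ∈ (instanceOf toConstraint I).vars) :
    csize S ≤ csize I * (csize I + 1) + 1 := by
  have hlen : ∀ J : List (RawConstraint q), (J.flatMap Prod.fst).length ≤ csize J := by
    intro J
    induction J with
    | nil => simp
    | cons C J ih =>
      have h₁ := length_lt_csize C.1
      have h₂ : csize C = csize C.1 + csize C.2 + 1 := rfl
      rw [List.flatMap_cons, List.length_append, csize_cons]
      omega
  have hmem : ∀ x ∈ S, ∃ C ∈ I, x ∈ C.1 := fun x hx => mem_vars_instanceOf.1 (hSI x hx)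
  refine (csize_le_of_forall (M := csize I) fun x hx => ?_).trans
    (Nat.add_le_add_right (Nat.mul_le_mul ?_ le_rfl) 1)
  · obtain ⟨C, hC, hxC⟩ := hmem x hx
    have h₁ := csize_le_of_mem hxC
    have h₂ := csize_le_of_mem hC
    have h₃ : csize C = csize C.1 + csize C.2 + 1 := rfl
    omega
  · exact ((hS.subperm fun x hx => List.mem_flatMap.2 (hmem x hx)).length_le).trans (hlen I)

/-- A list whose length bounds the number of choices of the algorithm. -/
def choiceClock (k : List Unit) : List Unit := k.flatMap fun _ => () :: () :: k

theorem length_choiceClock (k : List Unit) :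
    (choiceClock k).length = k.length * (k.length + 2) := by
  simp [choiceClock]

/-- Listing the words takes time `2 ^ O(k ^ 2)`, and everything else is polynomial in the size of
the input together with the words. -/
theorem exists_program_findBackdoor (Γ : List (List (RawRelation q))) (B : ℕ) :
    ∃ (p : Program) (c : ℕ), ∀ (I : List (RawConstraint q)) (k : List Unit) (S W : List ℕ),
      S.Nodup → W.Nodup → (∀ x ∈ S, x ∈ (instanceOf toConstraint I).vars) →
      (∀ x ∈ W, x ∈ (instanceOf toConstraint I).vars) →
      ∃ t ≤ 2 ^ (c * (k.length ^ 2 + 1)) * csize I ^ c,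
        Eval p (code (I, k, S, W)) (code (findBackdoor Γ I (words (List.finRange q) k)
          (words (letters B) (choiceClock k)) k S W)) t := by
  let ι := {a : List (RawConstraint q) × List Unit × List ℕ × List ℕ //
    a.2.2.1.Nodup ∧ a.2.2.2.Nodup ∧ (∀ x ∈ a.2.2.1, x ∈ (instanceOf toConstraint a.1).vars) ∧
      ∀ x ∈ a.2.2.2, x ∈ (instanceOf toConstraint a.1).vars}
  let κ : ι → ℕ := fun a => a.1.2.1.length ^ 2 + 1
  let σ : ι → ℕ := fun a => csize a.1.1
  have hκ : ∀ a, 0 < κ a := fun a => Nat.succ_pos _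
  have hσ : ∀ a, 0 < σ a := fun a => csize_pos _
  have hconst := FPTBounded.const hκ hσ
  -- The size of the input.
  have hin : FPTBounded κ σ fun a : ι => csize a.1 := by
    have hk : FPTBounded κ σ fun a : ι => csize a.1.2.1 := by
      refine (FPTBounded.two_pow 2 hσ).of_le fun a => ?_
      have h₁ : a.1.2.1 = List.replicate a.1.2.1.length () := List.eq_replicate_of_mem (by simp)
      have h₂ : a.1.2.1.length ≤ a.1.2.1.length ^ 2 := Nat.le_self_pow (by omega) _
      rw [h₁, csize_replicate_unit]
      refine le_trans ?_ (Nat.lt_two_pow_self (n := 2 * κ a)).le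
      simp only [κ]
      omega
    have hvars : FPTBounded κ σ fun a => σ a * (σ a + 1) + 1 :=
      (FPTBounded.size.mul (FPTBounded.size.add hκ hσ (hconst 1))).add hκ hσ (hconst 1)
    refine ((((FPTBounded.size (κ := κ) (σ := σ)).add hκ hσ hk).add hκ hσ hvars).add hκ hσ
      hvars).add hκ hσ (hconst 3) |>.of_le fun a => ?_
    have h₁ := csize_vars_le a.2.1 a.2.2.2.1
    have h₂ := csize_vars_le a.2.2.1 a.2.2.2.2
    have h₃ : csize a.1 = csize a.1.1 + (csize a.1.2.1 + (csize a.1.2.2.1 + csize a.1.2.2.2 + 1)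
      + 1) + 1 := rfl
    simp only [σ]
    omega
  -- The two lists of words.
  obtain ⟨p₁, c₁, h₁⟩ := exists_program_words (List.finRange q)
  obtain ⟨p₂, c₂, h₂⟩ := exists_program_words (letters B)
  have hk : PolyTime fun a : List (RawConstraint q) × List Unit × List ℕ × List ℕ => a.2.1 := by
    fun_prop
  have hclock : PolyTime fun a : List (RawConstraint q) × List Unit × List ℕ × List ℕ =>
      choiceClock a.2.1 := by
    unfold choiceClock
    fun_prop
  have hmain : PolyTime fun b : List (List (Fin q)) × List (List (List Unit)) ×
      List (RawConstraint q) × List Unit × List ℕ × List ℕ =>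
      findBackdoor Γ b.2.2.1 b.1 b.2.1 b.2.2.2.1 b.2.2.2.2.1 b.2.2.2.2.2 := by
    fun_prop
  obtain ⟨pk, Tk, hTk, hpk⟩ := hk
  obtain ⟨pc, Tc, hTc, hpc⟩ := hclock
  obtain ⟨pm, Tm, hTm, hpm⟩ := hmain
  let env : ι → List (List (Fin q)) × List (List (List Unit)) ×
      List (RawConstraint q) × List Unit × List ℕ × List ℕ := fun a =>
    (words (List.finRange q) a.1.2.1, words (letters B) (choiceClock a.1.2.1), a.1)
  have hw₁ : FPTBounded κ σ fun a : ι => 2 ^ (c₁ * (a.1.2.1.length + 1)) := by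
    refine (FPTBounded.two_pow (2 * c₁) hσ).of_le fun a => Nat.pow_le_pow_right (by omega) ?_
    have : a.1.2.1.length + 1 ≤ 2 * κ a := by simp only [κ]; nlinarith
    calc c₁ * (a.1.2.1.length + 1) ≤ c₁ * (2 * κ a) := Nat.mul_le_mul le_rfl this
      _ = 2 * c₁ * κ a := by ring
  have hw₂ : FPTBounded κ σ fun a : ι => 2 ^ (c₂ * ((choiceClock a.1.2.1).length + 1)) := by
    refine (FPTBounded.two_pow (2 * c₂) hσ).of_le fun a => Nat.pow_le_pow_right (by omega) ?_
    have : (choiceClock a.1.2.1).length + 1 ≤ 2 * κ a := by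
      rw [length_choiceClock]
      simp only [κ]
      zify
      nlinarith [sq_nonneg ((a.1.2.1.length : ℤ) - 1)]
    calc c₂ * ((choiceClock a.1.2.1).length + 1) ≤ c₂ * (2 * κ a) := Nat.mul_le_mul le_rfl this
      _ = 2 * c₂ * κ a := by ring
  have henv : FPTBounded κ σ fun a => csize (env a) := by
    refine ((hw₁.add hκ hσ hw₂).add hκ hσ hin).add hκ hσ (hconst 2) |>.of_le fun a => ?_
    obtain ⟨t₁, ht₁, hE₁⟩ := h₁ a.1.2.1
    obtain ⟨t₂, ht₂, hE₂⟩ := h₂ (choiceClock a.1.2.1)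
    have h₃ : csize (words (List.finRange q) a.1.2.1) ≤ t₁ := hE₁.size_le
    have h₄ : csize (words (letters B) (choiceClock a.1.2.1)) ≤ t₂ := hE₂.size_le
    have h₅ : csize (env a) = csize (words (List.finRange q) a.1.2.1) +
      (csize (words (letters B) (choiceClock a.1.2.1)) + csize a.1 + 1) + 1 := rfl
    omega
  have htotal : FPTBounded κ σ fun a : ι =>
      (Tk a.1 + Tc a.1) + (2 ^ (c₁ * (a.1.2.1.length + 1)) +
        2 ^ (c₂ * ((choiceClock a.1.2.1).length + 1))) + csize a.1 + 2 * csize (env a) +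
        Tm (env a) + 3 := by
    refine FPTBounded.add hκ hσ (FPTBounded.add hκ hσ (FPTBounded.add hκ hσ (FPTBounded.add hκ hσ
      (FPTBounded.add hκ hσ (FPTBounded.add hκ hσ ?_ ?_) (hw₁.add hκ hσ hw₂)) hin)
        ((hconst 2).mul henv)) ?_) (hconst 3)
    · exact FPTBounded.comp hκ hσ hTk hin
    · exact FPTBounded.comp hκ hσ hTc hin
    · exact FPTBounded.comp hκ hσ hTm henv
  obtain ⟨c, hc⟩ := htotal
  refine ⟨.comp pm (.pair (.comp p₁ pk) (.pair (.comp p₂ pc) .id)), c,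
    fun I k S W hS hW hSI hWI => ?_⟩
  have hc' := hc ⟨(I, k, S, W), hS, hW, hSI, hWI⟩
  obtain ⟨tk, htk, hEk⟩ := hpk (I, k, S, W)
  obtain ⟨tc, htc, hEc⟩ := hpc (I, k, S, W)
  obtain ⟨t₁, ht₁, hE₁⟩ := h₁ k
  obtain ⟨t₂, ht₂, hE₂⟩ := h₂ (choiceClock k)
  obtain ⟨tm, htm, hEm⟩ := hpm (env ⟨(I, k, S, W), hS, hW, hSI, hWI⟩)
  refine ⟨_, le_trans ?_ hc', .comp (.pair (.comp hEk hE₁) (.pair (.comp hEc hE₂) (.id _))) hEm⟩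
  have h₃ : csize (env ⟨(I, k, S, W), hS, hW, hSI, hWI⟩) =
    (code (words (List.finRange q) k)).size + ((code (words (letters B) (choiceClock k))).size +
      (code (I, k, S, W)).size + 1) + 1 := rfl
  simp only [Data.size]
  have h₄ : csize (I, k, S, W) = (code (I, k, S, W)).size := rfl
  omega

/-! ### Encodings of the input and the output -/

/-- Sets of variables are encoded by lists without repetitions. -/
theorem encodesVars_iff {S : Finset ℕ} {x : Data} :
    EncodesVars S x ↔ ∃ l : List ℕ, l.Nodup ∧ l.toFinset = S ∧ x = code l := by
  have hmap : ∀ (l : List ℕ) (xs : List Data),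
      List.Forall₂ (fun v y => y = Data.ofNat v) l xs ↔ xs = l.map Data.ofNat := by
    intro l
    induction l with
    | nil => simp
    | cons a l ih =>
      intro xs
      cases xs with
      | nil => simp
      | cons y xs => simp [ih]
  constructor
  · rintro ⟨l, xs, hl, hxs, rfl⟩
    rw [hmap] at hxs
    subst hxs
    have hnd : l.Nodup := by
      have := S.nodup
      rwa [← hl, Multiset.coe_nodup] at this
    refine ⟨l, hnd, ?_, rfl⟩
    ext x
    rw [List.mem_toFinset, ← Finset.mem_val, ← hl, Multiset.mem_coe]
  · rintro ⟨l, hl, rfl, rfl⟩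
    refine ⟨l, _, ?_, (hmap _ _).2 rfl, rfl⟩
    rw [List.toFinset_val, hl.dedup]

/-- An encoding of a constraint is the code of a presentation of the constraint in which all tuples
have the right length. -/
theorem EncodesConstraint.exists_raw {C : Constraint q} {x : Data} (h : EncodesConstraint C x) :
    ∃ r : RawConstraint q, x = code r ∧ toConstraint r = C ∧ ∀ t ∈ r.2, t.length = r.1.length := by
  obtain ⟨_, ⟨l, xs, hl, hxs, rfl⟩, rfl⟩ := h
  have hmap : xs = l.map fun t => code t := by
    clear hl
    induction hxs with
    | nil => rfl
    | @cons t _ _ _ h _ ih =>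
      have ht : (do let a ← t; pure (a : ℕ)) = t.map fun a : Fin q => (a : ℕ) :=
        List.map_eq_flatMap.symm
      rw [ih, h, ht, List.map_map]
      rfl
  have hmem : ∀ t, t ∈ C.tuples ↔ t ∈ l := fun t => by
    rw [← Finset.mem_val, ← hl, Multiset.mem_coe]
  have hlen : ∀ t ∈ l, t.length = C.scope.length := fun t ht => C.length_eq t ((hmem t).2 ht)
  refine ⟨(C.scope, l), by rw [hmap]; rfl, ?_, hlen⟩
  ext1
  · rfl
  · ext t
    simp only [toConstraint, List.mem_toFinset, List.mem_filter, decide_eq_true_eq, hmem]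
    exact ⟨fun h => h.1, fun h => ⟨h, hlen t h⟩⟩

theorem EncodesInstance.exists_raw {I : Instance q} {x : Data} (h : EncodesInstance I x) :
    ∃ rs : List (RawConstraint q), x = code rs ∧ instanceOf toConstraint rs = I ∧
      ∀ r ∈ rs, ∀ t ∈ r.2, t.length = r.1.length := by
  obtain ⟨l, xs, hl, hxs, rfl⟩ := h
  have key : ∃ rs : List (RawConstraint q), Data.ofList xs = code rs ∧
      rs.map toConstraint = l ∧ ∀ r ∈ rs, ∀ t ∈ r.2, t.length = r.1.length := by
    clear hl
    induction hxs with
    | nil => exact ⟨[], rfl, rfl, by simp⟩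
    | cons h _ ih =>
      obtain ⟨r, rfl, rfl, hr⟩ := h.exists_raw
      obtain ⟨rs, h₁, rfl, h₂⟩ := ih
      refine ⟨r :: rs, ?_, rfl, ?_⟩
      · rw [Data.ofList, h₁]
        rfl
      · intro r' hr'
        rcases List.mem_cons.1 hr' with rfl | hr'
        · exact hr
        · exact h₂ r' hr'
  obtain ⟨rs, h₁, rfl, h₂⟩ := key
  refine ⟨rs, h₁, ?_, h₂⟩
  ext C
  rw [instanceOf, List.mem_toFinset, ← Finset.mem_val, ← hl, Multiset.mem_coe]

theorem unary_eq_code (k : ℕ) : Data.unary k = code (List.replicate k ()) := by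
  simp only [Data.unary, code, List.map_replicate]

end Main
end SBD

theorem mainTheorem3 (q d : ℕ) [NeZero q] (Γ : Fin d → Finset (SBD.Relation q))
    (hclosed : ∀ i, SBD.ClosedUnderAssignments (Γ i))
    (hfull : ∀ i, SBD.Relation.full q 2 ∈ Γ i) :
    ∃ (p : SBD.Program) (c : ℕ),
      ∀ (I : SBD.Instance q) (k : ℕ) (S W : Finset ℕ),
        SBD.IsNonSeparatingInstance Γ I k S W →
        ∀ x s w : SBD.Data,
          SBD.EncodesInstance I x → SBD.EncodesVars S s → SBD.EncodesVars W w →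
          ∃ (y : SBD.Data) (t : ℕ),
            SBD.Eval p (.pair x (.pair (SBD.Data.unary k) (.pair s w))) y t ∧
            t ≤ 2 ^ (c * (k ^ 2 + 1)) * x.size ^ c ∧
            ∃ Z : Finset ℕ, SBD.IsSolution Γ I k S W Z ∧ SBD.EncodesVars Z y := by
  rcases Nat.eq_zero_or_pos d with rfl | hd
  · -- Without languages only the empty instance is non-separating.
    refine ⟨.nil, 1, fun I k S W h x s w _ _ _ => ⟨.nil, 1, .nil _, ?_, ?_⟩⟩
    · exact Nat.mul_pos (Nat.two_pow_pos _) (Nat.pow_pos (SBD.Data.size_pos x))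
    · obtain ⟨-, Z, hZ, -⟩ := h
      have hI : I = ∅ := by
        obtain ⟨P, hP, -⟩ := hZ.1.2 fun _ => 0
        refine Finset.eq_empty_of_forall_notMem fun C hC => ?_
        obtain ⟨i, -⟩ := (hP _).1 (Finset.mem_image_of_mem _ hC)
        exact i.elim0
      have hZ0 : Z = ∅ := by
        have := hZ.1.1
        rw [hI] at this
        exact Finset.subset_empty.1 this
      rw [hZ0] at hZ
      exact ⟨∅, hZ, SBD.encodesVars_iff.2 ⟨[], List.nodup_nil, rfl, rfl⟩⟩
  · have : NeZero d := ⟨hd.ne'⟩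
    obtain ⟨p, c, hp⟩ := SBD.exists_program_findBackdoor (SBD.rawLanguages Γ)
      (d * (SBD.maxArity Γ + 1) + 2)
    refine ⟨p, c, fun I k S W h x s w hx hs hw => ?_⟩
    obtain ⟨rs, rfl, rfl, hrs⟩ := hx.exists_raw
    obtain ⟨S, hS, rfl, rfl⟩ := SBD.encodesVars_iff.1 hs
    obtain ⟨W, hW, rfl, rfl⟩ := SBD.encodesVars_iff.1 hw
    have hWS := h.1.2.1.1
    obtain ⟨t, ht, hE⟩ := hp rs (List.replicate k ()) S W hS hW
      (fun x hx => hWS (Finset.mem_union_right _ (List.mem_toFinset.2 hx)))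
      (fun x hx => hWS (Finset.mem_union_left _ (List.mem_toFinset.2 hx)))
    have hspec := SBD.findBackdoor_spec (k := List.replicate k ()) hclosed hrs hS
      (by rwa [List.length_replicate]) (SBD.length_choiceClock _).ge
    rw [List.length_replicate] at ht hspec
    refine ⟨_, t, ?_, ht, _, hspec.2, SBD.encodesVars_iff.2 ⟨_, hspec.1, rfl, rfl⟩⟩
    rw [SBD.unary_eq_code]
    exact hE
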